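/- Let $n\ge 0$, let $x_1<\dots<x_n$ be real numbers, and let $\omega=\sum_{i=1}^n\omega_i\delta_{x_i}$, $v=\sum_{i=1}^n v_i\delta_{x_i}$ with $\omega_i\in\mathbb R$, $v_i\ge 0$ and $|\omega_i|+v_i>0$ for all $i$. For $z\in\mathbb C$, consider the equation $$-f''+\tfrac14 f=z\,\omega f+z^2\,v f\quad\text{on }\mathbb R .\qquad(*)$$ A solution is a continuous function $f:\mathbb R\to\mathbb C$ with $-f''+\frac14 f=0$ on $\mathbb R\setminus\{x_1,\dots,x_n\}$ such that the one-sided limits of $f'$ at each $x_i$ exist and satisfy $f'(x_i-)=f'(x_i+)+z\omega_i f(x_i)+z^2v_if(x_i)$. Its eigenvalues are the $z\in\mathbb C$ for which $(*)$ has a nontrivial bounded solution. Let $\phi_+(z,\cdot)$ be the solution of $(*)$ with $\phi_+(z,x)=e^{-x/2}$ for all sufficiently large $x$, and for an eigenvalue $\lambda$ (all eigenvalues are real) put $$\gamma_\lambda^2=\int_{\mathbb R}|\phi_+(\lambda,x)|^2\,d\omega(x)+2\lambda\int_{\mathbb R}|\phi_+(\lambda,x)|^2\,dv(x).$$ Let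 $a\in\mathbb R$. If $\lambda_1<\dots<\lambda_N$ are all the eigenvalues of $(*)$ and $$\varphi_i(x)=\frac{\phi_+(\lambda_i,x)}{\sqrt{\lambda_i\gamma_{\lambda_i}^2}},$$ then $\{\lambda_i,\varphi_i(a)\}_{i=1}^N$ is called the interior spectral data of $(\omega,v)$ at $a$. **Theorem.** Let $a\in\mathbb R$, $N\ge 1$, and let $\lambda_1,\dots,\lambda_N,\alpha_1,\dots,\alpha_N$ be real numbers. Then $\{\lambda_i,\alpha_i\}_{i=1}^N$ is the interior spectral data at $a$ of some $(\omega,v)$ as above (for some $n$) if and only if the following three conditions hold: (i) for every $j$ with $\alpha_j=0$, the number $\lambda_j$ is a zero of $$G(z)=\Bigl(1-\sum_{i=1}^N\alpha_i^2\Bigr)z-\sum_{i=1}^N\lambda_i\alpha_i^2+\sum_{i=1}^N\frac{\lambda_i^2\alpha_i^2}{\lambda_i-z},$$ where summands with $\alpha_i=0$ are read as identically $0$; (ii) if $\alpha_j=0$ for some $1<j<N$, then $\alpha_{j-1}\alpha_{j+1}<0$; (iii) $\{\lambda_i,\alpha_i\}_{i=1}^N\in\mathcal T$, that is, $\lambda_1<\lambda_2<\dots<\lambda_N$,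 $\sum_{i=1}^N\alpha_i^2\le 1$, and there is $j_0\in\{0,\dots,N\}$ such that $\lambda_{j_0}<0<\lambda_{j_0+1}$, $\alpha_{j_0}>0$ and $\alpha_{j_0+1}>0$, where for $j_0=0$ this means $\lambda_1>0$, $\alpha_1>0$, and for $j_0=N$ it means $\lambda_N<0$, $\alpha_N>0$. -/

import Mathlib

open Filter Topology

namespace CamassaHolm

/-- A pair of discrete measures `ω = ∑ i, w i • δ_{x i}`, `v = ∑ i, u i • δ_{x i}` on the real line,
supported on the finitely many points `x 0 < x 1 < ⋯ < x (n - 1)`, with `w i` real, `u i ≥ 0` and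
`|w i| + u i > 0`. -/
structure DiscretePair where
  /-- number of support points -/
  n : ℕ
  /-- support points -/
  x : Fin n → ℝ
  /-- weights of `ω` -/
  w : Fin n → ℝ
  /-- weights of `v` -/
  u : Fin n → ℝ
  strictMono_x : StrictMono x
  u_nonneg : ∀ i, 0 ≤ u i
  nondegenerate : ∀ i, 0 < |w i| + u i

namespace DiscretePair

/-- `f` solves `-f'' + f / 4 = z ω f + z ^ 2 v f` on the real line: the homogeneous equation holds off
the support points, `f` is continuous, and at each support point `f'` has one-sided limits related
by the jump condition `f'(x-) = f'(x+) + z w f(x) + z ^ 2 u f(x)`. -/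
def IsSolution (H : DiscretePair) (z : ℂ) (f : ℝ → ℂ) : Prop :=
  Continuous f ∧
  (∀ x : ℝ, x ∉ Set.range H.x →
    DifferentiableAt ℝ f x ∧ HasDerivAt (deriv f) (f x / 4) x) ∧
  ∀ i : Fin H.n, ∃ dl dr : ℂ,
    Tendsto (deriv f) (𝓝[<] H.x i) (𝓝 dl) ∧
    Tendsto (deriv f) (𝓝[>] H.x i) (𝓝 dr) ∧
    dl = dr + z * (H.w i : ℂ) * f (H.x i) + z ^ 2 * (H.u i : ℂ) * f (H.x i)

/-- The spectrum: the complex `z` for which there is a nontrivial bounded solution. -/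
def spectrum (H : DiscretePair) : Set ℂ :=
  {z | ∃ f : ℝ → ℂ, H.IsSolution z f ∧ (∃ x, f x ≠ 0) ∧ ∃ C : ℝ, ∀ x, ‖f x‖ ≤ C}

/-- `f` is the solution `φ₊(z, ·)`, normalised by `φ₊(z, x) = exp (-x / 2)` for all `x` near `+∞`. -/
def IsPhiPlus (H : DiscretePair) (z : ℂ) (f : ℝ → ℂ) : Prop :=
  H.IsSolution z f ∧ ∀ᶠ x : ℝ in atTop, f x = Complex.exp (-(x : ℂ) / 2)

/-- `∫ |f| ^ 2 dω + 2 l ∫ |f| ^ 2 dv`; for `f = φ₊(l, ·)` at an eigenvalue `l` this is `γ_l ^ 2`. -/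
noncomputable def gammaSq (H : DiscretePair) (l : ℝ) (f : ℝ → ℂ) : ℝ :=
  ∑ i, ‖f (H.x i)‖ ^ 2 * H.w i + 2 * l * ∑ i, ‖f (H.x i)‖ ^ 2 * H.u i

/-- `(lam i, al i)` is the interior spectral data at `a`: the `lam i`, listed in increasing order, are
exactly the eigenvalues, and `al i` is the value at `a` of the normalised eigenfunction
`φ₊(lam i, ·) / √(lam i * γ ^ 2)`. -/
def IsInteriorSpectralData (H : DiscretePair) (a : ℝ) {N : ℕ} (lam al : Fin N → ℝ) : Prop :=
  StrictMono lam ∧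
  H.spectrum = Set.range (fun i => (lam i : ℂ)) ∧
  ∀ i, ∃ f : ℝ → ℂ, H.IsPhiPlus (lam i : ℂ) f ∧
    (al i : ℂ) = f a / ((Real.sqrt (lam i * H.gammaSq (lam i) f) : ℝ) : ℂ)

end DiscretePair

/-- The rational function `G` built from the data. A summand with `al i = 0` is identically zero,
also (by the convention `0 / 0 = 0`) at `z = lam i`. -/
noncomputable def G {N : ℕ} (lam al : Fin N → ℝ) (z : ℝ) : ℝ :=
  (1 - ∑ i, al i ^ 2) * z - ∑ i, lam i * al i ^ 2 + ∑ i, lam i ^ 2 * al i ^ 2 / (lam i - z)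

/-- The class `𝒯`. Indices start at `0` here, so `j₀ : ℕ` with `j₀ ≤ N` is the number of negative
`lam i`; the last negative one has index `j₀ - 1` (absent if `j₀ = 0`), the first positive one has
index `j₀` (absent if `j₀ = N`). -/
def ClassT {N : ℕ} (lam al : Fin N → ℝ) : Prop :=
  StrictMono lam ∧ ∑ i, al i ^ 2 ≤ 1 ∧
  ∃ j₀ : ℕ, j₀ ≤ N ∧
    (∀ i : Fin N, (i : ℕ) + 1 = j₀ → lam i < 0 ∧ 0 < al i) ∧
    (∀ i : Fin N, (i : ℕ) = j₀ → 0 < lam i ∧ 0 < al i)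

end CamassaHolm

/-!
Points of a finite set `S`, some of them possibly without mass, carry the weights `w` of `ω` and
`u` of `v`. A solution of the differential equation with prescribed behaviour at `±∞` is the same
thing as a solution of a triangular system on `S` with the Volterra kernel `vol` of `-∂² + 1/4`
(`DiscretePair.isSolution_iff`, `IsJost`), so `φ₊(·, x)` is a real polynomial `phi S w u x` in the
spectral parameter. The eigenvalues are the zeros of the polynomial `wron S w u`, the coefficient
of `exp (-x / 2)` in `φ₊` near `-∞`, and `Represents.isInteriorSpectralData_iff` expresses the
interior spectral data through these polynomials.

*Necessity.* The eigenfunctions solve an integral equation with the Green kernel `ker` that is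
quadratic in `z`. As `u ≥ 0`, it linearises to an eigenvalue problem for a symmetric operator
(`pencil`), and expanding the vector that represents evaluation at `a` in its eigenvectors gives
`∑ i, al i ^ 2 ≤ 1`; at a zero `κ` of `φ₊(·, a)` the truncation of `φ₊(κ, ·)` to the right of `a`
solves an inhomogeneous resolvent equation, which forces `G κ = 0` (`bessel_and_G_eq_zero`). Between
neighbouring poles `G` is strictly monotone (`G_ne_G`), the zeros of `φ₊(·, a)` are simple
(`exists_phi_factor`, a Christoffel–Darboux identity), and `φ₊(0, a) > 0`. The signs of the `al i`
follow (`conditions_of_data`).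

*Sufficiency.* `G` is a rational Nevanlinna function `A z + b + ∑ r k / (k - z)`, and so is `-1 / G`
(`exists_nevNum_inversion`); its poles are `0` and a set `Q`. The points of `Q` are divided among the
zeros of `φ₊(·, a)` and those of the solution decaying at `-∞`: a point in a gap of the set of poles
of `G` belongs to the first set if the data change sign across the gap and to the second otherwise,
and the `lam j` with `al j = 0` belong to both, half of the residue going to each
side (`exists_split`). Each side is an inverse problem on a half-line, solved by peeling off
one mass at a time, which is a continued fraction expansion (`exists_weights_half_line`); the linear
part of `-1 / G` is the mass at `a` (`exists_weights_line`). By the choice of the sets `φ₊(·, a)`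
has the signs of the data at the eigenvalues (`mul_rootPoly_pos`), and the residues of `G` give their
absolute values (`exists_weights_of_values`).
-/

namespace CamassaHolm
open Polynomial Finset

/-! ### Volterra systems for the Green kernel -/

/-- The Green kernel `exp (-|x - y| / 2)` of `-∂² + 1/4` on the real line. -/
noncomputable def ker (x y : ℝ) : ℝ := Real.exp (-|x - y| / 2)

/-- The Volterra kernel of `-∂² + 1/4` from the right: `2 sinh ((s - x) / 2)` for `x ≤ s` and `0`
for `s ≤ x`, written as an exponential minus the Green kernel. -/
noncomputable def vol (s x : ℝ) : ℝ := Real.exp ((s - x) / 2) - ker x s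

lemma ker_comm (x y : ℝ) : ker x y = ker y x := by
  simp only [ker, abs_sub_comm]

lemma ker_self (x : ℝ) : ker x x = 1 := by simp [ker]

lemma ker_of_le {x y : ℝ} (h : x ≤ y) : ker x y = Real.exp (x / 2) * Real.exp (-y / 2) := by
  rw [ker, abs_of_nonpos (by linarith), ← Real.exp_add]; congr 1; ring

lemma ker_of_ge {x y : ℝ} (h : y ≤ x) : ker x y = Real.exp (-x / 2) * Real.exp (y / 2) := by
  rw [ker_comm, ker_of_le h, mul_comm]

lemma vol_of_le {s x : ℝ} (h : s ≤ x) : vol s x = 0 := by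
  rw [vol, ker_of_ge h, ← Real.exp_add, sub_eq_zero]; congr 1; ring

lemma vol_of_ge {s x : ℝ} (h : x ≤ s) : vol s x =
    Real.exp (s / 2) * Real.exp (-x / 2) - Real.exp (-s / 2) * Real.exp (x / 2) := by
  rw [vol, ker_of_le h, ← Real.exp_add (s / 2), mul_comm (Real.exp (-s / 2))]; congr 2; ring

lemma vol_add_ker (s x : ℝ) : vol s x = Real.exp (s / 2) * Real.exp (-x / 2) - ker x s := by
  rw [vol, ← Real.exp_add]; congr 2; ring

section Volterra

variable {R : Type*} [CommRing R] [Algebra ℝ R]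

/-- A homogeneous Volterra equation with a kernel that is strictly triangular for the order
induced by `r` has only the trivial solution. -/
lemma eq_zero_of_volterra (k : ℝ → ℝ → ℝ) (r : ℝ → ℝ) (hk : ∀ s x, r s ≤ r x → k s x = 0)
    (S : Finset ℝ) (q f : ℝ → R) (hf : ∀ x, f x = - ∑ s ∈ S, k s x • (q s * f s)) (x : ℝ) :
    f x = 0 := by
  classical
  have key : ∀ s ∈ S, f s = 0 := by
    by_contra! h
    obtain ⟨s₀, hs₀, hmax⟩ := Finset.exists_max_image (S.filter fun s => f s ≠ 0) r
      (by obtain ⟨s, hs, h⟩ := h; exact ⟨s, by simp [hs, h]⟩)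
    simp only [mem_filter] at hs₀ hmax
    apply hs₀.2
    rw [hf, Finset.sum_eq_zero, neg_zero]
    intro s hs
    by_cases h0 : f s = 0
    · simp [h0]
    · rw [hk s s₀ (hmax s ⟨hs, h0⟩), zero_smul]
  rw [hf, Finset.sum_eq_zero, neg_zero]
  intro s hs
  rw [key s hs, mul_zero, smul_zero]

/-- `f` is the Jost solution from the right for the point weights `q s`, `s ∈ S`: the equation
`-f'' + f / 4 = ∑ q s f(s) δ_s` with `f x = exp (-x / 2)` near `+∞`, in Volterra form. The weights
and values may lie in any commutative `ℝ`-algebra, so that `f` can be a number or a polynomial in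
the spectral parameter. -/
def IsJost (S : Finset ℝ) (q f : ℝ → R) : Prop :=
  ∀ x, f x = algebraMap ℝ R (Real.exp (-x / 2)) - ∑ s ∈ S, vol s x • (q s * f s)

/-- The Jost solution from the left, with `f x = exp (x / 2)` near `-∞`. -/
def IsJostLeft (S : Finset ℝ) (q f : ℝ → R) : Prop :=
  ∀ x, f x = algebraMap ℝ R (Real.exp (x / 2)) - ∑ s ∈ S, vol x s • (q s * f s)

lemma IsJost.unique {S : Finset ℝ} {q f : ℝ → R} {c : R} {g : ℝ → R} (hf : IsJost S q f)
    (hg : ∀ x, g x = algebraMap ℝ R (Real.exp (-x / 2)) * c - ∑ s ∈ S, vol s x • (q s * g s))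
    (x : ℝ) : g x = f x * c := by
  rw [← sub_eq_zero]
  refine eq_zero_of_volterra vol id (fun s x h => vol_of_le h) S q (fun x => g x - f x * c) ?_ x
  intro x
  rw [hf x, hg x, sub_mul, sub_sub_sub_cancel_left, sum_mul, ← sum_sub_distrib, ← sum_neg_distrib]
  refine sum_congr rfl fun s _ => ?_
  rw [smul_mul_assoc, ← smul_sub, ← smul_neg]
  congr 1; ring

lemma IsJostLeft.unique {S : Finset ℝ} {q f : ℝ → R} {c : R} {g : ℝ → R} (hf : IsJostLeft S q f)
    (hg : ∀ x, g x = algebraMap ℝ R (Real.exp (x / 2)) * c - ∑ s ∈ S, vol x s • (q s * g s))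
    (x : ℝ) : g x = f x * c := by
  rw [← sub_eq_zero]
  refine eq_zero_of_volterra (fun s x => vol x s) (fun x => -x)
    (fun s x h => vol_of_le (neg_le_neg_iff.1 h)) S q (fun x => g x - f x * c) ?_ x
  intro x
  rw [hf x, hg x, sub_mul, sub_sub_sub_cancel_left, sum_mul, ← sum_sub_distrib, ← sum_neg_distrib]
  refine sum_congr rfl fun s _ => ?_
  rw [smul_mul_assoc, ← smul_sub, ← smul_neg]
  congr 1; ring

/-- The Volterra system is triangular: a further point to the left of all others leaves the values
at the others unchanged. -/
lemma exists_isJost (S : Finset ℝ) (q : ℝ → R) : ∃ f, IsJost S q f := by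
  induction S using Finset.induction_on_min with
  | empty => exact ⟨fun x => algebraMap ℝ R (Real.exp (-x / 2)), fun x => by simp⟩
  | insert s₀ S hS ih =>
    obtain ⟨f, hf⟩ := ih
    have hmem : s₀ ∉ S := fun h => lt_irrefl _ (hS _ h)
    refine ⟨fun x => f x - vol s₀ x • (q s₀ * f s₀), fun x => ?_⟩
    have h0 : ∀ s ∈ insert s₀ S, vol s₀ s = 0 := by
      intro s hs
      rcases mem_insert.1 hs with rfl | hs
      · exact vol_of_le le_rfl
      · exact vol_of_le (hS s hs).le
    have h1 : ∀ s ∈ insert s₀ S, vol s x • (q s * (f s - vol s₀ s • (q s₀ * f s₀))) =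
        vol s x • (q s * f s) := fun s hs => by rw [h0 s hs, zero_smul, sub_zero]
    simp only
    rw [sum_congr rfl h1, sum_insert hmem, hf x]
    ring

/-- A chosen Jost solution; it is unique by `IsJost.unique`. -/
noncomputable def jost (S : Finset ℝ) (q : ℝ → R) : ℝ → R := (exists_isJost S q).choose

lemma isJost_jost (S : Finset ℝ) (q : ℝ → R) : IsJost S q (jost S q) :=
  (exists_isJost S q).choose_spec

lemma IsJost.map {R' : Type*} [CommRing R'] [Algebra ℝ R'] (φ : R →ₐ[ℝ] R') {S : Finset ℝ}
    {q f : ℝ → R} (hf : IsJost S q f) : IsJost S (fun s => φ (q s)) (fun s => φ (f s)) := by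
  intro x
  simp only
  rw [hf x]
  simp [map_sum]

lemma IsJostLeft.map {R' : Type*} [CommRing R'] [Algebra ℝ R'] (φ : R →ₐ[ℝ] R') {S : Finset ℝ}
    {q f : ℝ → R} (hf : IsJostLeft S q f) :
    IsJostLeft S (fun s => φ (q s)) (fun s => φ (f s)) := by
  intro x
  simp only
  rw [hf x]
  simp [map_sum]

lemma vol_neg_neg (s x : ℝ) : vol (-s) (-x) = vol x s := by
  have h : -s - -x = x - s := by ring
  rw [vol, vol, ker_comm (-x), ker_comm s, ker, ker, h]

/-- Reflection of the line turns the Jost solution from the right into the one from the left. -/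
lemma IsJost.reflect {S : Finset ℝ} {q f : ℝ → R} (hf : IsJost S q f) :
    IsJostLeft (S.image fun s => -s) (fun s => q (-s)) (fun s => f (-s)) := by
  intro x
  have h : ∀ s, vol s (-x) = vol x (-s) := fun s => by rw [← vol_neg_neg, neg_neg]
  simp only [hf (-x), neg_neg, sum_image (fun _ _ _ _ h => neg_injective h), h]

/-- The Wronskian of the two Jost solutions: the coefficient of `exp (-x / 2)` near `-∞` in the
solution from the right. -/
noncomputable def wronski (S : Finset ℝ) (q f : ℝ → R) : R :=
  1 - ∑ s ∈ S, Real.exp (s / 2) • (q s * f s)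

/-- The coefficient of `exp (x / 2)` near `-∞` in the Jost solution from the right. -/
noncomputable def growth (S : Finset ℝ) (q f : ℝ → R) : R :=
  ∑ s ∈ S, Real.exp (-s / 2) • (q s * f s)

lemma IsJost.eq_ker {S : Finset ℝ} {q f : ℝ → R} (hf : IsJost S q f) (x : ℝ) :
    f x = Real.exp (-x / 2) • wronski S q f + ∑ s ∈ S, ker x s • (q s * f s) := by
  rw [hf x, wronski, smul_sub, smul_sum, Algebra.algebraMap_eq_smul_one, sub_add, ← sum_sub_distrib]
  congr 1
  refine sum_congr rfl fun s _ => ?_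
  rw [vol_add_ker, sub_smul, mul_comm, mul_smul]

/-- Only the weights to the right of `a` enter the values on `[a, ∞)`. -/
lemma IsJost.eq_at {S : Finset ℝ} {q f : ℝ → R} (hf : IsJost S q f) {a x : ℝ} (hx : a ≤ x) :
    f x = algebraMap ℝ R (Real.exp (-x / 2))
      - ∑ s ∈ S.filter (a < ·), vol s x • (q s * f s) := by
  rw [hf x, sum_filter_of_ne]
  intro s _ hs
  by_contra h
  exact hs (by rw [vol_of_le (by linarith), zero_smul])

/-- To the left of all weights the Jost solution is a combination of the two exponentials. -/
lemma IsJost.eq_exp_of_le {S : Finset ℝ} {q f : ℝ → R} (hf : IsJost S q f) {x : ℝ}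
    (hx : ∀ s ∈ S, x ≤ s) :
    f x = Real.exp (-x / 2) • wronski S q f + Real.exp (x / 2) • growth S q f := by
  rw [hf.eq_ker x, growth, smul_sum]
  congr 1
  refine sum_congr rfl fun s hs => ?_
  rw [ker_of_le (hx s hs), mul_smul]

/-- The Jost solution on `[a, ∞)` depends only on the weights to the right of `a`. -/
lemma IsJost.restrict {S S' : Finset ℝ} {q q' f f' : ℝ → R} (hf : IsJost S q f)
    (hf' : IsJost S' q' f') {a : ℝ} (hS : S.filter (a < ·) = S'.filter (a < ·))
    (hq : ∀ s, a < s → q s = q' s) : ∀ x, a ≤ x → f x = f' x := by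
  have key : ∀ x, (if a ≤ x then f x - f' x else 0) = 0 := by
    refine eq_zero_of_volterra (fun s x => if a ≤ x then vol s x else 0) id
      (fun s x h => by simp only [vol_of_le (show s ≤ x from h), ite_self]) (S.filter (a < ·)) q _ ?_
    intro x
    split_ifs with hx
    · rw [hf.eq_at hx, hf'.eq_at hx, ← hS, sub_sub_sub_cancel_left, ← sum_sub_distrib,
        ← sum_neg_distrib]
      refine sum_congr rfl fun s hs => ?_
      have hs' := (mem_filter.1 hs).2
      rw [if_pos hs'.le, ← hq s hs', ← smul_sub, ← smul_neg]
      congr 1; ring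
    · simp
  intro x hx
  have := key x
  rw [if_pos hx] at this
  exact sub_eq_zero.1 this

end Volterra

/-! ### Solutions of the differential equation -/

/-- The right derivative in `x` of the Volterra kernel `vol s x`. -/
noncomputable def volDeriv (s x : ℝ) : ℝ := if x < s then -Real.cosh ((s - x) / 2) else 0

lemma vol_eq_sinh {s x : ℝ} (h : x ≤ s) : vol s x = 2 * Real.sinh ((s - x) / 2) := by
  rw [vol_of_ge h, Real.sinh_eq, ← Real.exp_add, ← Real.exp_add]
  have h1 : s / 2 + -x / 2 = (s - x) / 2 := by ring
  have h2 : -s / 2 + x / 2 = -((s - x) / 2) := by ring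
  rw [h1, h2]; ring

lemma continuous_vol (s : ℝ) : Continuous (vol s) := by
  unfold vol ker
  fun_prop

lemma hasDerivAt_vol {s x : ℝ} (h : x ≠ s) : HasDerivAt (vol s) (volDeriv s x) x := by
  rcases lt_or_gt_of_ne h with h | h
  · have h1 : HasDerivAt (fun y : ℝ => 2 * Real.sinh ((s - y) / 2))
        (2 * (Real.cosh ((s - x) / 2) * (-1 / 2))) x :=
      ((((hasDerivAt_id x).const_sub s).div_const 2).sinh).const_mul 2
    rw [volDeriv, if_pos h]
    refine (h1.congr_of_eventuallyEq ?_).congr_deriv (by ring)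
    filter_upwards [eventually_lt_nhds h] with y hy using vol_eq_sinh hy.le
  · rw [volDeriv, if_neg h.not_gt]
    refine (hasDerivAt_const x (0 : ℝ)).congr_of_eventuallyEq ?_
    filter_upwards [eventually_gt_nhds h] with y hy using vol_of_le hy.le

lemma hasDerivAt_volDeriv {s x : ℝ} (h : x ≠ s) :
    HasDerivAt (volDeriv s) (vol s x / 4) x := by
  rcases lt_or_gt_of_ne h with h | h
  · have h1 : HasDerivAt (fun y : ℝ => -Real.cosh ((s - y) / 2))
        (-(Real.sinh ((s - x) / 2) * (-1 / 2))) x :=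
      ((((hasDerivAt_id x).const_sub s).div_const 2).cosh).neg
    rw [vol_eq_sinh h.le]
    refine (h1.congr_of_eventuallyEq ?_).congr_deriv (by ring)
    filter_upwards [eventually_lt_nhds h] with y hy using if_pos hy
  · rw [vol_of_le h.le, zero_div]
    refine (hasDerivAt_const x (0 : ℝ)).congr_of_eventuallyEq ?_
    filter_upwards [eventually_gt_nhds h] with y hy using if_neg hy.not_gt

lemma tendsto_volDeriv_right (s x : ℝ) :
    Tendsto (volDeriv s) (𝓝[>] x) (𝓝 (volDeriv s x)) := by
  by_cases h : x = s
  · subst h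
    rw [volDeriv, if_neg (lt_irrefl _)]
    refine tendsto_const_nhds.congr' ?_
    filter_upwards [self_mem_nhdsWithin] with y hy using (if_neg (not_lt.2 (le_of_lt hy))).symm
  · exact (hasDerivAt_volDeriv h).continuousAt.tendsto.mono_left nhdsWithin_le_nhds

lemma tendsto_volDeriv_left (s x : ℝ) :
    Tendsto (volDeriv s) (𝓝[<] x) (𝓝 (volDeriv s x - if s = x then 1 else 0)) := by
  by_cases h : x = s
  · subst h
    rw [volDeriv, if_neg (lt_irrefl _), if_pos rfl]
    have h1 : Tendsto (fun y : ℝ => -Real.cosh ((x - y) / 2)) (𝓝[<] x) (𝓝 (0 - 1)) := by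
      have : Continuous (fun y : ℝ => -Real.cosh ((x - y) / 2)) := by fun_prop
      have h2 := (this.tendsto x).mono_left (nhdsWithin_le_nhds (s := Set.Iio x))
      simpa using h2
    refine h1.congr' ?_
    filter_upwards [self_mem_nhdsWithin] with y hy using (if_pos hy).symm
  · rw [if_neg (Ne.symm h), sub_zero]
    exact (hasDerivAt_volDeriv h).continuousAt.tendsto.mono_left nhdsWithin_le_nhds

/-- A continuous function with vanishing derivative off a finite set is constant. -/
lemma eq_of_hasDerivAt_zero_off_finite {T : Set ℝ} (hT : T.Finite) {h : ℝ → ℂ} (hc : Continuous h)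
    (hd : ∀ x ∉ T, HasDerivAt h 0 x) (x y : ℝ) : h x = h y := by
  have := MeasureTheory.integral_eq_of_hasDerivAt_off_countable h (fun _ => 0) (a := y) (b := x)
    hT.countable hc.continuousOn (fun z hz => hd z hz.2) (by simp)
  rw [intervalIntegral.integral_zero] at this
  exact sub_eq_zero.1 this.symm

lemma hasDerivAt_cexp_half (x : ℝ) :
    HasDerivAt (fun y : ℝ => Complex.exp ((y : ℂ) / 2)) (Complex.exp ((x : ℂ) / 2) / 2) x := by
  have h := ((Complex.ofRealCLM.hasDerivAt (x := x)).div_const 2).cexp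
  refine h.congr_deriv ?_
  simp; ring

lemma hasDerivAt_cexp_neg_half (x : ℝ) :
    HasDerivAt (fun y : ℝ => Complex.exp (-(y : ℂ) / 2)) (-Complex.exp (-(x : ℂ) / 2) / 2) x := by
  have h := ((Complex.ofRealCLM.hasDerivAt (x := x)).neg.div_const 2).cexp
  refine h.congr_deriv ?_
  simp; ring

/-- The free equation `g'' = g / 4` is solved by combinations of `exp (± x / 2)`, even if the second
derivative is only known off a finite set where `g'` is merely continuous. -/
lemma exists_eq_exp_of_free {T : Set ℝ} (hT : T.Finite) {g g' : ℝ → ℂ} (hg : Continuous g)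
    (hg' : Continuous g') (h1 : ∀ x ∉ T, HasDerivAt g (g' x) x)
    (h2 : ∀ x ∉ T, HasDerivAt g' (g x / 4) x) :
    ∃ A B : ℂ, ∀ x : ℝ, g x = A * Complex.exp ((x : ℂ) / 2) + B * Complex.exp (-(x : ℂ) / 2) := by
  have e1 : ∀ x : ℝ, Complex.exp (-(x : ℂ) / 2) * Complex.exp ((x : ℂ) / 2) = 1 := fun x => by
    rw [← Complex.exp_add]; simp [neg_div]
  have c1 : ∀ x y, (g' x + g x / 2) * Complex.exp (-(x : ℂ) / 2)
      = (g' y + g y / 2) * Complex.exp (-(y : ℂ) / 2) := by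
    refine eq_of_hasDerivAt_zero_off_finite hT
      (h := fun x => (g' x + g x / 2) * Complex.exp (-(x : ℂ) / 2)) (by fun_prop) fun x hx => ?_
    refine (((h2 x hx).add ((h1 x hx).div_const 2)).mul (hasDerivAt_cexp_neg_half x)).congr_deriv ?_
    simp; ring
  have c2 : ∀ x y, (g' x - g x / 2) * Complex.exp ((x : ℂ) / 2)
      = (g' y - g y / 2) * Complex.exp ((y : ℂ) / 2) := by
    refine eq_of_hasDerivAt_zero_off_finite hT
      (h := fun x => (g' x - g x / 2) * Complex.exp ((x : ℂ) / 2)) (by fun_prop) fun x hx => ?_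
    refine (((h2 x hx).sub ((h1 x hx).div_const 2)).mul (hasDerivAt_cexp_half x)).congr_deriv ?_
    simp; ring
  refine ⟨g' 0 + g 0 / 2, -(g' 0 - g 0 / 2), fun x => ?_⟩
  have d1 := c1 x 0
  have d2 := c2 x 0
  simp only [Complex.ofReal_zero, neg_zero, zero_div, Complex.exp_zero, mul_one] at d1 d2
  rw [← d1, ← d2]
  linear_combination (-(g x)) * e1 x

namespace DiscretePair
variable (H : DiscretePair)

/-- The weight `z ω + z ^ 2 v` at the `i`-th support point. -/
noncomputable def weight (z : ℂ) (i : Fin H.n) : ℂ := z * (H.w i : ℂ) + z ^ 2 * (H.u i : ℂ)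

/-- The part of a solution produced by the point masses. -/
noncomputable def source (z : ℂ) (f : ℝ → ℂ) (x : ℝ) : ℂ :=
  ∑ i, vol (H.x i) x • (H.weight z i * f (H.x i))

/-- The right derivative of `source`. -/
noncomputable def sourceDeriv (z : ℂ) (f : ℝ → ℂ) (x : ℝ) : ℂ :=
  ∑ i, volDeriv (H.x i) x • (H.weight z i * f (H.x i))

lemma continuous_source (z : ℂ) (f : ℝ → ℂ) : Continuous (H.source z f) := by
  unfold source
  exact continuous_finsetSum _ fun i _ => (continuous_vol _).smul continuous_const

lemma hasDerivAt_source (z : ℂ) (f : ℝ → ℂ) {x : ℝ} (hx : x ∉ Set.range H.x) :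
    HasDerivAt (H.source z f) (H.sourceDeriv z f x) x := by
  unfold source sourceDeriv
  exact HasDerivAt.fun_sum fun i _ => (hasDerivAt_vol fun h => hx ⟨i, h.symm⟩).smul_const _

lemma hasDerivAt_sourceDeriv (z : ℂ) (f : ℝ → ℂ) {x : ℝ} (hx : x ∉ Set.range H.x) :
    HasDerivAt (H.sourceDeriv z f) (H.source z f x / 4) x := by
  have h : HasDerivAt (H.sourceDeriv z f)
      (∑ i, (vol (H.x i) x / 4) • (H.weight z i * f (H.x i))) x := by
    unfold sourceDeriv
    exact HasDerivAt.fun_sum fun i _ => (hasDerivAt_volDeriv fun h => hx ⟨i, h.symm⟩).smul_const _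
  refine h.congr_deriv ?_
  rw [source, Finset.sum_div]
  refine Finset.sum_congr rfl fun i _ => ?_
  rw [div_eq_inv_mul, mul_smul, Complex.real_smul]
  push_cast; ring

lemma tendsto_sourceDeriv_right (z : ℂ) (f : ℝ → ℂ) (x : ℝ) :
    Tendsto (H.sourceDeriv z f) (𝓝[>] x) (𝓝 (H.sourceDeriv z f x)) := by
  unfold sourceDeriv
  exact tendsto_finsetSum _ fun i _ => (tendsto_volDeriv_right _ _).smul_const _

lemma tendsto_sourceDeriv_left (z : ℂ) (f : ℝ → ℂ) (j : Fin H.n) :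
    Tendsto (H.sourceDeriv z f) (𝓝[<] H.x j)
      (𝓝 (H.sourceDeriv z f (H.x j) - H.weight z j * f (H.x j))) := by
  have h : Tendsto (H.sourceDeriv z f) (𝓝[<] H.x j)
      (𝓝 (∑ i, (volDeriv (H.x i) (H.x j) - if H.x i = H.x j then (1 : ℝ) else 0) •
        (H.weight z i * f (H.x i)))) := by
    unfold sourceDeriv
    exact tendsto_finsetSum _ fun i _ => (tendsto_volDeriv_left _ _).smul_const _
  convert h using 2
  simp only [sub_smul, Finset.sum_sub_distrib, sourceDeriv, H.strictMono_x.injective.eq_iff]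
  simp [ite_smul]

lemma eventually_notMem_range (x : ℝ) : ∀ᶠ y in 𝓝[≠] x, y ∉ Set.range H.x := by
  have : ((Set.range H.x) \ {x})ᶜ ∈ 𝓝 x :=
    ((Set.finite_range H.x).sdiff.isClosed.isOpen_compl).mem_nhds (by simp)
  filter_upwards [nhdsWithin_le_nhds this, self_mem_nhdsWithin] with y hy hy' hy''
  exact hy ⟨hy'', hy'⟩

/-- Solutions in Volterra form: `source` carries the whole effect of the point masses. -/
theorem isSolution_iff (z : ℂ) (f : ℝ → ℂ) : H.IsSolution z f ↔
    ∃ A B : ℂ, ∀ x : ℝ,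
      f x = A * Complex.exp ((x : ℂ) / 2) + B * Complex.exp (-(x : ℂ) / 2) - H.source z f x := by
  have hcl : ∀ x ∉ Set.range H.x, ∀ᶠ y in 𝓝 x, y ∉ Set.range H.x := fun x hx =>
    (Set.finite_range H.x).isClosed.isOpen_compl.mem_nhds hx
  have hlt : ∀ x, ∀ᶠ y in 𝓝[<] x, y ∉ Set.range H.x := fun x =>
    (H.eventually_notMem_range x).filter_mono (nhdsWithin_mono _ fun y hy => ne_of_lt hy)
  have hgt : ∀ x, ∀ᶠ y in 𝓝[>] x, y ∉ Set.range H.x := fun x =>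
    (H.eventually_notMem_range x).filter_mono (nhdsWithin_mono _ fun y hy => ne_of_gt hy)
  constructor
  · rintro ⟨hc, hd, hj⟩
    set g : ℝ → ℂ := fun x => f x + H.source z f x with hg
    have hgc : Continuous g := hc.add (H.continuous_source z f)
    have hgd : ∀ x ∉ Set.range H.x, HasDerivAt g (deriv f x + H.sourceDeriv z f x) x :=
      fun x hx => (hd x hx).1.hasDerivAt.add (H.hasDerivAt_source z f hx)
    have hL : ∀ i, ∃ L, Tendsto (deriv g) (𝓝[<] H.x i) (𝓝 L) ∧
        Tendsto (deriv g) (𝓝[>] H.x i) (𝓝 L) := by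
      intro i
      obtain ⟨dl, dr, hl, hr, hlr⟩ := hj i
      refine ⟨dr + H.sourceDeriv z f (H.x i), ?_, ?_⟩
      · have := hl.add (H.tendsto_sourceDeriv_left z f i)
        have e : dl + (H.sourceDeriv z f (H.x i) - H.weight z i * f (H.x i)) =
            dr + H.sourceDeriv z f (H.x i) := by rw [hlr, weight]; ring
        rw [e] at this
        refine this.congr' ?_
        filter_upwards [hlt (H.x i)] with y hy using (hgd y hy).deriv.symm
      · refine (hr.add (H.tendsto_sourceDeriv_right z f (H.x i))).congr' ?_
        filter_upwards [hgt (H.x i)] with y hy using (hgd y hy).deriv.symm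
    -- the one-sided derivatives of `g` agree at the support points, so `g` is `C¹`
    have hgi : ∀ i, ∀ L, Tendsto (deriv g) (𝓝[<] H.x i) (𝓝 L) →
        Tendsto (deriv g) (𝓝[>] H.x i) (𝓝 L) → HasDerivAt g L (H.x i) := by
      intro i L h1 h2
      have a1 : HasDerivWithinAt g L (Set.Iic (H.x i)) (H.x i) :=
        hasDerivWithinAt_Iic_of_tendsto_deriv
          (fun y (hy : y ∈ {y | y ∉ Set.range H.x}) =>
            (hgd y hy).differentiableAt.differentiableWithinAt)
          hgc.continuousWithinAt (hlt _) h1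
      have a2 : HasDerivWithinAt g L (Set.Ici (H.x i)) (H.x i) :=
        hasDerivWithinAt_Ici_of_tendsto_deriv
          (fun y (hy : y ∈ {y | y ∉ Set.range H.x}) =>
            (hgd y hy).differentiableAt.differentiableWithinAt)
          hgc.continuousWithinAt (hgt _) h2
      have := a1.union a2
      rwa [Set.Iic_union_Ici, hasDerivWithinAt_univ] at this
    have hg2 : ∀ x ∉ Set.range H.x, HasDerivAt (deriv g) (g x / 4) x := by
      intro x hx
      have := (hd x hx).2.add (H.hasDerivAt_sourceDeriv z f hx)
      rw [← add_div] at this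
      refine this.congr_of_eventuallyEq ?_
      filter_upwards [hcl x hx] with y hy using (hgd y hy).deriv
    have hg'c : Continuous (deriv g) := by
      rw [continuous_iff_continuousAt]
      intro x
      by_cases hx : x ∈ Set.range H.x
      · obtain ⟨i, rfl⟩ := hx
        obtain ⟨L, h1, h2⟩ := hL i
        have hd := (hgi i L h1 h2).deriv
        rw [continuousAt_iff_continuous_left'_right']
        exact ⟨by rw [ContinuousWithinAt, hd]; exact h1, by rw [ContinuousWithinAt, hd]; exact h2⟩
      · exact (hg2 x hx).continuousAt
    obtain ⟨A, B, hAB⟩ := exists_eq_exp_of_free (Set.finite_range H.x) hgc hg'c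
      (fun x hx => (hgd x hx).differentiableAt.hasDerivAt) hg2
    exact ⟨A, B, fun x => by rw [← hAB x, hg]; ring⟩
  · rintro ⟨A, B, hf⟩
    set e : ℝ → ℂ := fun x => A * Complex.exp ((x : ℂ) / 2) + B * Complex.exp (-(x : ℂ) / 2) with he
    set e' : ℝ → ℂ := fun x => A * (Complex.exp ((x : ℂ) / 2) / 2)
      + B * (-Complex.exp (-(x : ℂ) / 2) / 2) with he'
    have h1 : ∀ x, HasDerivAt e (e' x) x := fun x =>
      ((hasDerivAt_cexp_half x).const_mul A).add ((hasDerivAt_cexp_neg_half x).const_mul B)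
    have h2 : ∀ x, HasDerivAt e' (e x / 4) x := fun x =>
      ((((hasDerivAt_cexp_half x).div_const 2).const_mul A).add
        (((hasDerivAt_cexp_neg_half x).neg.div_const 2).const_mul B)).congr_deriv (by
          simp only [he]; ring)
    have hfe : f = fun x => e x - H.source z f x := funext hf
    have hec : Continuous e := continuous_iff_continuousAt.2 fun x => (h1 x).continuousAt
    have he'c : Continuous e' := continuous_iff_continuousAt.2 fun x => (h2 x).continuousAt
    have hd1 : ∀ x ∉ Set.range H.x, HasDerivAt f (e' x - H.sourceDeriv z f x) x := by
      intro x hx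
      have := (h1 x).sub (H.hasDerivAt_source z f hx)
      exact this.congr_of_eventuallyEq (Eventually.of_forall fun y => hf y)
    refine ⟨?_, fun x hx => ⟨(hd1 x hx).differentiableAt, ?_⟩, fun i => ?_⟩
    · rw [hfe]; exact hec.sub (H.continuous_source z f)
    · have := (h2 x).sub (H.hasDerivAt_sourceDeriv z f hx)
      rw [← sub_div, ← show f x = e x - H.source z f x from hf x] at this
      refine this.congr_of_eventuallyEq ?_
      filter_upwards [hcl x hx] with y hy using (hd1 y hy).deriv
    · refine ⟨e' (H.x i) - (H.sourceDeriv z f (H.x i) - H.weight z i * f (H.x i)),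
        e' (H.x i) - H.sourceDeriv z f (H.x i), ?_, ?_, ?_⟩
      · refine (((he'c.tendsto _).mono_left nhdsWithin_le_nhds).sub
          (H.tendsto_sourceDeriv_left z f i)).congr' ?_
        filter_upwards [hlt (H.x i)] with y hy using (hd1 y hy).deriv.symm
      · refine (((he'c.tendsto _).mono_left nhdsWithin_le_nhds).sub
          (H.tendsto_sourceDeriv_right z f (H.x i))).congr' ?_
        filter_upwards [hgt (H.x i)] with y hy using (hd1 y hy).deriv.symm
      · rw [weight]; ring

end DiscretePair

/-! ### Polynomials in the spectral parameter -/

/-- The weight `w s * X + u s * X ^ 2` of the point `s` as a polynomial in the spectral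
parameter. -/
noncomputable def pw (w u : ℝ → ℝ) (s : ℝ) : ℝ[X] := C (w s) * X + C (u s) * X ^ 2

/-- The solution `φ₊(·, x)` as a polynomial in the spectral parameter. -/
noncomputable def phi (S : Finset ℝ) (w u : ℝ → ℝ) : ℝ → ℝ[X] := jost S (pw w u)

/-- The Wronskian as a polynomial in the spectral parameter; its zeros are the eigenvalues. -/
noncomputable def wron (S : Finset ℝ) (w u : ℝ → ℝ) : ℝ[X] := wronski S (pw w u) (phi S w u)

lemma isJost_phi (S : Finset ℝ) (w u : ℝ → ℝ) : IsJost S (pw w u) (phi S w u) := isJost_jost _ _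

lemma aeval_pw (w u : ℝ → ℝ) (s : ℝ) (z : ℂ) :
    aeval z (pw w u s) = z * (w s : ℂ) + z ^ 2 * (u s : ℂ) := by
  simp [pw]; ring

lemma eval_pw (w u : ℝ → ℝ) (s z : ℝ) : (pw w u s).eval z = w s * z + u s * z ^ 2 := by
  simp [pw]

lemma aeval_ofReal (p : ℝ[X]) (z : ℝ) : aeval (z : ℂ) p = ((p.eval z : ℝ) : ℂ) := by
  exact Polynomial.aeval_algebraMap_apply_eq_algebraMap_eval z p

lemma eval_phi (S : Finset ℝ) (w u : ℝ → ℝ) (z : ℝ) :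
    IsJost S (fun s => (pw w u s).eval z) (fun s => (phi S w u s).eval z) :=
  (isJost_phi S w u).map (Polynomial.aeval z)

lemma aeval_phi (S : Finset ℝ) (w u : ℝ → ℝ) (z : ℂ) :
    IsJost S (fun s => aeval z (pw w u s)) (fun s => aeval z (phi S w u s)) :=
  (isJost_phi S w u).map (Polynomial.aeval z)

lemma eval_wron (S : Finset ℝ) (w u : ℝ → ℝ) (z : ℝ) :
    (wron S w u).eval z =
      wronski S (fun s => (pw w u s).eval z) (fun s => (phi S w u s).eval z) := by
  simp [wron, wronski, eval_finsetSum]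

lemma aeval_wron (S : Finset ℝ) (w u : ℝ → ℝ) (z : ℂ) :
    aeval z (wron S w u) =
      wronski S (fun s => aeval z (pw w u s)) (fun s => aeval z (phi S w u s)) := by
  simp [wron, wronski]

lemma tendsto_exp_neg_half : Tendsto (fun x : ℝ => Real.exp (-x / 2)) atTop (𝓝 0) := by
  refine Real.tendsto_exp_atBot.comp ?_
  have : Tendsto (fun x : ℝ => (1 / 2 : ℝ) * x) atTop atTop :=
    tendsto_id.const_mul_atTop (by norm_num)
  refine (tendsto_neg_atTop_atBot.comp this).congr fun x => ?_
  simp only [Function.comp]; ring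

lemma cexp_half (x : ℝ) : Complex.exp ((x : ℂ) / 2) = ((Real.exp (x / 2) : ℝ) : ℂ) := by
  push_cast; rfl

lemma cexp_neg_half (x : ℝ) : Complex.exp (-(x : ℂ) / 2) = ((Real.exp (-x / 2) : ℝ) : ℂ) := by
  push_cast; rfl

lemma exp_half_mul (x : ℝ) : Real.exp (x / 2) * Real.exp (-x / 2) = 1 := by
  rw [← Real.exp_add]; simp [neg_div]

lemma exp_neg_half_mul (x : ℝ) : Real.exp (-x / 2) * Real.exp (x / 2) = 1 := by
  rw [mul_comm, exp_half_mul]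

/-- A combination of exponentials that is bounded near `+∞` has no growing part. -/
lemma eq_zero_of_bounded {A B : ℂ} {M : ℝ} (h : ∀ᶠ x : ℝ in atTop,
    ‖A * Complex.exp ((x : ℂ) / 2) + B * Complex.exp (-(x : ℂ) / 2)‖ ≤ M) : A = 0 := by
  have h1 : Tendsto (fun x : ℝ => M * Real.exp (-x / 2)
      + ‖B‖ * (Real.exp (-x / 2) * Real.exp (-x / 2))) atTop (𝓝 (M * 0 + ‖B‖ * (0 * 0))) :=
    (tendsto_exp_neg_half.const_mul M).add
      ((tendsto_exp_neg_half.mul tendsto_exp_neg_half).const_mul ‖B‖)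
  have h2 : ‖A‖ ≤ M * 0 + ‖B‖ * (0 * 0) := by
    refine ge_of_tendsto h1 ?_
    filter_upwards [h] with x hx
    have e : A = (A * Complex.exp ((x : ℂ) / 2) + B * Complex.exp (-(x : ℂ) / 2)) *
        ((Real.exp (-x / 2) : ℝ) : ℂ) - B * ((Real.exp (-x / 2) * Real.exp (-x / 2) : ℝ) : ℂ) := by
      have : ((Real.exp (x / 2) : ℝ) : ℂ) * ((Real.exp (-x / 2) : ℝ) : ℂ) = 1 := by
        rw [← Complex.ofReal_mul, exp_half_mul, Complex.ofReal_one]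
      rw [cexp_half, cexp_neg_half, Complex.ofReal_mul]
      linear_combination (-A) * this
    calc ‖A‖ = _ := congrArg norm e
      _ ≤ _ := norm_sub_le _ _
      _ ≤ _ := by
        rw [norm_mul, norm_mul, Complex.norm_real, Complex.norm_real, Real.norm_of_nonneg
          (Real.exp_pos _).le, Real.norm_of_nonneg (by positivity)]
        gcongr
  simpa using h2

/-- The finite set `S` and the weight functions `w`, `u` describe the measures of `H`; points of `S`
without mass are allowed. -/
structure DiscretePair.Represents (H : DiscretePair) (S : Finset ℝ) (w u : ℝ → ℝ) : Prop where
  mem : ∀ i, H.x i ∈ S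
  w_eq : ∀ i, w (H.x i) = H.w i
  u_eq : ∀ i, u (H.x i) = H.u i
  eq_zero : ∀ s ∈ S, s ∉ Set.range H.x → w s = 0 ∧ u s = 0

namespace DiscretePair.Represents

variable {H : DiscretePair} {S : Finset ℝ} {w u : ℝ → ℝ} (hR : H.Represents S w u)
include hR

/-- Points without mass do not contribute to sums over the weights. -/
lemma sum_eq {M : Type*} [AddCommMonoid M] (g : ℝ → M)
    (hg : ∀ s, w s = 0 → u s = 0 → g s = 0) : ∑ s ∈ S, g s = ∑ i, g (H.x i) := by
  classical
  rw [← Finset.sum_image (s := univ) (g := H.x) (f := g)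
    (fun _ _ _ _ h => H.strictMono_x.injective h)]
  symm
  refine Finset.sum_subset (fun s hs => ?_) fun s hs hs' => ?_
  · obtain ⟨i, -, rfl⟩ := Finset.mem_image.1 hs
    exact hR.mem i
  · have := hR.eq_zero s hs (fun ⟨i, hi⟩ => hs' (Finset.mem_image.2 ⟨i, mem_univ _, hi⟩))
    exact hg s this.1 this.2

lemma source_eq (z : ℂ) (f : ℝ → ℂ) (x : ℝ) :
    H.source z f x = ∑ s ∈ S, vol s x • (aeval z (pw w u s) * f s) := by
  rw [hR.sum_eq (fun s => vol s x • (aeval z (pw w u s) * f s))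
    (fun s h1 h2 => by simp [aeval_pw, h1, h2])]
  simp only [source, weight, aeval_pw, hR.w_eq, hR.u_eq]

lemma gammaSq_eq (l : ℝ) (f : ℝ → ℂ) :
    H.gammaSq l f = ∑ s ∈ S, (w s + 2 * l * u s) * ‖f s‖ ^ 2 := by
  rw [hR.sum_eq (fun s => (w s + 2 * l * u s) * ‖f s‖ ^ 2) (fun s h1 h2 => by simp [h1, h2]),
    gammaSq, Finset.mul_sum, ← Finset.sum_add_distrib]
  refine Finset.sum_congr rfl fun i _ => ?_
  rw [hR.w_eq, hR.u_eq]; ring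

lemma eventually_source (z : ℂ) (f : ℝ → ℂ) : ∀ᶠ x in atTop, H.source z f x = 0 := by
  have : ∀ᶠ x in atTop, ∀ s ∈ S, s ≤ x :=
    (Finset.eventually_all S).2 fun s _ => eventually_ge_atTop s
  filter_upwards [this] with x hx
  rw [hR.source_eq]
  exact Finset.sum_eq_zero fun s hs => by rw [vol_of_le (hx s hs), zero_smul]

lemma isSolution_phi (z : ℂ) : H.IsSolution z (fun x => aeval z (phi S w u x)) := by
  rw [isSolution_iff]
  refine ⟨0, 1, fun x => ?_⟩
  rw [hR.source_eq, cexp_neg_half, zero_mul, zero_add, one_mul]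
  exact aeval_phi S w u z x

/-- A solution without growing part at `+∞` is a multiple of `φ₊`. -/
lemma eq_phi_mul {z B : ℂ} {f : ℝ → ℂ}
    (hf : ∀ x : ℝ, f x = 0 * Complex.exp ((x : ℂ) / 2) + B * Complex.exp (-(x : ℂ) / 2)
      - H.source z f x) (x : ℝ) : f x = aeval z (phi S w u x) * B := by
  refine (aeval_phi S w u z).unique (g := f) (c := B) (fun x => ?_) x
  rw [hf, hR.source_eq, cexp_neg_half, zero_mul, zero_add, mul_comm B]
  rfl

lemma isPhiPlus_iff (z : ℂ) (f : ℝ → ℂ) :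
    H.IsPhiPlus z f ↔ ∀ x, f x = aeval z (phi S w u x) := by
  constructor
  · rintro ⟨hs, he⟩
    obtain ⟨A, B, hf⟩ := (H.isSolution_iff z f).1 hs
    have h1 : ∀ᶠ x : ℝ in atTop,
        A * Complex.exp ((x : ℂ) / 2) + B * Complex.exp (-(x : ℂ) / 2) =
          Complex.exp (-(x : ℂ) / 2) := by
      filter_upwards [he, hR.eventually_source z f] with x h1 h2
      have h3 := hf x
      rw [h1, h2, sub_zero] at h3
      exact h3.symm
    have hA : A = 0 := by
      refine eq_zero_of_bounded (A := A) (B := B) (M := 1) ?_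
      filter_upwards [h1, eventually_ge_atTop 0] with x hx hx0
      rw [hx, cexp_neg_half, Complex.norm_real, Real.norm_of_nonneg (Real.exp_pos _).le]
      exact Real.exp_le_one_iff.2 (by linarith)
    subst hA
    obtain ⟨x₀, hx₀⟩ := h1.exists
    have hB : B = 1 := by
      rw [zero_mul, zero_add] at hx₀
      exact mul_right_cancel₀ (Complex.exp_ne_zero _) (hx₀.trans (one_mul _).symm)
    intro x
    rw [hR.eq_phi_mul hf x, hB, mul_one]
  · intro h
    obtain rfl : f = fun x => aeval z (phi S w u x) := funext h
    refine ⟨hR.isSolution_phi z, ?_⟩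
    filter_upwards [hR.eventually_source z (fun x => aeval z (phi S w u x))] with x hx
    rw [hR.source_eq] at hx
    have := aeval_phi S w u z x
    simp only at this
    rw [this, hx, sub_zero, cexp_neg_half]
    rfl

lemma mem_spectrum_iff (z : ℂ) : z ∈ H.spectrum ↔ aeval z (wron S w u) = 0 := by
  constructor
  · rintro ⟨f, hs, ⟨x₀, hx₀⟩, M, hM⟩
    obtain ⟨A, B, hf⟩ := (H.isSolution_iff z f).1 hs
    have hA : A = 0 := by
      refine eq_zero_of_bounded (A := A) (B := B) (M := M) ?_
      filter_upwards [hR.eventually_source z f] with x h2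
      have := hM x
      rwa [hf x, h2, sub_zero] at this
    subst hA
    have hfB := hR.eq_phi_mul hf
    have hB : B ≠ 0 := fun h => hx₀ (by rw [hfB, h, mul_zero])
    have hW : aeval z (wron S w u) * B = 0 := by
      refine eq_zero_of_bounded (A := aeval z (wron S w u) * B)
        (B := growth S (fun s => aeval z (pw w u s)) (fun s => aeval z (phi S w u s)) * B)
        (M := M) ?_
      have : ∀ᶠ x in atTop, ∀ s ∈ S, -x ≤ s :=
        (Finset.eventually_all S).2 fun s _ =>
          (eventually_ge_atTop (-s)).mono fun x hx => by linarith
      filter_upwards [this] with x hx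
      have h1 := hM (-x)
      have h2 := (aeval_phi S w u z).eq_exp_of_le hx
      simp only [neg_neg] at h2
      rw [hfB, h2, ← aeval_wron] at h1
      convert h1 using 2
      rw [cexp_half, cexp_neg_half, Complex.real_smul, Complex.real_smul]
      ring
    exact (mul_eq_zero.1 hW).resolve_right hB
  · intro hW
    refine ⟨_, hR.isSolution_phi z, ?_, ∑ s ∈ S, ‖aeval z (pw w u s) * aeval z (phi S w u s)‖, ?_⟩
    · obtain ⟨x, hx⟩ := ((hR.isPhiPlus_iff z _).2 fun _ => rfl).2.exists
      exact ⟨x, by simp only [hx]; exact Complex.exp_ne_zero _⟩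
    · intro x
      have := (aeval_phi S w u z).eq_ker x
      rw [← aeval_wron, hW, smul_zero, zero_add] at this
      rw [this]
      refine (norm_sum_le _ _).trans (Finset.sum_le_sum fun s _ => ?_)
      rw [norm_smul, ker, Real.norm_of_nonneg (Real.exp_pos _).le]
      refine mul_le_of_le_one_left (norm_nonneg _) (Real.exp_le_one_iff.2 ?_)
      have := abs_nonneg (x - s)
      linarith

/-- The interior spectral data in terms of the polynomials `wron` and `phi`. -/
theorem isInteriorSpectralData_iff (a : ℝ) {N : ℕ} (lam al : Fin N → ℝ) :
    H.IsInteriorSpectralData a lam al ↔ StrictMono lam ∧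
      (∀ z : ℂ, aeval z (wron S w u) = 0 ↔ ∃ i, (lam i : ℂ) = z) ∧
      ∀ i, al i = (phi S w u a).eval (lam i) / Real.sqrt (lam i *
        ∑ s ∈ S, (w s + 2 * lam i * u s) * (phi S w u s).eval (lam i) ^ 2) := by
  refine and_congr_right fun _ => and_congr ?_ ?_
  · rw [Set.ext_iff]
    simp only [hR.mem_spectrum_iff, Set.mem_range]
  · refine forall_congr' fun i => ?_
    have h1 : ∀ f, H.IsPhiPlus (lam i : ℂ) f ↔ f = fun x => (((phi S w u x).eval (lam i) : ℝ) : ℂ) :=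
      fun f => by simp only [hR.isPhiPlus_iff, aeval_ofReal, funext_iff]
    simp only [h1, exists_eq_left, hR.gammaSq_eq, Complex.norm_real, Real.norm_eq_abs, sq_abs]
    norm_cast

end DiscretePair.Represents

/-- Every pair of discrete measures is represented on a set that contains the given point `a`, with
zero weights at `a` if it is not a support point. -/
lemma DiscretePair.exists_represents (H : DiscretePair) (a : ℝ) :
    ∃ S w u, H.Represents S w u ∧ a ∈ S ∧ ∀ s, 0 ≤ u s := by
  classical
  have hi := H.strictMono_x.injective
  refine ⟨insert a (univ.image H.x), Function.extend H.x H.w 0, Function.extend H.x H.u 0,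
    ⟨fun i => ?_, fun i => hi.extend_apply _ _ _, fun i => hi.extend_apply _ _ _, ?_⟩,
    mem_insert_self _ _, fun s => ?_⟩
  · exact mem_insert_of_mem (mem_image_of_mem _ (mem_univ _))
  · intro s _ hs
    exact ⟨Function.extend_apply' _ _ _ hs, Function.extend_apply' _ _ _ hs⟩
  · by_cases hs : ∃ i, H.x i = s
    · obtain ⟨i, rfl⟩ := hs
      rw [hi.extend_apply]; exact H.u_nonneg i
    · rw [Function.extend_apply' _ _ _ hs]; exact le_rfl

lemma DiscretePair.exists_of_weights (S : Finset ℝ) (w u : ℝ → ℝ) (hu : ∀ s, 0 ≤ u s) :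
    ∃ H : DiscretePair, H.Represents S w u := by
  classical
  set T := S.filter fun s => 0 < |w s| + u s with hT
  have hr : Set.range (T.orderEmbOfFin rfl) = T := T.range_orderEmbOfFin rfl
  refine ⟨⟨T.card, T.orderEmbOfFin rfl, fun i => w (T.orderEmbOfFin rfl i),
    fun i => u (T.orderEmbOfFin rfl i), (T.orderEmbOfFin rfl).strictMono, fun i => hu _,
    fun i => (mem_filter.1 (T.orderEmbOfFin_mem rfl i)).2⟩, ⟨fun i => ?_, fun i => rfl,
    fun i => rfl, fun s hs hs' => ?_⟩⟩
  · exact (mem_filter.1 (T.orderEmbOfFin_mem rfl i)).1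
  · have h1 : s ∉ T := fun h => hs' (by
      change s ∈ Set.range (T.orderEmbOfFin rfl)
      rw [hr]; exact h)
    have h2 : ¬ 0 < |w s| + u s := fun h => h1 (mem_filter.2 ⟨hs, h⟩)
    have h3 := abs_nonneg (w s)
    have h4 := hu s
    exact ⟨abs_eq_zero.1 (by linarith), by linarith⟩

/-! ### Symmetric pencils and the resolvent at `a` -/

open scoped InnerProductSpace

/-- A strengthened positivity of the Green kernel; the slack lets it pass through the induction,
since to the right of the support `∑ g(x) ker x p` decays like `exp (-p / 2)`. -/
lemma sq_sum_ker_le (S : Finset ℝ) (g : ℝ → ℝ) : ∀ p, (∀ s ∈ S, s ≤ p) →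
    (∑ x ∈ S, g x * ker x p) ^ 2 ≤ ∑ x ∈ S, ∑ y ∈ S, g x * g y * ker x y := by
  induction S using Finset.induction_on_max with
  | empty => intro p _; simp
  | insert m S hm ih =>
    intro p hp
    have hmS : m ∉ S := fun h => lt_irrefl _ (hm m h)
    have hmp : m ≤ p := hp m (mem_insert_self _ _)
    set L := ∑ x ∈ S, g x * ker x m with hL
    have e : ∑ x ∈ S, g x * ker x p = Real.exp ((m - p) / 2) * L := by
      rw [hL, mul_sum]
      refine sum_congr rfl fun x hx => ?_
      rw [ker, ker, abs_of_nonpos (by linarith [hm x hx]), abs_of_nonpos (by linarith [hm x hx]),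
        mul_left_comm, ← Real.exp_add]
      congr 2; ring
    have e2 : ker m p = Real.exp ((m - p) / 2) := by
      rw [ker, abs_of_nonpos (by linarith)]; congr 1; ring
    have h1 := ih m fun s hs => (hm s hs).le
    have h2 : ∑ x ∈ insert m S, ∑ y ∈ insert m S, g x * g y * ker x y =
        g m ^ 2 + 2 * g m * L + ∑ x ∈ S, ∑ y ∈ S, g x * g y * ker x y := by
      simp only [sum_insert hmS, sum_add_distrib, ker_self]
      have h3 : ∑ y ∈ S, g m * g y * ker m y = g m * L := by
        rw [hL, mul_sum]
        exact sum_congr rfl fun x _ => by rw [ker_comm]; ring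
      have h4 : ∑ x ∈ S, g x * g m * ker x m = g m * L := by
        rw [hL, mul_sum]
        exact sum_congr rfl fun x _ => by ring
      rw [h3, h4]; ring
    rw [h2, sum_insert hmS, e, e2]
    have h5 : 0 ≤ Real.exp ((m - p) / 2) := (Real.exp_pos _).le
    have h6 : Real.exp ((m - p) / 2) ≤ 1 := Real.exp_le_one_iff.2 (by linarith)
    calc (g m * Real.exp ((m - p) / 2) + Real.exp ((m - p) / 2) * L) ^ 2
        = Real.exp ((m - p) / 2) ^ 2 * (g m + L) ^ 2 := by ring
      _ ≤ 1 * (g m + L) ^ 2 := by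
        gcongr
        exact pow_le_one₀ h5 h6
      _ ≤ _ := by rw [← hL] at h1; linarith

/-- Vectors `k s` with Gram matrix `ker`, together with orthonormal vectors `e s` orthogonal to
them. -/
lemma exists_gram (S : Finset ℝ) : ∃ (m : ℕ) (k e : ℝ → EuclideanSpace ℝ (Fin m ⊕ S)),
    (∀ x ∈ S, ∀ y ∈ S, ⟪k x, k y⟫_ℝ = ker x y) ∧ (∀ x ∈ S, ∀ y ∈ S, ⟪k x, e y⟫_ℝ = 0) ∧
    ∀ x ∈ S, ∀ y ∈ S, ⟪e x, e y⟫_ℝ = if x = y then 1 else 0 := by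
  classical
  have hpsd : (Matrix.of fun x y : S => ker x y).PosSemidef := by
    refine Matrix.PosSemidef.of_dotProduct_mulVec_nonneg ?_ fun g => ?_
    · ext x y; simp [ker_comm]
    · obtain ⟨p, hp⟩ := S.bddAbove
      set g' : ℝ → ℝ := fun x => if h : x ∈ S then g ⟨x, h⟩ else 0 with hg'
      have h := (sq_nonneg _).trans (sq_sum_ker_le S g' p fun s hs => hp hs)
      have hg : ∀ x : S, g x = g' x := fun x => by simp [hg']
      have e : star g ⬝ᵥ (Matrix.of fun x y : S => ker x y).mulVec g =
          ∑ x ∈ S, ∑ y ∈ S, g' x * g' y * ker x y := by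
        rw [← Finset.sum_coe_sort S (fun x => ∑ y ∈ S, g' x * g' y * ker x y)]
        simp only [dotProduct, Matrix.mulVec, star_trivial, Matrix.of_apply]
        refine sum_congr rfl fun x _ => ?_
        rw [← Finset.sum_coe_sort S (fun y => g' x * g' y * ker x y), mul_sum]
        refine sum_congr rfl fun y _ => ?_
        rw [hg, hg]; ring
      rw [e]; exact h
  obtain ⟨m, v, hv⟩ := Matrix.posSemidef_iff_eq_sum_vecMulVec.1 hpsd
  refine ⟨m, fun x => if h : x ∈ S then
      WithLp.toLp 2 (Sum.elim (fun i => v i ⟨x, h⟩) fun _ => 0) else 0,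
    fun x => if h : x ∈ S then
      WithLp.toLp 2 (Sum.elim (fun _ => 0) fun y => if y = ⟨x, h⟩ then 1 else 0) else 0, ?_, ?_, ?_⟩
  · intro x hx y hy
    have := congrFun (congrFun hv ⟨x, hx⟩) ⟨y, hy⟩
    simp only [Matrix.of_apply, Matrix.sum_apply, Matrix.vecMulVec_apply, star_trivial]
      at this
    rw [this]
    simp [hx, hy, PiLp.inner_apply, mul_comm]
  · intro x hx y hy
    simp [hx, hy, PiLp.inner_apply]
  · intro x hx y hy
    simp [hx, hy, PiLp.inner_apply]

section Abstract

variable {E : Type*} [NormedAddCommGroup E] [InnerProductSpace ℝ E]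

/-- Expansion of the resolvent of a symmetric operator at a unit vector `δ`, in terms of the
eigenvectors `v i` for the nonzero eigenvalues `(lam i)⁻¹`. The function `G` is, up to the factor
`κ`, the matrix element `⟪δ, (1 - κ T)⁻¹ δ⟫`; the hypotheses on `Y` say that it vanishes, also when
`κ` is one of the `lam i` and `(1 - κ T)⁻¹` does not exist. -/
lemma G_eq_zero_of_resolvent [FiniteDimensional ℝ E] {T : E →ₗ[ℝ] E} (hT : T.IsSymmetric) {N : ℕ}
    {v : Fin N → E}
    (hv : Orthonormal ℝ v) {lam al : Fin N → ℝ} (hlam : ∀ i, lam i ≠ 0)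
    (hTv : ∀ i, T (v i) = (lam i)⁻¹ • v i)
    (hcomp : ∀ μ : ℝ, μ ≠ 0 → ∀ Y, Y ≠ 0 → T Y = μ • Y → ∃ i, ∃ c : ℝ, Y = c • v i)
    {δ : E} (hδ : ⟪δ, δ⟫_ℝ = 1) (hal : ∀ i, al i = ⟪v i, δ⟫_ℝ) {κ c : ℝ} (hc : c ≠ 0) {Y : E}
    (hY : Y = κ • T Y + c • δ) (h0 : ⟪δ, Y⟫_ℝ = 0) : G lam al κ = 0 := by
  classical
  set δ₀ := δ - ∑ i, al i • v i with hδ₀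
  have hort : ∀ j, ⟪v j, δ₀⟫_ℝ = 0 := by
    intro j
    rw [hδ₀, inner_sub_right, hv.inner_right_fintype, hal, sub_self]
  -- `T` vanishes at `δ₀`, which is orthogonal to all eigenvectors with nonzero eigenvalue
  have hTδ₀ : T δ₀ = 0 := by
    set b := hT.eigenvectorBasis rfl
    rw [← b.sum_repr' (T δ₀)]
    refine sum_eq_zero fun i _ => ?_
    rw [smul_eq_zero]
    left
    rw [← hT, hT.apply_eigenvectorBasis]
    by_cases hμ : hT.eigenvalues rfl i = 0
    · rw [hμ]; simp
    · obtain ⟨j, c, hj⟩ := hcomp _ hμ _ (b.orthonormal.ne_zero i) (hT.apply_eigenvectorBasis rfl i)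
      rw [hj, inner_smul_left, inner_smul_left, hort]; simp
  have hδ₀δ : ⟪δ₀, δ⟫_ℝ = 1 - ∑ i, al i ^ 2 := by
    rw [hδ₀, inner_sub_left, hδ, sum_inner]
    congr 1
    refine sum_congr rfl fun i _ => ?_
    rw [inner_smul_left, ← hal]; simp [sq]
  have h1 : ⟪δ₀, Y⟫_ℝ = c * (1 - ∑ i, al i ^ 2) := by
    rw [hY, inner_add_right, inner_smul_right, inner_smul_right, ← hT, hTδ₀, inner_zero_left,
      hδ₀δ]; ring
  have h2 : ∀ i, (lam i - κ) * ⟪v i, Y⟫_ℝ = c * al i * lam i := by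
    intro i
    have h3 : ⟪v i, Y⟫_ℝ = κ * ((lam i)⁻¹ * ⟪v i, Y⟫_ℝ) + c * al i := by
      conv_lhs => rw [hY]
      rw [inner_add_right, inner_smul_right, inner_smul_right, ← hT, hTv, inner_smul_left, hal]
      simp
    have h4 := mul_inv_cancel₀ (hlam i)
    linear_combination (lam i) * h3 + κ * ⟪v i, Y⟫_ℝ * h4
  have h5 : ⟪δ, Y⟫_ℝ = ⟪δ₀, Y⟫_ℝ + ∑ i, al i * ⟪v i, Y⟫_ℝ := by
    have : δ = δ₀ + ∑ i, al i • v i := by rw [hδ₀]; abel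
    conv_lhs => rw [this]
    rw [inner_add_left, sum_inner]
    congr 1
    refine sum_congr rfl fun i _ => ?_
    rw [inner_smul_left]; simp
  have h6 : ∀ i, c * (lam i ^ 2 * al i ^ 2 / (lam i - κ) - lam i * al i ^ 2) =
      κ * (al i * ⟪v i, Y⟫_ℝ) := by
    intro i
    have h7 := h2 i
    rcases eq_or_ne (lam i) κ with h | h
    · have : al i = 0 := by
        rw [h, sub_self, zero_mul, ← h] at h7
        simpa [hc, hlam i] using h7.symm
      simp [this]
    · have h8 : lam i - κ ≠ 0 := sub_ne_zero.2 h
      field_simp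
      linear_combination (-κ * al i) * h7
  have h9 : c * G lam al κ = κ * ⟪δ, Y⟫_ℝ := by
    have : G lam al κ = (1 - ∑ i, al i ^ 2) * κ +
        ∑ i, (lam i ^ 2 * al i ^ 2 / (lam i - κ) - lam i * al i ^ 2) := by
      rw [G, sum_sub_distrib]; ring
    rw [this, h5, h1, mul_add, mul_add, mul_sum, mul_sum, sum_congr rfl fun i _ => h6 i]
    ring
  rw [h0, mul_zero] at h9
  exact (mul_eq_zero.1 h9).resolve_left hc

end Abstract

section Pencil

variable {E : Type*} [NormedAddCommGroup E] [InnerProductSpace ℝ E]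

/-- The symmetric operator that linearises the quadratic eigenvalue problem
`f = ∑ s, ker · s * (z * w s + z ^ 2 * u s) * f s`: the second component of a vector holds
`z √(u s) f s`, and an eigenvalue `z` of the problem corresponds to the eigenvalue `1 / z`. -/
noncomputable def pencil (S : Finset ℝ) (w u : ℝ → ℝ) (k e : ℝ → E) : E →ₗ[ℝ] E :=
  ∑ s ∈ S, ((w s • innerₛₗ ℝ (k s) + Real.sqrt (u s) • innerₛₗ ℝ (e s)).smulRight (k s) +
    (Real.sqrt (u s) • innerₛₗ ℝ (k s)).smulRight (e s))

lemma pencil_apply (S : Finset ℝ) (w u : ℝ → ℝ) (k e : ℝ → E) (y : E) : pencil S w u k e y =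
    ∑ s ∈ S, ((w s * ⟪k s, y⟫_ℝ + Real.sqrt (u s) * ⟪e s, y⟫_ℝ) • k s +
      (Real.sqrt (u s) * ⟪k s, y⟫_ℝ) • e s) := by
  simp [pencil]

lemma pencil_isSymmetric (S : Finset ℝ) (w u : ℝ → ℝ) (k e : ℝ → E) :
    (pencil S w u k e).IsSymmetric := by
  intro x y
  rw [pencil_apply, pencil_apply, sum_inner, inner_sum]
  refine sum_congr rfl fun s _ => ?_
  simp only [inner_add_left, inner_add_right, real_inner_smul_left, real_inner_smul_right,
    real_inner_comm x]
  ring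

/-- The vector of the linearised problem belonging to a function `f` with a point source `c` at
`a`. -/
noncomputable def pencilVec (S : Finset ℝ) (w u : ℝ → ℝ) (k e : ℝ → E) (a z c : ℝ) (f : ℝ → ℝ) :
    E :=
  ∑ s ∈ S, (((w s * z + u s * z ^ 2) * f s) • k s + (z * Real.sqrt (u s) * f s) • e s) + c • k a

variable {S : Finset ℝ} {w u : ℝ → ℝ} {k e : ℝ → E} {a z c : ℝ} {f : ℝ → ℝ}
  (hkk : ∀ x ∈ S, ∀ y ∈ S, ⟪k x, k y⟫_ℝ = ker x y) (hke : ∀ x ∈ S, ∀ y ∈ S, ⟪k x, e y⟫_ℝ = 0)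
  (hee : ∀ x ∈ S, ∀ y ∈ S, ⟪e x, e y⟫_ℝ = if x = y then 1 else 0) (ha : a ∈ S)
  (hu : ∀ s, 0 ≤ u s)
  (hf : ∀ x ∈ S, f x = ∑ s ∈ S, ker x s * ((w s * z + u s * z ^ 2) * f s) + c * ker x a)

include hkk hke ha hf in
lemma inner_k_pencilVec {x : ℝ} (hx : x ∈ S) :
    ⟪k x, pencilVec S w u k e a z c f⟫_ℝ = f x := by
  rw [hf x hx, pencilVec, inner_add_right, inner_sum, real_inner_smul_right, hkk x hx a ha]
  congr 1
  refine sum_congr rfl fun s hs => ?_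
  rw [inner_add_right, real_inner_smul_right, real_inner_smul_right, hkk x hx s hs, hke x hx s hs]
  ring

include hke hee ha in
lemma inner_e_pencilVec {x : ℝ} (hx : x ∈ S) :
    ⟪e x, pencilVec S w u k e a z c f⟫_ℝ = z * Real.sqrt (u x) * f x := by
  have : ∀ s ∈ S, ⟪e x, ((w s * z + u s * z ^ 2) * f s) • k s + (z * Real.sqrt (u s) * f s) • e s⟫_ℝ
      = if x = s then z * Real.sqrt (u s) * f s else 0 := by
    intro s hs
    rw [inner_add_right, real_inner_smul_right, real_inner_smul_right, real_inner_comm,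
      hke s hs x hx, hee x hx s hs]
    simp
  rw [pencilVec, inner_add_right, inner_sum, real_inner_smul_right, real_inner_comm,
    hke a ha x hx, sum_congr rfl this]
  simp [hx]

include hkk hke hee ha hu hf in
lemma pencilVec_eq : pencilVec S w u k e a z c f =
    z • pencil S w u k e (pencilVec S w u k e a z c f) + c • k a := by
  rw [pencil_apply, smul_sum]
  conv_lhs => rw [pencilVec]
  congr 1
  refine sum_congr rfl fun s hs => ?_
  rw [inner_k_pencilVec hkk hke ha hf hs, inner_e_pencilVec hke hee ha hs, smul_add, smul_smul,
    smul_smul]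
  have := Real.mul_self_sqrt (hu s)
  congr 2
  · linear_combination (-z ^ 2 * f s) * this
  · ring

include hkk hke hee ha hu hf in
lemma inner_self_pencilVec : ⟪pencilVec S w u k e a z c f, pencilVec S w u k e a z c f⟫_ℝ =
    z * ∑ s ∈ S, (w s + 2 * z * u s) * f s ^ 2 + c * f a := by
  nth_rw 1 [pencilVec]
  rw [inner_add_left, sum_inner, real_inner_smul_left, inner_k_pencilVec hkk hke ha hf ha, mul_sum]
  congr 1
  refine sum_congr rfl fun s hs => ?_
  rw [inner_add_left, real_inner_smul_left, real_inner_smul_left,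
    inner_k_pencilVec hkk hke ha hf hs, inner_e_pencilVec hke hee ha hs]
  have := Real.mul_self_sqrt (hu s)
  linear_combination (z ^ 2 * f s ^ 2) * this

end Pencil

/-- Positivity of `z γ ^ 2`, for solutions that may have a point source at a zero `a` of theirs. -/
lemma mul_gamma_pos {S : Finset ℝ} {w u : ℝ → ℝ} {a z c : ℝ} {f : ℝ → ℝ} (ha : a ∈ S)
    (hu : ∀ s, 0 ≤ u s)
    (hf : ∀ x ∈ S, f x = ∑ s ∈ S, ker x s * ((w s * z + u s * z ^ 2) * f s) + c * ker x a)
    (hc : c * f a = 0) (h0 : ∃ x ∈ S, f x ≠ 0) :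
    0 < z * ∑ s ∈ S, (w s + 2 * z * u s) * f s ^ 2 := by
  obtain ⟨m, k, e, hkk, hke, hee⟩ := exists_gram S
  have h1 := inner_self_pencilVec hkk hke hee ha hu hf
  rw [hc, add_zero] at h1
  rw [← h1, real_inner_self_eq_norm_sq]
  obtain ⟨x, hx, hfx⟩ := h0
  have : pencilVec S w u k e a z c f ≠ 0 := by
    intro h
    apply hfx
    rw [← inner_k_pencilVec hkk hke ha hf hx, h, inner_zero_right]
  positivity

/-! ### Zeros of `G` and of `φ₊(·, a)` -/

lemma vol_sub_vol (s t : ℝ) : vol t s - vol s t =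
    Real.exp (t / 2) * Real.exp (-s / 2) - Real.exp (s / 2) * Real.exp (-t / 2) := by
  rw [vol_add_ker, vol_add_ker, ker_comm]; ring

/-- A Christoffel–Darboux identity for two spectral parameters `z` and `l`. -/
lemma christoffel_darboux {T : Finset ℝ} {w u f g : ℝ → ℝ} {z l : ℝ}
    (hf : ∀ x ∈ T, f x = Real.exp (-x / 2) - ∑ s ∈ T, vol s x * ((w s * z + u s * z ^ 2) * f s))
    (hg : ∀ x ∈ T, g x = Real.exp (-x / 2) - ∑ s ∈ T, vol s x * ((w s * l + u s * l ^ 2) * g s)) :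
    wronski T (fun s => w s * z + u s * z ^ 2) f * growth T (fun s => w s * l + u s * l ^ 2) g
      - wronski T (fun s => w s * l + u s * l ^ 2) g * growth T (fun s => w s * z + u s * z ^ 2) f
      = (l - z) * ∑ s ∈ T, (w s + (l + z) * u s) * (f s * g s) := by
  set F : ℝ → ℝ := fun s => (w s * z + u s * z ^ 2) * f s with hF
  set K : ℝ → ℝ := fun s => (w s * l + u s * l ^ 2) * g s with hK
  have e1 : ∑ s ∈ T, K s * f s = ∑ s ∈ T, Real.exp (-s / 2) * K s
      - ∑ s ∈ T, ∑ t ∈ T, vol t s * (K s * F t) := by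
    rw [← sum_sub_distrib]
    refine sum_congr rfl fun s hs => ?_
    rw [hf s hs, mul_sub, mul_sum]
    congr 1
    · ring
    · exact sum_congr rfl fun t _ => by ring
  have e2 : ∑ s ∈ T, F s * g s = ∑ s ∈ T, Real.exp (-s / 2) * F s
      - ∑ s ∈ T, ∑ t ∈ T, vol s t * (K s * F t) := by
    rw [Finset.sum_comm, ← sum_sub_distrib]
    refine sum_congr rfl fun s hs => ?_
    rw [hg s hs, mul_sub, mul_sum]
    congr 1
    · ring
    · exact sum_congr rfl fun t _ => by ring
  have e3 : ∑ s ∈ T, ∑ t ∈ T, vol t s * (K s * F t) - ∑ s ∈ T, ∑ t ∈ T, vol s t * (K s * F t) =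
      (∑ s ∈ T, Real.exp (-s / 2) * K s) * (∑ t ∈ T, Real.exp (t / 2) * F t)
      - (∑ s ∈ T, Real.exp (s / 2) * K s) * (∑ t ∈ T, Real.exp (-t / 2) * F t) := by
    rw [sum_mul_sum, sum_mul_sum, ← sum_sub_distrib, ← sum_sub_distrib]
    refine sum_congr rfl fun s _ => ?_
    rw [← sum_sub_distrib, ← sum_sub_distrib]
    refine sum_congr rfl fun t _ => ?_
    linear_combination (K s * F t) * vol_sub_vol s t
  have e4 : (l - z) * ∑ s ∈ T, (w s + (l + z) * u s) * (f s * g s) =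
      ∑ s ∈ T, K s * f s - ∑ s ∈ T, F s * g s := by
    rw [mul_sum, ← sum_sub_distrib]
    refine sum_congr rfl fun s _ => ?_
    simp only [hF, hK]; ring
  rw [e4]
  simp only [wronski, growth, smul_eq_mul]
  change (1 - ∑ s ∈ T, Real.exp (s / 2) * F s) * (∑ s ∈ T, Real.exp (-s / 2) * K s)
    - (1 - ∑ s ∈ T, Real.exp (s / 2) * K s) * (∑ s ∈ T, Real.exp (-s / 2) * F s) = _
  linear_combination e2 - e1 + e3

section Truncation

variable {S : Finset ℝ} {q f : ℝ → ℝ} (hf : IsJost S q f) {a : ℝ}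
include hf

lemma IsJost.exists_ne_zero_of_eq_zero (h0 : f a = 0) : ∃ s ∈ S, a < s ∧ f s ≠ 0 := by
  by_contra! h
  rw [hf.eq_at le_rfl, sum_eq_zero fun s hs => ?_, sub_zero] at h0
  · exact (Real.exp_pos _).ne' h0
  · obtain ⟨h1, h2⟩ := mem_filter.1 hs
    rw [h s h1 h2]; simp

/-- At a zero `a` of the Jost solution, cutting it off to the left of `a` gives a solution with a
nonzero point source at `a`. -/
lemma IsJost.exists_truncation (h0 : f a = 0) : ∃ c : ℝ, c ≠ 0 ∧ ∀ x,
    (if a < x then f x else 0) =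
      ∑ s ∈ S, ker x s * (q s * if a < s then f s else 0) + c * ker x a := by
  set T := S.filter (a < ·) with hT
  set A := 1 - ∑ s ∈ T, Real.exp (s / 2) * (q s * f s) with hA
  set B := ∑ s ∈ T, Real.exp (-s / 2) * (q s * f s) with hB
  have hsum : ∀ x, ∑ s ∈ S, ker x s * (q s * if a < s then f s else 0) =
      ∑ s ∈ T, ker x s * (q s * f s) := by
    intro x
    rw [hT, sum_filter]
    refine sum_congr rfl fun s _ => ?_
    split_ifs <;> simp
  have hge : ∀ x, a ≤ x → f x = Real.exp (-x / 2) * A + ∑ s ∈ T, ker x s * (q s * f s) := by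
    intro x hx
    rw [hf.eq_at hx, hA, mul_sub, mul_one, mul_sum, sub_add, ← sum_sub_distrib]
    congr 1
    refine sum_congr rfl fun s _ => ?_
    rw [vol_add_ker, smul_eq_mul]; ring
  have hle : ∀ x, x ≤ a → ∑ s ∈ T, ker x s * (q s * f s) = Real.exp (x / 2) * B := by
    intro x hx
    rw [hB, mul_sum]
    refine sum_congr rfl fun s hs => ?_
    rw [ker_of_le (hx.trans (mem_filter.1 hs).2.le)]; ring
  have hAB : Real.exp (-a / 2) * A + Real.exp (a / 2) * B = 0 := by
    rw [← hle a le_rfl, ← hge a le_rfl, h0]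
  refine ⟨Real.exp (-a / 2) * A, ?_, fun x => ?_⟩
  · intro hA0
    have hB0 : B = 0 := by
      rw [hA0, zero_add] at hAB
      exact (mul_eq_zero.1 hAB).resolve_left (Real.exp_pos _).ne'
    have hA0' : A = 0 := (mul_eq_zero.1 hA0).resolve_left (Real.exp_pos _).ne'
    have key : ∀ x, (if a ≤ x then f x else 0) = 0 := by
      refine eq_zero_of_volterra (fun s x => vol x s) (fun x => -x)
        (fun s x h => vol_of_le (neg_le_neg_iff.1 h)) T q _ fun x => ?_
      have e : ∑ s ∈ T, vol x s • (q s * if a ≤ s then f s else 0) =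
          Real.exp (x / 2) * B - ∑ s ∈ T, ker x s * (q s * f s) := by
        rw [hB, mul_sum, ← sum_sub_distrib]
        refine sum_congr rfl fun s hs => ?_
        rw [if_pos (mem_filter.1 hs).2.le, vol_add_ker, ker_comm, smul_eq_mul]; ring
      rw [e, hB0]
      split_ifs with hx
      · rw [hge x hx, hA0']; ring
      · rw [hle x (not_le.1 hx).le, hB0]; ring
    obtain ⟨s, _, hs, hs'⟩ := hf.exists_ne_zero_of_eq_zero h0
    have := key s
    rw [if_pos hs.le] at this
    exact hs' this
  · rw [hsum]
    split_ifs with hx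
    · rw [hge x hx.le, ker_of_ge hx.le]
      linear_combination (-A * Real.exp (-x / 2)) * exp_neg_half_mul a
    · have hx := not_lt.1 hx
      rw [hle x hx, ker_of_le hx]
      linear_combination (-Real.exp (x / 2) * Real.exp (-a / 2)) * hAB +
        Real.exp (x / 2) * B * exp_neg_half_mul a

end Truncation

/-- `G` is injective on intervals free of its poles. -/
lemma G_ne_G {N : ℕ} {lam al : Fin N → ℝ} (hlam : ∀ i, lam i ≠ 0) {x y : ℝ} (hxy : x < y)
    (h : ∀ i, al i ≠ 0 → lam i < x ∨ y < lam i) (hs : ∑ i, al i ^ 2 ≤ 1) :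
    G lam al x ≠ G lam al y := by
  have e : G lam al y - G lam al x = (y - x) * ((1 - ∑ i, al i ^ 2) +
      ∑ i, lam i ^ 2 * al i ^ 2 / ((lam i - x) * (lam i - y))) := by
    have : ∀ i, lam i ^ 2 * al i ^ 2 / (lam i - y) - lam i ^ 2 * al i ^ 2 / (lam i - x) =
        (y - x) * (lam i ^ 2 * al i ^ 2 / ((lam i - x) * (lam i - y))) := by
      intro i
      by_cases h0 : al i = 0
      · simp [h0]
      · have h1 : lam i - x ≠ 0 := by
          rcases h i h0 with h | h
          · exact (sub_neg.2 h).ne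
          · exact (sub_pos.2 (hxy.trans h)).ne'
        have h2 : lam i - y ≠ 0 := by
          rcases h i h0 with h | h
          · exact (sub_neg.2 (h.trans hxy)).ne
          · exact (sub_pos.2 h).ne'
        field_simp
        ring
    rw [G, G, mul_add, mul_sum, ← sum_congr rfl fun i _ => this i, sum_sub_distrib]
    ring
  have hpos : ∀ i, al i ≠ 0 → 0 < lam i ^ 2 * al i ^ 2 / ((lam i - x) * (lam i - y)) := by
    intro i h0
    have h1 : 0 < (lam i - x) * (lam i - y) := by
      rcases h i h0 with h | h
      · exact mul_pos_of_neg_of_neg (by linarith) (by linarith)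
      · exact mul_pos (by linarith) (by linarith)
    have := hlam i
    positivity
  have hnn : ∀ i, 0 ≤ lam i ^ 2 * al i ^ 2 / ((lam i - x) * (lam i - y)) := by
    intro i
    by_cases h0 : al i = 0
    · simp [h0]
    · exact (hpos i h0).le
  have hd : 0 < G lam al y - G lam al x := by
    rw [e]
    refine mul_pos (by linarith) ?_
    by_cases hall : ∀ i, al i = 0
    · simp [hall]
    · push Not at hall
      obtain ⟨i, hi⟩ := hall
      have := Finset.sum_pos' (fun i _ => hnn i) ⟨i, mem_univ i, hpos i hi⟩
      linarith
  linarith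

lemma G_zero {N : ℕ} {lam al : Fin N → ℝ} (hlam : ∀ i, lam i ≠ 0) : G lam al 0 = 0 := by
  have : ∀ i, lam i ^ 2 * al i ^ 2 / lam i = lam i * al i ^ 2 := by
    intro i
    have := hlam i
    field_simp
  simp [G, this]

lemma mul_pos_of_continuous_of_ne_zero {f : ℝ → ℝ} (hf : Continuous f) {x y : ℝ} (hxy : x ≤ y)
    (h : ∀ t ∈ Set.Icc x y, f t ≠ 0) : 0 < f x * f y := by
  by_contra! hneg
  have h1 : (0 : ℝ) ∈ f '' Set.Icc x y := by
    have hx := h x ⟨le_rfl, hxy⟩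
    have hy := h y ⟨hxy, le_rfl⟩
    rcases lt_or_gt_of_ne hx with hx' | hx' <;> rcases lt_or_gt_of_ne hy with hy' | hy'
    · exact absurd (mul_pos_of_neg_of_neg hx' hy') (not_lt.2 hneg)
    · exact intermediate_value_Icc hxy hf.continuousOn ⟨hx'.le, hy'.le⟩
    · exact intermediate_value_Icc' hxy hf.continuousOn ⟨hy'.le, hx'.le⟩
    · exact absurd (mul_pos hx' hy') (not_lt.2 hneg)
  obtain ⟨t, ht, h0⟩ := h1
  exact h t ht h0

section Eigenfunctions

variable {S : Finset ℝ} {w u : ℝ → ℝ}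

lemma phi_eval_zero (x : ℝ) : (phi S w u x).eval 0 = Real.exp (-x / 2) := by
  have := eval_phi S w u 0 x
  simpa [eval_pw] using this

lemma wron_eval_zero : (wron S w u).eval 0 = 1 := by
  simp [eval_wron, wronski, eval_pw]

/-- At an eigenvalue `z`, the function `φ₊(z, ·)` solves the integral equation with the Green
kernel. -/
lemma phi_eq_ker_of_wron {z : ℝ} (hz : (wron S w u).eval z = 0) (x : ℝ) :
    (phi S w u x).eval z =
      ∑ s ∈ S, ker x s * ((w s * z + u s * z ^ 2) * (phi S w u s).eval z) := by
  have := (eval_phi S w u z).eq_ker x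
  rw [← eval_wron, hz, smul_zero, zero_add] at this
  simpa only [eval_pw, smul_eq_mul] using this

lemma exists_phi_ne_zero {z : ℝ} (hz : (wron S w u).eval z = 0) :
    ∃ s ∈ S, (phi S w u s).eval z ≠ 0 := by
  by_contra! h
  rw [eval_wron, wronski, sum_eq_zero fun s hs => by simp [h s hs], sub_zero] at hz
  exact one_ne_zero hz

lemma gamma_pos {a : ℝ} (ha : a ∈ S) (hu : ∀ s, 0 ≤ u s) {z : ℝ}
    (hz : (wron S w u).eval z = 0) :
    0 < z * ∑ s ∈ S, (w s + 2 * z * u s) * (phi S w u s).eval z ^ 2 :=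
  mul_gamma_pos (c := 0) (f := fun s => (phi S w u s).eval z) ha hu
    (fun x _ => by rw [zero_mul, add_zero]; exact phi_eq_ker_of_wron hz x) (zero_mul _)
    (exists_phi_ne_zero hz)

/-- A solution on `S` of the integral equation with the Green kernel is a multiple of `φ₊(z, ·)`,
and then `z` is a zero of the Wronskian. -/
lemma eq_phi_of_ker {z : ℝ} {f : ℝ → ℝ}
    (hf : ∀ x ∈ S, f x = ∑ s ∈ S, ker x s * ((w s * z + u s * z ^ 2) * f s)) :
    ∃ c, (∀ x ∈ S, f x = (phi S w u x).eval z * c) ∧ (c = 0 ∨ (wron S w u).eval z = 0) := by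
  set F : ℝ → ℝ := fun x => ∑ s ∈ S, ker x s * ((w s * z + u s * z ^ 2) * f s) with hF
  have hFf : ∀ x ∈ S, F x = f x := fun x hx => (hf x hx).symm
  set c := ∑ s ∈ S, Real.exp (s / 2) * ((w s * z + u s * z ^ 2) * f s) with hc
  have h1 : ∀ x, F x = (phi S w u x).eval z * c := by
    refine (eval_phi S w u z).unique fun x => ?_
    rw [Algebra.algebraMap_self, RingHom.id_apply, hc, mul_sum, ← sum_sub_distrib, hF]
    refine sum_congr rfl fun s hs => ?_
    have := hFf s hs
    simp only [hF] at this
    simp only [this, vol_add_ker, eval_pw, smul_eq_mul]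
    ring
  refine ⟨c, fun x hx => by rw [← hFf x hx, h1], ?_⟩
  have h2 := (eval_phi S w u z).eq_ker 0
  have h3 := h1 0
  have h4 : F 0 = c * ∑ s ∈ S, ker 0 s • ((pw w u s).eval z * (phi S w u s).eval z) := by
    rw [hF, mul_sum]
    refine sum_congr rfl fun s hs => ?_
    rw [← hFf s hs, h1, eval_pw, smul_eq_mul]
    ring
  rw [← mul_eq_zero, eval_wron]
  simp only [neg_zero, zero_div, Real.exp_zero, one_smul] at h2
  rw [h3] at h4
  linear_combination h4 - c * h2

/-- The spectral theorem for the linearised problem: Bessel's inequality at `a`, and the zeros of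
`φ₊(·, a)` are zeros of `G`. -/
lemma bessel_and_G_eq_zero {a : ℝ} (ha : a ∈ S) (hu : ∀ s, 0 ≤ u s) {N : ℕ} {lam al : Fin N → ℝ}
    (hinj : Function.Injective lam)
    (hspec : ∀ z : ℝ, (wron S w u).eval z = 0 ↔ ∃ i, lam i = z)
    (hal : ∀ i, al i = (phi S w u a).eval (lam i) / Real.sqrt (lam i *
        ∑ s ∈ S, (w s + 2 * lam i * u s) * (phi S w u s).eval (lam i) ^ 2)) :
    ∑ i, al i ^ 2 ≤ 1 ∧ ∀ κ : ℝ, (phi S w u a).eval κ = 0 → G lam al κ = 0 := by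
  obtain ⟨m, k, e, hkk, hke, hee⟩ := exists_gram S
  set T := pencil S w u k e with hT
  have hTs : T.IsSymmetric := pencil_isSymmetric S w u k e
  have hz : ∀ i, (wron S w u).eval (lam i) = 0 := fun i => (hspec _).2 ⟨i, rfl⟩
  have hlam : ∀ i, lam i ≠ 0 := fun i h => by
    have := hz i
    rw [h, wron_eval_zero] at this
    exact one_ne_zero this
  set n : Fin N → ℝ := fun i => lam i *
    ∑ s ∈ S, (w s + 2 * lam i * u s) * (phi S w u s).eval (lam i) ^ 2 with hn
  have hnpos : ∀ i, 0 < n i := fun i => gamma_pos ha hu (hz i)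
  have hker : ∀ i, ∀ x ∈ S, (phi S w u x).eval (lam i) = ∑ s ∈ S, ker x s *
      ((w s * lam i + u s * lam i ^ 2) * (phi S w u s).eval (lam i)) + 0 * ker x a :=
    fun i x _ => by rw [zero_mul, add_zero]; exact phi_eq_ker_of_wron (hz i) x
  set Y : Fin N → EuclideanSpace ℝ (Fin m ⊕ S) := fun i =>
    pencilVec S w u k e a (lam i) 0 (fun s => (phi S w u s).eval (lam i)) with hY
  have hYk : ∀ i, ∀ x ∈ S, ⟪k x, Y i⟫_ℝ = (phi S w u x).eval (lam i) := fun i x hx =>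
    inner_k_pencilVec hkk hke ha (hker i) hx
  have hYe : ∀ i, ∀ x ∈ S, ⟪e x, Y i⟫_ℝ = lam i * Real.sqrt (u x) * (phi S w u x).eval (lam i) :=
    fun i x hx => inner_e_pencilVec hke hee ha hx
  have hYT : ∀ i, T (Y i) = (lam i)⁻¹ • Y i := by
    intro i
    have := pencilVec_eq hkk hke hee ha hu (hker i)
    rw [zero_smul, add_zero] at this
    change T (Y i) = (lam i)⁻¹ • pencilVec S w u k e a (lam i) 0 _
    rw [this, smul_smul, inv_mul_cancel₀ (hlam i), one_smul]
  have hYY : ∀ i, ⟪Y i, Y i⟫_ℝ = n i := by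
    intro i
    have := inner_self_pencilVec hkk hke hee ha hu (hker i)
    rwa [zero_mul, add_zero] at this
  set v : Fin N → EuclideanSpace ℝ (Fin m ⊕ S) := fun i => (Real.sqrt (n i))⁻¹ • Y i with hv
  have hsq : ∀ i, Real.sqrt (n i) ≠ 0 := fun i => (Real.sqrt_pos.2 (hnpos i)).ne'
  have hTv : ∀ i, T (v i) = (lam i)⁻¹ • v i := by
    intro i
    simp only [hv]
    rw [map_smul, hYT, smul_comm]
  have hon : Orthonormal ℝ v := by
    classical
    rw [orthonormal_iff_ite]
    intro i j
    split_ifs with hij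
    · subst hij
      simp only [hv]
      rw [real_inner_smul_left, real_inner_smul_right, hYY]
      have := Real.mul_self_sqrt (hnpos i).le
      have := hsq i
      field_simp
      nlinarith
    · have h1 := hTs (v i) (v j)
      rw [hTv, hTv, real_inner_smul_left (v i) (v j), real_inner_smul_right (v i) (v j),
        ← sub_eq_zero, ← sub_mul] at h1
      refine (mul_eq_zero.1 h1).resolve_left (sub_ne_zero.2 fun h => hij (hinj (inv_injective h)))
  have hδ : ⟪k a, k a⟫_ℝ = 1 := by rw [hkk a ha a ha, ker_self]
  have halv : ∀ i, al i = ⟪v i, k a⟫_ℝ := by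
    intro i
    simp only [hv]
    rw [real_inner_smul_left, real_inner_comm, hYk i a ha, hal, div_eq_inv_mul]
  -- every eigenvector for a nonzero eigenvalue comes from a solution, hence from some `lam i`
  have hcomp : ∀ μ : ℝ, μ ≠ 0 → ∀ y, y ≠ 0 → T y = μ • y → ∃ i, ∃ c : ℝ, y = c • v i := by
    intro μ hμ y hy0 hy
    have hk : ∀ x ∈ S, μ * ⟪k x, y⟫_ℝ =
        ∑ s ∈ S, ker x s * (w s * ⟪k s, y⟫_ℝ + Real.sqrt (u s) * ⟪e s, y⟫_ℝ) := by
      intro x hx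
      rw [← real_inner_smul_right, ← hy, hT, pencil_apply, inner_sum]
      refine sum_congr rfl fun s hs => ?_
      rw [inner_add_right, real_inner_smul_right, real_inner_smul_right, hkk x hx s hs,
        hke x hx s hs]
      ring
    have he : ∀ x ∈ S, μ * ⟪e x, y⟫_ℝ = Real.sqrt (u x) * ⟪k x, y⟫_ℝ := by
      intro x hx
      rw [← real_inner_smul_right, ← hy, hT, pencil_apply, inner_sum]
      have : ∀ s ∈ S, ⟪e x, (w s * ⟪k s, y⟫_ℝ + Real.sqrt (u s) * ⟪e s, y⟫_ℝ) • k s +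
          (Real.sqrt (u s) * ⟪k s, y⟫_ℝ) • e s⟫_ℝ =
          if x = s then Real.sqrt (u s) * ⟪k s, y⟫_ℝ else 0 := by
        intro s hs
        rw [inner_add_right, real_inner_smul_right, real_inner_smul_right,
          real_inner_comm (k s) (e x), hke s hs x hx, hee x hx s hs]
        simp
      rw [sum_congr rfl this]
      simp [hx]
    have he' : ∀ x ∈ S, ⟪e x, y⟫_ℝ = μ⁻¹ * (Real.sqrt (u x) * ⟪k x, y⟫_ℝ) := fun x hx => by
      rw [← he x hx, inv_mul_cancel_left₀ hμ]
    have hf : ∀ x ∈ S, ⟪k x, y⟫_ℝ =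
        ∑ s ∈ S, ker x s * ((w s * μ⁻¹ + u s * μ⁻¹ ^ 2) * ⟪k s, y⟫_ℝ) := by
      intro x hx
      rw [← inv_mul_cancel_left₀ hμ ⟪k x, y⟫_ℝ, hk x hx, mul_sum]
      refine sum_congr rfl fun s hs => ?_
      rw [he' s hs]
      linear_combination (ker x s * μ⁻¹ ^ 2 * ⟪k s, y⟫_ℝ) * Real.mul_self_sqrt (hu s)
    have hy' : y = μ⁻¹ • T y := by rw [hy, smul_smul, inv_mul_cancel₀ hμ, one_smul]
    obtain ⟨c, hc, hc'⟩ := eq_phi_of_ker hf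
    rcases hc' with rfl | hw
    · have : T y = 0 := by
        rw [hT, pencil_apply]
        refine sum_eq_zero fun s hs => ?_
        rw [he' s hs, hc s hs]; simp
      exact absurd (by rw [hy', this, smul_zero]) hy0
    · obtain ⟨i, hi⟩ := (hspec _).1 hw
      refine ⟨i, c * Real.sqrt (n i), ?_⟩
      have : T y = c • T (Y i) := by
        rw [hT, pencil_apply, pencil_apply, smul_sum]
        refine sum_congr rfl fun s hs => ?_
        rw [he' s hs, hc s hs, hYk i s hs, hYe i s hs, ← hi, smul_add, smul_smul, smul_smul]
        congr 2 <;> ring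
      simp only [hv]
      rw [smul_smul, mul_assoc, mul_inv_cancel₀ (hsq i), mul_one, hy', this, hYT, smul_smul,
        smul_smul, ← hi]
      congr 1
      have := hlam i
      field_simp
  refine ⟨?_, fun κ hκ => ?_⟩
  · have := hon.sum_inner_products_le (x := k a) (s := univ)
    rw [← real_inner_self_eq_norm_sq, hδ] at this
    refine le_trans (le_of_eq (sum_congr rfl fun i _ => ?_)) this
    rw [halv, Real.norm_eq_abs, sq_abs]
  · obtain ⟨c, hc, htr⟩ := (eval_phi S w u κ).exists_truncation (a := a) hκ
    simp only [eval_pw] at htr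
    refine G_eq_zero_of_resolvent hTs hon hlam hTv hcomp hδ halv hc
      (pencilVec_eq hkk hke hee ha hu fun x _ => htr x) ?_
    rw [inner_k_pencilVec hkk hke ha (fun x _ => htr x) ha, if_neg (lt_irrefl _)]

end Eigenfunctions

/-! ### Necessity of the conditions -/

section Necessity

variable {S : Finset ℝ} {w u : ℝ → ℝ} {a : ℝ}

lemma eval_phi_eq_at {x : ℝ} (hx : a ≤ x) (z : ℝ) :
    (phi S w u x).eval z = Real.exp (-x / 2) - ∑ s ∈ S.filter (a < ·),
      vol s x * ((w s * z + u s * z ^ 2) * (phi S w u s).eval z) := by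
  have := (eval_phi S w u z).eq_at hx
  simp only [eval_pw, smul_eq_mul] at this
  exact this

/-- The value at `a` in terms of the weights to the right of `a`. -/
lemma eval_phi_eq_exp (z : ℝ) : (phi S w u a).eval z =
    Real.exp (-a / 2) * wronski (S.filter (a < ·)) (fun s => w s * z + u s * z ^ 2)
        (fun s => (phi S w u s).eval z) +
      Real.exp (a / 2) * growth (S.filter (a < ·)) (fun s => w s * z + u s * z ^ 2)
        (fun s => (phi S w u s).eval z) := by
  rw [eval_phi_eq_at le_rfl, wronski, growth, mul_sub, mul_one, mul_sum, mul_sum, sub_add,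
    ← sum_sub_distrib]
  congr 1
  refine sum_congr rfl fun s hs => ?_
  rw [vol_of_ge (mem_filter.1 hs).2.le, smul_eq_mul, smul_eq_mul]
  ring

/-- All zeros of the polynomial `phi S w u a` are simple: the function `g` below is its difference
quotient at the zero `l`, up to a constant. -/
lemma exists_phi_factor (ha : a ∈ S) (hu : ∀ s, 0 ≤ u s) {l : ℝ}
    (hl : (phi S w u a).eval l = 0) : ∃ (K : ℝ) (g : ℝ → ℝ), Continuous g ∧ g l ≠ 0 ∧
      ∀ z, K * (phi S w u a).eval z = (l - z) * g z := by
  set T := S.filter (a < ·) with hT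
  refine ⟨Real.exp (a / 2) * growth T (fun s => w s * l + u s * l ^ 2)
      (fun s => (phi S w u s).eval l), fun z => ∑ s ∈ T, (w s + (l + z) * u s) *
      ((phi S w u s).eval z * (phi S w u s).eval l), ?_, ?_, fun z => ?_⟩
  · refine continuous_finsetSum _ fun s _ => ?_
    have := (phi S w u s).continuous
    fun_prop
  · obtain ⟨c, -, htr⟩ := (eval_phi S w u l).exists_truncation (a := a) hl
    simp only [eval_pw] at htr
    have := mul_gamma_pos (z := l) (c := c) (w := w)
      (f := fun x => if a < x then (phi S w u x).eval l else 0) ha hu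
      (fun x _ => htr x) (by simp) ?_
    · have h2 : ∑ s ∈ S, (w s + 2 * l * u s) * (if a < s then (phi S w u s).eval l else 0) ^ 2 =
          ∑ s ∈ T, (w s + (l + l) * u s) * ((phi S w u s).eval l * (phi S w u s).eval l) := by
        rw [hT, sum_filter]
        refine sum_congr rfl fun s _ => ?_
        split_ifs
        · ring
        · simp
      rw [h2] at this
      exact (mul_ne_zero_iff.1 this.ne').2
    · obtain ⟨s, hs, hs1, hs2⟩ := (eval_phi S w u l).exists_ne_zero_of_eq_zero hl
      exact ⟨s, hs, by simpa [hs1] using hs2⟩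
  · have h1 := christoffel_darboux (T := T) (w := w) (u := u) (z := z) (l := l)
      (f := fun s => (phi S w u s).eval z) (g := fun s => (phi S w u s).eval l)
      (fun x hx => eval_phi_eq_at (mem_filter.1 hx).2.le z)
      (fun x hx => eval_phi_eq_at (mem_filter.1 hx).2.le l)
    have h2 := eval_phi_eq_exp (S := S) (w := w) (u := u) (a := a) z
    have h3 := eval_phi_eq_exp (S := S) (w := w) (u := u) (a := a) l
    rw [hl] at h3
    rw [← h1, h2]
    have h4 := exp_half_mul a
    simp only [← hT] at h3 ⊢
    set A := wronski T (fun s => w s * z + u s * z ^ 2) fun s => (phi S w u s).eval z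
    set B := growth T (fun s => w s * z + u s * z ^ 2) fun s => (phi S w u s).eval z
    set A' := wronski T (fun s => w s * l + u s * l ^ 2) fun s => (phi S w u s).eval l
    set B' := growth T (fun s => w s * l + u s * l ^ 2) fun s => (phi S w u s).eval l
    linear_combination (B' * A - A' * B) * h4 - Real.exp (a / 2) * B * h3

/-- The conditions satisfied by interior spectral data. The value at `a` of the `i`-th normalised
eigenfunction has the sign of the polynomial `phi S w u a` at `lam i`, and the zeros of this
polynomial are simple and are zeros of `G`, which has at most one zero between its poles. -/
theorem conditions_of_data (ha : a ∈ S) (hu : ∀ s, 0 ≤ u s) {N : ℕ} {lam al : Fin N → ℝ}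
    (hmono : StrictMono lam)
    (hspec : ∀ z : ℝ, (wron S w u).eval z = 0 ↔ ∃ i, lam i = z)
    (hal : ∀ i, al i = (phi S w u a).eval (lam i) / Real.sqrt (lam i *
        ∑ s ∈ S, (w s + 2 * lam i * u s) * (phi S w u s).eval (lam i) ^ 2)) :
    (∀ j : Fin N, al j = 0 → G lam al (lam j) = 0) ∧
    (∀ i j k : Fin N, (i : ℕ) + 1 = j → (j : ℕ) + 1 = k → al j = 0 → al i * al k < 0) ∧
    ClassT lam al := by
  classical
  obtain ⟨hbessel, hG⟩ := bessel_and_G_eq_zero ha hu hmono.injective hspec hal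
  have hz : ∀ i, (wron S w u).eval (lam i) = 0 := fun i => (hspec _).2 ⟨i, rfl⟩
  have hlam : ∀ i, lam i ≠ 0 := fun i h => by
    have := hz i
    rw [h, wron_eval_zero] at this
    exact one_ne_zero this
  have hr : ∀ i, ∃ r : ℝ, 0 < r ∧ al i = (phi S w u a).eval (lam i) * r := fun i =>
    ⟨_, inv_pos.2 (Real.sqrt_pos.2 (gamma_pos ha hu (hz i))), by rw [hal, div_eq_mul_inv]⟩
  choose r hrpos hal' using hr
  have hal0 : ∀ i, al i = 0 → (phi S w u a).eval (lam i) = 0 := fun i h => by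
    rw [hal'] at h
    exact (mul_eq_zero.1 h).resolve_right (hrpos i).ne'
  have hG0 : ∀ i, al i = 0 → G lam al (lam i) = 0 := fun i h => hG _ (hal0 i h)
  -- a pole-free interval contains at most one zero of `G`
  have huniq : ∀ x y, x < y → (∀ i, al i ≠ 0 → lam i < x ∨ y < lam i) → G lam al x = 0 →
      G lam al y = 0 → False := fun x y hxy h h1 h2 =>
    G_ne_G hlam hxy h hbessel (h1.trans h2.symm)
  have hcont := (phi S w u a).continuous
  have hphi0 : 0 < (phi S w u a).eval 0 := by rw [phi_eval_zero]; exact Real.exp_pos _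
  refine ⟨hG0, ?_, hmono, hbessel, ?_⟩
  · intro i j k hij hjk hj
    have hlij : lam i < lam j := hmono (by rw [Fin.lt_def]; omega)
    have hljk : lam j < lam k := hmono (by rw [Fin.lt_def]; omega)
    have hgap : ∀ t, al t ≠ 0 → lam t ≤ lam i ∨ lam k ≤ lam t := by
      intro t ht
      have h1 : t ≠ j := fun h => ht (h ▸ hj)
      have h2 : (t : ℕ) ≠ j := fun h => h1 (Fin.ext h)
      rcases Nat.lt_or_ge t j with h | h
      · exact Or.inl (hmono.monotone (by rw [Fin.le_def]; omega))
      · exact Or.inr (hmono.monotone (by rw [Fin.le_def]; omega))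
    have hi0 : al i ≠ 0 := by
      intro h
      refine huniq _ _ hlij (fun t ht => ?_) (hG0 i h) (hG0 j hj)
      rcases hgap t ht with h1 | h1
      · exact Or.inl (lt_of_le_of_ne h1 fun h2 => ht (hmono.injective h2 ▸ h))
      · exact Or.inr (by linarith)
    have hk0 : al k ≠ 0 := by
      intro h
      refine huniq _ _ hljk (fun t ht => ?_) (hG0 j hj) (hG0 k h)
      rcases hgap t ht with h1 | h1
      · exact Or.inl (by linarith)
      · exact Or.inr (lt_of_le_of_ne h1 fun h2 => ht (hmono.injective h2.symm ▸ h))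
    obtain ⟨K, g, hgc, hgl, hg⟩ := exists_phi_factor ha hu (hal0 j hj)
    have hg0 : ∀ t ∈ Set.Icc (lam i) (lam k), g t ≠ 0 := by
      intro t ht h
      have hK : K ≠ 0 := by
        rintro rfl
        have h1 : ∀ z, z ≠ lam j → g z = 0 := fun z hz => by
          have := hg z
          rw [zero_mul] at this
          exact (mul_eq_zero.1 this.symm).resolve_left (sub_ne_zero.2 hz.symm)
        refine hgl (tendsto_nhds_unique (hgc.continuousAt.tendsto.mono_left
          (nhdsWithin_le_nhds (s := {lam j}ᶜ))) (tendsto_const_nhds.congr' ?_))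
        filter_upwards [self_mem_nhdsWithin] with z hz using (h1 z hz).symm
      have htj : t ≠ lam j := fun h' => hgl (h' ▸ h)
      have h2 : (phi S w u a).eval t = 0 := by
        have := hg t
        rw [h, mul_zero] at this
        exact (mul_eq_zero.1 this).resolve_left hK
      have hti : t ≠ lam i := by
        rintro rfl
        exact hi0 (by rw [hal', h2, zero_mul])
      have htk : t ≠ lam k := by
        rintro rfl
        exact hk0 (by rw [hal', h2, zero_mul])
      have h3 : lam i < t := lt_of_le_of_ne ht.1 hti.symm
      have h4 : t < lam k := lt_of_le_of_ne ht.2 htk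
      rcases lt_or_gt_of_ne htj with h5 | h5
      · refine huniq _ _ h5 (fun s hs => ?_) (hG _ h2) (hG0 j hj)
        rcases hgap s hs with h6 | h6
        · exact Or.inl (by linarith)
        · exact Or.inr (by linarith)
      · refine huniq _ _ h5 (fun s hs => ?_) (hG0 j hj) (hG _ h2)
        rcases hgap s hs with h6 | h6
        · exact Or.inl (by linarith)
        · exact Or.inr (by linarith)
    have h1 := mul_pos_of_continuous_of_ne_zero hgc (hlij.trans hljk).le hg0
    have h2 : K ^ 2 * ((phi S w u a).eval (lam i) * (phi S w u a).eval (lam k)) =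
        (lam j - lam i) * (lam j - lam k) * (g (lam i) * g (lam k)) := by
      linear_combination K * (phi S w u a).eval (lam k) * hg (lam i) +
        (lam j - lam i) * g (lam i) * hg (lam k)
    have h3 : (lam j - lam i) * (lam j - lam k) * (g (lam i) * g (lam k)) < 0 :=
      mul_neg_of_neg_of_pos (mul_neg_of_pos_of_neg (by linarith) (by linarith)) h1
    have h4 : (phi S w u a).eval (lam i) * (phi S w u a).eval (lam k) < 0 := by
      by_contra! h
      have := mul_nonneg (sq_nonneg K) h
      linarith
    rw [hal' i, hal' k]
    have h5 := mul_pos (hrpos i) (hrpos k)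
    have : (phi S w u a).eval (lam i) * r i * ((phi S w u a).eval (lam k) * r k) =
        (phi S w u a).eval (lam i) * (phi S w u a).eval (lam k) * (r i * r k) := by ring
    rw [this]
    exact mul_neg_of_neg_of_pos h4 h5
  · -- `phi S w u a` is positive at `0` and has no zero up to the next eigenvalue on either side
    have hsign : ∀ i, (∀ t, al t ≠ 0 → t ≠ i → lam t < min 0 (lam i) ∨ max 0 (lam i) < lam t) →
        0 < al i := by
      intro i hi
      rw [hal' i]
      refine mul_pos ?_ (hrpos i)
      have hne : ∀ t ∈ Set.Icc (min 0 (lam i)) (max 0 (lam i)), (phi S w u a).eval t ≠ 0 := by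
        intro t ht h
        have ht0 : t ≠ 0 := fun h0 => by rw [h0] at h; exact hphi0.ne' h
        have hpole : ∀ s, al s ≠ 0 → lam s < min 0 t ∨ max 0 t < lam s := by
          intro s hs
          by_cases hsi : s = i
          · subst hsi
            have hti : t ≠ lam s := by
              rintro rfl
              exact hs (by rw [hal', h, zero_mul])
            rcases lt_or_gt_of_ne (hlam s) with h1 | h1
            · rw [min_eq_right h1.le, max_eq_left h1.le] at ht
              left
              rw [min_eq_right ht.2]
              exact lt_of_le_of_ne ht.1 hti.symm
            · rw [min_eq_left h1.le, max_eq_right h1.le] at ht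
              right
              rw [max_eq_right ht.1]
              exact lt_of_le_of_ne ht.2 hti
          · rcases hi s hs hsi with h1 | h1
            · exact Or.inl (lt_min (h1.trans_le (min_le_left _ _)) (h1.trans_le ht.1))
            · exact Or.inr (max_lt (lt_of_le_of_lt (le_max_left _ _) h1) (ht.2.trans_lt h1))
        rcases lt_or_gt_of_ne ht0 with h1 | h1
        · rw [min_eq_right h1.le, max_eq_left h1.le] at hpole
          exact huniq t 0 h1 hpole (hG t h) (G_zero hlam)
        · rw [min_eq_left h1.le, max_eq_right h1.le] at hpole
          exact huniq 0 t h1 hpole (G_zero hlam) (hG t h)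
      have h1 := mul_pos_of_continuous_of_ne_zero hcont min_le_max hne
      have h2 : (phi S w u a).eval (min 0 (lam i)) * (phi S w u a).eval (max 0 (lam i)) =
          (phi S w u a).eval 0 * (phi S w u a).eval (lam i) := by
        rcases le_total 0 (lam i) with h | h
        · rw [min_eq_left h, max_eq_right h]
        · rw [min_eq_right h, max_eq_left h, mul_comm]
      rw [h2] at h1
      exact pos_of_mul_pos_right h1 hphi0.le
    set F : Finset (Fin N) := univ.filter fun i => lam i < 0 with hF
    have hcard : ∀ i : Fin N, lam i < 0 ↔ (i : ℕ) < F.card := by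
      intro i
      constructor
      · intro hi
        have : Finset.Iic i ⊆ F := fun t ht => by
          rw [hF, mem_filter]
          exact ⟨mem_univ _, (hmono.monotone (Finset.mem_Iic.1 ht)).trans_lt hi⟩
        have := Finset.card_le_card this
        rw [Fin.card_Iic] at this
        omega
      · intro hi
        by_contra! h
        have : F ⊆ Finset.Iio i := fun t ht => by
          rw [hF, mem_filter] at ht
          rw [Finset.mem_Iio]
          exact hmono.lt_iff_lt.1 (ht.2.trans_le h)
        have := Finset.card_le_card this
        rw [Fin.card_Iio] at this
        omega
    refine ⟨F.card, (Finset.card_le_univ F).trans (by simp), fun i hi => ?_, fun i hi => ?_⟩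
    · have hneg : lam i < 0 := (hcard i).2 (by omega)
      refine ⟨hneg, hsign i fun t _ hti => ?_⟩
      rw [min_eq_right hneg.le, max_eq_left hneg.le]
      have hti' : (t : ℕ) ≠ i := fun h => hti (Fin.ext h)
      rcases Nat.lt_or_ge t i with h | h
      · exact Or.inl (hmono (by rw [Fin.lt_def]; omega))
      · refine Or.inr (lt_of_le_of_ne (not_lt.1 fun h' => ?_) (hlam t).symm)
        have := (hcard t).1 h'
        omega
    · have hpos : 0 < lam i := lt_of_le_of_ne (not_lt.1 fun h' => by
        have := (hcard i).1 h'
        omega) (hlam i).symm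
      refine ⟨hpos, hsign i fun t _ hti => ?_⟩
      rw [min_eq_left hpos.le, max_eq_right hpos.le]
      have hti' : (t : ℕ) ≠ i := fun h => hti (Fin.ext h)
      rcases Nat.lt_or_ge t i with h | h
      · exact Or.inl ((hcard t).2 (by omega))
      · exact Or.inr (hmono (by rw [Fin.lt_def]; omega))

end Necessity

/-! ### Rational Nevanlinna functions -/

/-- The monic polynomial with simple roots at the points of `K`. -/
noncomputable def rootPoly (K : Finset ℝ) : ℝ[X] := ∏ k ∈ K, (X - C k)

/-- The numerator over the denominator `rootPoly K` of the rational Nevanlinna function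
`A z + b + ∑ k ∈ K, r k / (k - z)`. -/
noncomputable def nevNum (A b : ℝ) (r : ℝ → ℝ) (K : Finset ℝ) : ℝ[X] :=
  (C A * X + C b) * rootPoly K - ∑ k ∈ K, C (r k) * rootPoly (K.erase k)

lemma rootPoly_monic (K : Finset ℝ) : (rootPoly K).Monic :=
  monic_prod_of_monic _ _ fun k _ => monic_X_sub_C k

lemma natDegree_rootPoly (K : Finset ℝ) : (rootPoly K).natDegree = K.card := by
  rw [rootPoly, natDegree_prod_of_monic K (fun k => X - C k) fun k _ => monic_X_sub_C k]
  simp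

lemma eval_rootPoly (K : Finset ℝ) (z : ℝ) : (rootPoly K).eval z = ∏ k ∈ K, (z - k) := by
  simp [rootPoly, eval_prod]

lemma eval_rootPoly_eq_zero {K : Finset ℝ} {z : ℝ} : (rootPoly K).eval z = 0 ↔ z ∈ K := by
  rw [eval_rootPoly, prod_eq_zero_iff]
  simp [sub_eq_zero]

lemma rootPoly_erase {K : Finset ℝ} {k : ℝ} (hk : k ∈ K) :
    (X - C k) * rootPoly (K.erase k) = rootPoly K := mul_prod_erase K (fun k => X - C k) hk

lemma rootPoly_insert {K : Finset ℝ} {k : ℝ} (hk : k ∉ K) :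
    rootPoly (insert k K) = (X - C k) * rootPoly K := prod_insert hk

lemma aeval_nevNum {L : Type*} [Field L] [Algebra ℝ L] {A b : ℝ} {r : ℝ → ℝ} {K : Finset ℝ} {z : L}
    (hz : ∀ k ∈ K, z ≠ algebraMap ℝ L k) : aeval z (nevNum A b r K) = aeval z (rootPoly K) *
      (algebraMap ℝ L A * z + algebraMap ℝ L b
        + ∑ k ∈ K, algebraMap ℝ L (r k) / (algebraMap ℝ L k - z)) := by
  rw [nevNum, map_sub, map_mul, map_sum, mul_add, sub_eq_add_neg, mul_sum, ← sum_neg_distrib]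
  congr 1
  · simp only [map_add, map_mul, aeval_C, aeval_X]; ring
  · refine sum_congr rfl fun k hk => ?_
    have h1 : algebraMap ℝ L k - z ≠ 0 := sub_ne_zero.2 (hz k hk).symm
    rw [← rootPoly_erase hk]
    simp only [map_mul, aeval_C, map_sub, aeval_X]
    field_simp
    ring

lemma eval_nevNum {A b : ℝ} {r : ℝ → ℝ} {K : Finset ℝ} {z : ℝ} (hz : z ∉ K) :
    (nevNum A b r K).eval z = (rootPoly K).eval z * (A * z + b + ∑ k ∈ K, r k / (k - z)) := by
  have := aeval_nevNum (A := A) (b := b) (r := r) (K := K) (z := z)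
    (fun k hk h => hz (by simp only [Algebra.algebraMap_self, RingHom.id_apply] at h; rwa [h]))
  simpa using this

lemma eval_nevNum_self {A b : ℝ} {r : ℝ → ℝ} {K : Finset ℝ} {k : ℝ} (hk : k ∈ K) :
    (nevNum A b r K).eval k = - (r k * (rootPoly (K.erase k)).eval k) := by
  have h0 : (rootPoly K).eval k = 0 := eval_rootPoly_eq_zero.2 hk
  rw [nevNum, eval_sub, eval_mul, h0, mul_zero, zero_sub, eval_finsetSum, sum_eq_single k]
  · simp
  · intro j _ hjk
    rw [eval_mul, eval_rootPoly_eq_zero.2 (mem_erase.2 ⟨hjk.symm, hk⟩), mul_zero]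
  · exact fun h => absurd hk h

lemma natDegree_sum_rootPoly_le (r : ℝ → ℝ) (K : Finset ℝ) :
    (∑ k ∈ K, C (r k) * rootPoly (K.erase k)).natDegree ≤ K.card - 1 := by
  refine natDegree_sum_le_of_forall_le _ _ fun k hk => (natDegree_C_mul_le _ _).trans ?_
  rw [natDegree_rootPoly, card_erase_of_mem hk]

section Inversion

variable {A b : ℝ} {r : ℝ → ℝ} {K : Finset ℝ} (hA : 0 ≤ A) (hr : ∀ k ∈ K, 0 < r k)

include hr in
lemma eval_nevNum_ne_zero {k : ℝ} (hk : k ∈ K) : (nevNum A b r K).eval k ≠ 0 := by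
  rw [eval_nevNum_self hk, neg_ne_zero]
  refine mul_ne_zero (hr k hk).ne' fun h => ?_
  exact (notMem_erase k K) (eval_rootPoly_eq_zero.1 h)

include hr in
lemma nevNum_ne_zero (hne : K.Nonempty ∨ A ≠ 0 ∨ b ≠ 0) : nevNum A b r K ≠ 0 := by
  intro h
  rcases K.eq_empty_or_nonempty with rfl | ⟨k, hk⟩
  · have h' : C A * X + C b = (0 : ℝ[X]) := by simpa [nevNum, rootPoly] using h
    have h0 := congrArg (coeff · 0) h'
    have h1 := congrArg (coeff · 1) h'
    simp at h0 h1
    simp [h0, h1] at hne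
  · exact eval_nevNum_ne_zero (A := A) (b := b) hr hk (by rw [h, eval_zero])

include hA hr in
/-- A Nevanlinna function has positive imaginary part in the upper half-plane, hence only real
zeros. -/
lemma nevNum_splits (hne : K.Nonempty ∨ A ≠ 0 ∨ b ≠ 0) : (nevNum A b r K).Splits := by
  have hP := nevNum_ne_zero (A := A) (b := b) hr hne
  refine Splits.of_splits_map (algebraMap ℝ ℂ) (IsAlgClosed.splits _) fun z hz => ?_
  have hz0 : aeval z (nevNum A b r K) = 0 := by
    have := (mem_roots'.1 hz).2
    rwa [IsRoot, eval_map_algebraMap] at this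
  by_cases him : z.im = 0
  · exact ⟨z.re, Complex.ext rfl (by simp [him])⟩
  exfalso
  have hzk : ∀ k : ℝ, z ≠ (k : ℂ) := fun k h => him (by rw [h, Complex.ofReal_im])
  rw [aeval_nevNum fun k _ => hzk k] at hz0
  have hd : aeval z (rootPoly K) ≠ 0 := by
    rw [rootPoly, map_prod, prod_ne_zero_iff]
    intro k _
    simpa using sub_ne_zero.2 (hzk k)
  have hF := (mul_eq_zero.1 hz0).resolve_left hd
  simp only [Complex.coe_algebraMap] at hF
  have him' := congrArg Complex.im hF
  have hterm : ∀ k : ℝ, ((r k : ℂ) / ((k : ℂ) - z)).im =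
      z.im * (r k / Complex.normSq ((k : ℂ) - z)) := by
    intro k
    rw [Complex.div_im]
    simp
    ring
  simp only [Complex.add_im, Complex.im_sum, hterm, Complex.im_ofReal_mul, Complex.ofReal_im,
    add_zero, Complex.zero_im, ← mul_sum] at him'
  have hsum : A + ∑ k ∈ K, r k / Complex.normSq ((k : ℂ) - z) = 0 := by
    have : z.im * (A + ∑ k ∈ K, r k / Complex.normSq ((k : ℂ) - z)) = 0 := by
      rw [← him']; ring
    exact (mul_eq_zero.1 this).resolve_left him
  have hpos : ∀ k ∈ K, 0 < r k / Complex.normSq ((k : ℂ) - z) := fun k hk =>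
    div_pos (hr k hk) (Complex.normSq_pos.2 (sub_ne_zero.2 (hzk k).symm))
  rcases K.eq_empty_or_nonempty with rfl | hK
  · simp only [sum_empty, add_zero] at hsum
    subst hsum
    have hb : b ≠ 0 := by simpa using hne
    simp at hF
    exact hb hF
  · have := sum_pos hpos hK
    linarith

include hA hr in
/-- A Nevanlinna function is strictly increasing on the real line, hence its zeros are simple. -/
lemma eval_derivative_nevNum (hne : K.Nonempty ∨ A ≠ 0 ∨ b ≠ 0) {x : ℝ}
    (hx : (nevNum A b r K).eval x = 0) :
    ∃ m, 0 < m ∧ (derivative (nevNum A b r K)).eval x = (rootPoly K).eval x * m := by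
  have hxK : x ∉ K := fun h => eval_nevNum_ne_zero hr h hx
  have hkx : ∀ k ∈ K, k - x ≠ 0 := fun k hk => sub_ne_zero.2 fun h => hxK (h ▸ hk)
  have hd0 : (rootPoly K).eval x ≠ 0 := fun h => hxK (eval_rootPoly_eq_zero.1 h)
  have hF0 : A * x + b + ∑ k ∈ K, r k / (k - x) = 0 := by
    rw [eval_nevNum hxK] at hx
    exact (mul_eq_zero.1 hx).resolve_left hd0
  set m := A + ∑ k ∈ K, r k / (k - x) ^ 2 with hm
  have hFd : HasDerivAt (fun z => A * z + b + ∑ k ∈ K, r k / (k - z)) m x := by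
    have h1 : HasDerivAt (fun z : ℝ => A * z + b) A x := by
      simpa using ((hasDerivAt_id x).const_mul A).add_const b
    have h2 : HasDerivAt (fun z : ℝ => ∑ k ∈ K, r k / (k - z)) (∑ k ∈ K, r k / (k - x) ^ 2) x := by
      refine HasDerivAt.fun_sum fun k hk => ?_
      refine ((((hasDerivAt_id x).const_sub k).inv (hkx k hk)).const_mul (r k)).congr_deriv ?_
      simp; ring
    exact h1.add h2
  have hev : (fun z => (nevNum A b r K).eval z) =ᶠ[𝓝 x]
      fun z => (rootPoly K).eval z * (A * z + b + ∑ k ∈ K, r k / (k - z)) := by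
    have : ∀ᶠ z in 𝓝 x, z ∉ (K : Set ℝ) :=
      K.finite_toSet.isClosed.isOpen_compl.mem_nhds (by simpa using hxK)
    filter_upwards [this] with z hz using eval_nevNum (by simpa using hz)
  have h3 := (((rootPoly K).hasDerivAt x).mul hFd).congr_of_eventuallyEq hev
  refine ⟨m, ?_, ?_⟩
  · have hpos : ∀ k ∈ K, 0 < r k / (k - x) ^ 2 := fun k hk => by
      have := hr k hk
      have := hkx k hk
      positivity
    rcases K.eq_empty_or_nonempty with rfl | hK
    · simp only [sum_empty, add_zero] at hm hF0
      rcases hA.lt_or_eq with h | h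
      · rw [hm]; exact h
      · simp [← h] at hne hF0
        exact absurd hF0 hne
    · have := sum_pos hpos hK
      linarith
  · rw [((nevNum A b r K).hasDerivAt x).unique h3, hF0, mul_zero, zero_add]

include hr in
/-- The only Nevanlinna functions with fewer zeros than poles are those with `A = b = 0`; they are
`-(∑ r k) / z` to leading order at `∞`. -/
lemma natDegree_nevNum (hA : 0 ≤ A) (hne : K.Nonempty ∨ A ≠ 0 ∨ b ≠ 0) :
    K.card ≤ (nevNum A b r K).natDegree ∨
      (K.card = (nevNum A b r K).natDegree + 1 ∧ (nevNum A b r K).leadingCoeff < 0) := by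
  set D := ∑ k ∈ K, C (r k) * rootPoly (K.erase k) with hD
  have hDd : D.natDegree ≤ K.card - 1 := natDegree_sum_rootPoly_le r K
  have hlead : (rootPoly K).coeff K.card = 1 := by
    have := (rootPoly_monic K).coeff_natDegree
    rwa [natDegree_rootPoly] at this
  have hd1 : (rootPoly K).coeff (K.card + 1) = 0 :=
    coeff_eq_zero_of_natDegree_lt (by rw [natDegree_rootPoly]; omega)
  have hD1 : D.coeff (K.card + 1) = 0 := coeff_eq_zero_of_natDegree_lt (by omega)
  have hc1 : (nevNum A b r K).coeff (K.card + 1) = A := by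
    rw [nevNum, coeff_sub, ← hD, hD1, add_mul, coeff_add, mul_assoc, coeff_C_mul, coeff_X_mul,
      coeff_C_mul, hlead, hd1]; ring
  by_cases hA0 : A = 0
  · subst hA0
    have hnum : nevNum 0 b r K = C b * rootPoly K - D := by rw [nevNum, C_0, zero_mul, zero_add]
    by_cases hb : b = 0
    · subst hb
      have hK : K.Nonempty := by simpa using hne
      have hKc := hK.card_pos
      right
      have hnum' : nevNum 0 0 r K = -D := by rw [hnum, C_0, zero_mul, zero_sub]
      have hco : D.coeff (K.card - 1) = ∑ k ∈ K, r k := by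
        rw [hD, finsetSum_coeff]
        refine sum_congr rfl fun k hk => ?_
        rw [coeff_C_mul]
        have := (rootPoly_monic (K.erase k)).coeff_natDegree
        rw [natDegree_rootPoly, card_erase_of_mem hk] at this
        rw [this, mul_one]
      have hpos : 0 < ∑ k ∈ K, r k := sum_pos hr hK
      have hdeg : D.natDegree = K.card - 1 :=
        le_antisymm hDd (le_natDegree_of_ne_zero (by rw [hco]; exact hpos.ne'))
      rw [hnum', natDegree_neg, leadingCoeff_neg, leadingCoeff, hdeg, hco]
      exact ⟨by omega, by linarith⟩
    · left
      rcases Nat.eq_zero_or_pos K.card with h | h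
      · omega
      · refine le_natDegree_of_ne_zero ?_
        rw [hnum, coeff_sub, coeff_C_mul, hlead,
          coeff_eq_zero_of_natDegree_lt (p := D) (by omega)]
        simpa using hb
  · left
    have := le_natDegree_of_ne_zero (p := nevNum A b r K) (n := K.card + 1) (by rwa [hc1])
    omega

include hA hr in
/-- If `F = A z + b + ∑ r k / (k - z)` is a nonzero rational Nevanlinna function, then so is
`-1 / F`. Here `F = ρ * rootPoly Z / rootPoly K`, where `Z` is the set of zeros of `F`. -/
theorem exists_nevNum_inversion (hne : K.Nonempty ∨ A ≠ 0 ∨ b ≠ 0) :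
    ∃ (ρ : ℝ) (Z : Finset ℝ) (A' b' : ℝ) (c : ℝ → ℝ), ρ ≠ 0 ∧ 0 ≤ A' ∧ (∀ ζ ∈ Z, 0 < c ζ) ∧
      nevNum A b r K = C ρ * rootPoly Z ∧ rootPoly K = - C ρ * nevNum A' b' c Z := by
  classical
  set P := nevNum A b r K with hPdef
  have hP : P ≠ 0 := nevNum_ne_zero hr hne
  have hsplit : P.Splits := nevNum_splits hA hr hne
  set ρ := P.leadingCoeff with hρdef
  have hρ : ρ ≠ 0 := leadingCoeff_ne_zero.2 hP
  set Z := P.roots.toFinset with hZ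
  have hmult : P.roots.Nodup := by
    rw [Multiset.nodup_iff_count_le_one]
    intro x
    rw [count_roots]
    by_contra! h
    obtain ⟨h1, h2⟩ := (one_lt_rootMultiplicity_iff_isRoot hP).1 h
    obtain ⟨m, hm, hm'⟩ := eval_derivative_nevNum hA hr hne h1
    rw [IsRoot.def, hm'] at h2
    rcases mul_eq_zero.1 h2 with h3 | h3
    · exact eval_nevNum_ne_zero hr (eval_rootPoly_eq_zero.1 h3) h1
    · exact hm.ne' h3
  have hPZ : P = C ρ * rootPoly Z := by
    conv_lhs => rw [hsplit.eq_prod_roots]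
    rw [rootPoly, Finset.prod, hZ, Multiset.toFinset_val, hmult.dedup]
  have hPd : P.natDegree = Z.card := by
    rw [hPZ, natDegree_C_mul hρ, natDegree_rootPoly]
  have hroot : ∀ ζ ∈ Z, P.eval ζ = 0 := fun ζ hζ => by
    rw [hPZ, eval_mul, eval_rootPoly_eq_zero.2 hζ, mul_zero]
  -- `-1 / F = Q / rootPoly Z`; its linear part is the quotient of a division with remainder and its
  -- fractional part the partial fraction expansion of the remainder
  set Q := -C ρ⁻¹ * rootPoly K with hQ
  have hmon := rootPoly_monic Z
  set q := Q /ₘ rootPoly Z with hq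
  set R := Q %ₘ rootPoly Z with hR
  have hdiv : R + rootPoly Z * q = Q := modByMonic_add_div Q (rootPoly Z)
  have hRd : R.degree < Z.card := by
    have := degree_modByMonic_lt Q hmon
    rwa [degree_eq_natDegree hmon.ne_zero, natDegree_rootPoly] at this
  have hQd : Q.natDegree = K.card := by
    rw [hQ, ← C_neg, natDegree_C_mul (neg_ne_zero.2 (inv_ne_zero hρ)), natDegree_rootPoly]
  have hdegs := natDegree_nevNum (A := A) (b := b) hr hA hne
  rw [← hPdef, hPd, ← hρdef] at hdegs
  have hqd : q.natDegree ≤ 1 := by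
    rw [hq, natDegree_divByMonic _ hmon, natDegree_rootPoly, hQd]
    omega
  have hq1 : q = C (q.coeff 1) * X + C (q.coeff 0) := eq_X_add_C_of_natDegree_le_one hqd
  have hA' : 0 ≤ q.coeff 1 := by
    rcases hdegs with h | ⟨h, hneg⟩
    · rw [coeff_eq_zero_of_natDegree_lt]
      rw [hq, natDegree_divByMonic _ hmon, natDegree_rootPoly, hQd]
      omega
    · have h1 : q.natDegree = 1 := by
        rw [hq, natDegree_divByMonic _ hmon, natDegree_rootPoly, hQd]
        omega
      have h2 : q.leadingCoeff = Q.leadingCoeff := by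
        refine leadingCoeff_divByMonic_of_monic hmon ?_
        have hQ0 : Q ≠ 0 := fun h0 => by
          rw [h0, natDegree_zero] at hQd
          omega
        rw [degree_eq_natDegree hmon.ne_zero, degree_eq_natDegree hQ0, natDegree_rootPoly, hQd]
        exact_mod_cast (by omega : Z.card ≤ K.card)
      rw [leadingCoeff, h1] at h2
      rw [h2, hQ, ← C_neg, leadingCoeff_mul, leadingCoeff_C, (rootPoly_monic K).leadingCoeff,
        mul_one, Left.nonneg_neg_iff]
      exact (inv_lt_zero.2 hneg).le
  -- the residues are positive because `F` is increasing at its zeros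
  have herase : ∀ ζ ∈ Z, (rootPoly (Z.erase ζ)).eval ζ ≠ 0 := fun ζ _ h =>
    notMem_erase ζ Z (eval_rootPoly_eq_zero.1 h)
  refine ⟨ρ, Z, q.coeff 1, q.coeff 0, fun ζ => - R.eval ζ / (rootPoly (Z.erase ζ)).eval ζ, hρ, hA',
    fun ζ hζ => ?_, hPZ, ?_⟩
  · have h1 : R.eval ζ = -ρ⁻¹ * (rootPoly K).eval ζ := by
      have := congrArg (eval ζ) hdiv
      rw [eval_add, eval_mul, eval_rootPoly_eq_zero.2 hζ, zero_mul, add_zero, hQ, eval_mul] at this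
      simpa using this
    obtain ⟨m, hm, hm'⟩ := eval_derivative_nevNum hA hr hne (hroot ζ hζ)
    have h2 : (derivative P).eval ζ = ρ * (rootPoly (Z.erase ζ)).eval ζ := by
      rw [hPZ, ← rootPoly_erase hζ]
      simp
    rw [← hPdef, h2] at hm'
    have h3 : (rootPoly K).eval ζ ≠ 0 := fun h =>
      eval_nevNum_ne_zero hr (eval_rootPoly_eq_zero.1 h) (hroot ζ hζ)
    have h4 := herase ζ hζ
    have h5 : - R.eval ζ / (rootPoly (Z.erase ζ)).eval ζ = m⁻¹ := by
      rw [h1]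
      field_simp
      linear_combination -hm'
    simp only [h5]
    exact inv_pos.2 hm
  · have hRsum : R = - ∑ ζ ∈ Z, C (- R.eval ζ / (rootPoly (Z.erase ζ)).eval ζ) *
        rootPoly (Z.erase ζ) := by
      rcases Z.eq_empty_or_nonempty with h0 | h0
      · rw [h0] at hRd ⊢
        simpa using hRd
      refine Polynomial.eq_of_degrees_lt_of_eval_finset_eq Z hRd ?_ fun ζ hζ => ?_
      · rw [degree_neg]
        have h1 := natDegree_sum_rootPoly_le
          (fun ζ => - R.eval ζ / (rootPoly (Z.erase ζ)).eval ζ) Z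
        refine degree_le_natDegree.trans_lt ?_
        have := h0.card_pos
        exact_mod_cast (by omega : _ < Z.card)
      · have h2 := eval_nevNum_self (A := 0) (b := 0)
          (r := fun ζ => - R.eval ζ / (rootPoly (Z.erase ζ)).eval ζ) hζ
        rw [nevNum, C_0, zero_mul, zero_add, zero_mul, zero_sub] at h2
        rw [h2, div_mul_cancel₀ _ (herase ζ hζ), neg_neg]
    have h6 : nevNum (q.coeff 1) (q.coeff 0)
        (fun ζ => - R.eval ζ / (rootPoly (Z.erase ζ)).eval ζ) Z = Q := by
      rw [nevNum, ← hq1, sub_eq_add_neg, ← hRsum, ← hdiv]; ring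
    have h7 : C ρ * C ρ⁻¹ = 1 := by rw [← C_mul, mul_inv_cancel₀ hρ, C_1]
    rw [h6, hQ]
    linear_combination (-rootPoly K) * h7

end Inversion

/-! ### The inverse problem on a half-line -/

lemma nevNum_zero (b : ℝ) (r : ℝ → ℝ) (K : Finset ℝ) :
    nevNum 0 b r K = C b * rootPoly K + nevNum 0 0 r K := by
  simp only [nevNum, C_0]; ring

/-- The numerator of `∑ c k * k / (k - z) = z * ∑ c k / (k - z) + ∑ c k`. -/
lemma nevNum_mul_self (c : ℝ → ℝ) (K : Finset ℝ) : nevNum 0 0 (fun k => c k * k) K =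
    X * nevNum 0 0 c K + C (∑ k ∈ K, c k) * rootPoly K := by
  have h : ∀ k ∈ K, C (c k * k) * rootPoly (K.erase k) =
      X * (C (c k) * rootPoly (K.erase k)) - C (c k) * rootPoly K := fun k hk => by
    rw [← rootPoly_erase hk, C_mul]; ring
  simp only [nevNum, C_0, zero_mul, zero_add, zero_sub]
  rw [sum_congr rfl h, sum_sub_distrib, ← mul_sum, ← sum_mul, ← map_sum]
  ring

lemma nevNum_insert_zero (A b : ℝ) (c : ℝ → ℝ) {K : Finset ℝ} (h0 : (0 : ℝ) ∉ K) :
    nevNum A b c (insert 0 K) = X * ((C A * X + C b) * rootPoly K + nevNum 0 0 c K)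
      - C (c 0) * rootPoly K := by
  have h : ∀ k ∈ K, C (c k) * rootPoly ((insert 0 K).erase k) =
      X * (C (c k) * rootPoly (K.erase k)) := fun k hk => by
    have hk0 : (0 : ℝ) ≠ k := fun h => h0 (h ▸ hk)
    rw [erase_insert_of_ne hk0, rootPoly_insert fun h => h0 (mem_of_mem_erase h), C_0, sub_zero]
    ring
  simp only [nevNum, C_0, zero_mul, zero_add, zero_sub]
  rw [sum_insert h0, sum_congr rfl h, ← mul_sum, rootPoly_insert h0, erase_insert h0, C_0, sub_zero]
  ring

/-- The coefficient of `exp (x / 2)` of `φ₊` near `-∞` as a polynomial in the spectral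
parameter. -/
noncomputable def grow (S : Finset ℝ) (w u : ℝ → ℝ) : ℝ[X] := growth S (pw w u) (phi S w u)

lemma eval_grow (S : Finset ℝ) (w u : ℝ → ℝ) (z : ℝ) : (grow S w u).eval z =
    ∑ s ∈ S, Real.exp (-s / 2) * ((w s * z + u s * z ^ 2) * (phi S w u s).eval z) := by
  simp [grow, growth, eval_finsetSum, eval_pw]

lemma eval_wron_eq (S : Finset ℝ) (w u : ℝ → ℝ) (z : ℝ) : (wron S w u).eval z =
    1 - ∑ s ∈ S, Real.exp (s / 2) * ((w s * z + u s * z ^ 2) * (phi S w u s).eval z) := by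
  simp [eval_wron, wronski, eval_pw]

lemma eval_phi_of_le {S : Finset ℝ} {w u : ℝ → ℝ} {a : ℝ} (ha : ∀ s ∈ S, a ≤ s) (z : ℝ) :
    (phi S w u a).eval z =
      Real.exp (-a / 2) * (wron S w u).eval z + Real.exp (a / 2) * (grow S w u).eval z := by
  have := (isJost_phi S w u).eq_exp_of_le ha
  rw [this]
  simp [wron, grow]

/-- `phi` at `a` only depends on the weights to the right of `a`. -/
lemma phi_congr {S S' : Finset ℝ} {w u w' u' : ℝ → ℝ} {a : ℝ}
    (hS : S.filter (a < ·) = S'.filter (a < ·)) (hw : ∀ s, a < s → w s = w' s)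
    (hu : ∀ s, a < s → u s = u' s) {x : ℝ} (hx : a ≤ x) : phi S w u x = phi S' w' u' x :=
  (isJost_phi S w u).restrict (isJost_phi S' w' u') hS
    (fun s hs => by rw [pw, pw, hw s hs, hu s hs]) x hx

/-- Effect of a further point mass at `s`, to the left of all others, on the data at `a < s`. -/
lemma eval_insert_mass {S : Finset ℝ} {w u : ℝ → ℝ} {a s w₀ u₀ : ℝ} (has : a < s)
    (hS : ∀ t ∈ S, s < t) (z : ℝ) :
    let w' := Function.update w s w₀
    let u' := Function.update u s u₀
    let Y := Real.exp s * (grow S w u).eval z +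
      (w₀ * z + u₀ * z ^ 2) * (Real.exp (s / 2) * (phi S w u s).eval z)
    Real.exp a * (grow (insert s S) w' u').eval z = Real.exp (a - s) * Y ∧
    Real.exp (a / 2) * (phi (insert s S) w' u' a).eval z =
      Real.exp (s / 2) * (phi S w u s).eval z - (1 - Real.exp (a - s)) * Y := by
  intro w' u' Y
  have hsS : s ∉ S := fun h => lt_irrefl _ (hS s h)
  have hne : ∀ t ∈ S, t ≠ s := fun t ht => (hS t ht).ne'
  have hphi : ∀ x, s ≤ x → phi (insert s S) w' u' x = phi S w u x := fun x hx =>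
    phi_congr (by rw [filter_insert, if_neg (lt_irrefl _)])
      (fun t ht => Function.update_of_ne ht.ne' _ _)
      (fun t ht => Function.update_of_ne ht.ne' _ _) hx
  have hw : w' s = w₀ := Function.update_self ..
  have hu : u' s = u₀ := Function.update_self ..
  have hterm : ∀ g : ℝ → ℝ, ∑ t ∈ S, g t * ((w' t * z + u' t * z ^ 2) *
      (phi (insert s S) w' u' t).eval z) =
      ∑ t ∈ S, g t * ((w t * z + u t * z ^ 2) * (phi S w u t).eval z) := by
    intro g
    refine sum_congr rfl fun t ht => ?_
    rw [hphi t (hS t ht).le]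
    simp only [w', u']
    rw [Function.update_of_ne (hne t ht), Function.update_of_ne (hne t ht)]
  have hg : (grow (insert s S) w' u').eval z = (grow S w u).eval z +
      Real.exp (-s / 2) * ((w₀ * z + u₀ * z ^ 2) * (phi S w u s).eval z) := by
    rw [eval_grow, sum_insert hsS, hterm (fun t => Real.exp (-t / 2)), hw, hu, hphi s le_rfl,
      eval_grow]
    ring
  have hW : (wron (insert s S) w' u').eval z = (wron S w u).eval z -
      Real.exp (s / 2) * ((w₀ * z + u₀ * z ^ 2) * (phi S w u s).eval z) := by
    rw [eval_wron_eq, sum_insert hsS, hterm (fun t => Real.exp (t / 2)), hw, hu, hphi s le_rfl,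
      eval_wron_eq]
    ring
  have h1 := eval_phi_of_le (S := S) (w := w) (u := u) (a := s) (fun t ht => (hS t ht).le) z
  have h2 := eval_phi_of_le (S := insert s S) (w := w') (u := u') (a := a)
    (fun t ht => (mem_insert.1 ht).elim (fun h => h ▸ has.le) fun h => (has.trans (hS t h)).le) z
  have ea : Real.exp a = Real.exp (a / 2) * Real.exp (a / 2) := by
    rw [← Real.exp_add]; congr 1; ring
  have es : Real.exp s = Real.exp (s / 2) * Real.exp (s / 2) := by
    rw [← Real.exp_add]; congr 1; ring
  have eas : Real.exp (a - s) = Real.exp (a / 2) * Real.exp (a / 2) *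
      (Real.exp (-s / 2) * Real.exp (-s / 2)) := by
    rw [← Real.exp_add, ← Real.exp_add, ← Real.exp_add]; congr 1; ring
  have i1 := exp_half_mul a
  have i2 := exp_half_mul s
  constructor
  · rw [hg, eas, ea]
    simp only [Y, es]
    generalize Real.exp (a / 2) = x at *
    generalize Real.exp (s / 2) = y at *
    generalize Real.exp (-s / 2) = y' at *
    linear_combination (-(x ^ 2 * (grow S w u).eval z) * (y * y' + 1) - x ^ 2 * y' *
      ((w₀ * z + u₀ * z ^ 2) * (phi S w u s).eval z)) * i2
  · rw [h2, hg, hW, eas]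
    simp only [Y, es]
    rw [h1]
    generalize Real.exp (a / 2) = x at *
    generalize Real.exp (-a / 2) = x' at *
    generalize Real.exp (s / 2) = y at *
    generalize Real.exp (-s / 2) = y' at *
    generalize (grow S w u).eval z = g at *
    generalize (wron S w u).eval z = W at *
    generalize w₀ * z + u₀ * z ^ 2 = q at *
    linear_combination (W - y * q * (y' * W + y * g)) * i1 +
      (-W - x ^ 2 * g * (1 + y * y') - x ^ 2 * y' * q * (y' * W + y * g)) * i2

/-- The inverse problem on the half-line `(a, ∞)`: any `z`-multiple of a rational Nevanlinna
function `∑ c k / (k - z)` is the ratio of the growing part of `φ₊` to `φ₊` at `a`. The nearest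
point mass is found from the value at `∞`, and the mass itself from the linear part of the
function `-1 / F` with one pole less. -/
theorem exists_weights_half_line (n : ℕ) : ∀ (K : Finset ℝ) (c : ℝ → ℝ) (a : ℝ), K.card = n →
    (0 : ℝ) ∉ K → (∀ k ∈ K, 0 < c k) → ∃ (S : Finset ℝ) (w u : ℝ → ℝ), (∀ s ∈ S, a < s) ∧
      (∀ s, 0 ≤ u s) ∧ ∀ z,
      (rootPoly K).eval 0 * (Real.exp (a / 2) * (phi S w u a).eval z) = (rootPoly K).eval z ∧
      (rootPoly K).eval 0 * (Real.exp a * (grow S w u).eval z) =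
        z * (nevNum 0 0 c K).eval z := by
  induction n using Nat.strong_induction_on with
  | _ n ih =>
  intro K c a hn h0 hc
  rcases K.eq_empty_or_nonempty with rfl | hK
  · refine ⟨∅, 0, 0, by simp, by simp, fun z => ?_⟩
    have h1 : (phi ∅ 0 0 a).eval z = Real.exp (-a / 2) := by
      have := eval_phi ∅ 0 0 z a
      simpa using this
    rw [h1, exp_half_mul, eval_grow]
    simp [rootPoly, nevNum]
  set σ := ∑ k ∈ K, c k with hσ
  have hσpos : 0 < σ := sum_pos hc hK
  obtain ⟨ρ, Z, A', b', c', hρ, hA', hc', hE1, hE2⟩ := exists_nevNum_inversion (A := 0)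
    (b := -∑ k ∈ K, c k * k) (r := fun k => c k * k * k) (K := K) le_rfl
    (fun k hk => by
      have hk0 : k ≠ 0 := fun h => h0 (h ▸ hk)
      have := hc k hk
      have := mul_self_pos.2 hk0
      rw [mul_assoc]; positivity) (Or.inl hK)
  have hI1 : nevNum 0 (-∑ k ∈ K, c k * k) (fun k => c k * k * k) K =
      X * nevNum 0 0 (fun k => c k * k) K := by
    rw [nevNum_zero, nevNum_mul_self (fun k => c k * k), C_neg]; ring
  rw [hI1] at hE1
  -- the constant term was chosen so that the function vanishes at `0`
  have hZ0 : (0 : ℝ) ∈ Z := by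
    have := congrArg (eval 0) hE1
    simp only [eval_mul, eval_X, zero_mul, eval_C] at this
    exact eval_rootPoly_eq_zero.1 ((mul_eq_zero.1 this.symm).resolve_left hρ)
  set K' := Z.erase 0 with hK'
  have h0' : (0 : ℝ) ∉ K' := notMem_erase 0 Z
  have hZ : Z = insert 0 K' := (insert_erase hZ0).symm
  have hn' : nevNum 0 0 (fun k => c k * k) K = C ρ * rootPoly K' := by
    have h1 : rootPoly Z = X * rootPoly K' := by rw [hZ, rootPoly_insert h0', C_0, sub_zero]
    rw [h1] at hE1
    have : X * nevNum 0 0 (fun k => c k * k) K = X * (C ρ * rootPoly K') := by rw [hE1]; ring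
    exact mul_left_cancel₀ X_ne_zero this
  have hcard : K'.card < n := by
    have h1 : (nevNum 0 0 (fun k => c k * k) K).natDegree ≤ K.card - 1 := by
      simp only [nevNum, C_0, zero_mul, zero_add, zero_sub, natDegree_neg]
      exact natDegree_sum_rootPoly_le _ K
    rw [hn', natDegree_C_mul hρ, natDegree_rootPoly] at h1
    have := hK.card_pos
    omega
  rw [hZ, nevNum_insert_zero A' b' c' h0'] at hE2
  have hI2 := nevNum_mul_self c K
  rw [hn', ← hσ] at hI2
  have eI2 : ∀ z, ρ * (rootPoly K').eval z =
      z * (nevNum 0 0 c K).eval z + σ * (rootPoly K).eval z := fun z => by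
    have := congrArg (eval z) hI2
    simpa using this
  have eE2 : ∀ z, (rootPoly K).eval z = -ρ * (z * ((A' * z + b') * (rootPoly K').eval z +
      (nevNum 0 0 c' K').eval z) - c' 0 * (rootPoly K').eval z) := fun z => by
    have := congrArg (eval z) hE2
    simpa using this
  set D := (rootPoly K).eval 0 with hD
  set D' := (rootPoly K').eval 0 with hD'
  have hD0 : D ≠ 0 := fun h => h0 (eval_rootPoly_eq_zero.1 h)
  have hD0' : D' ≠ 0 := fun h => h0' (eval_rootPoly_eq_zero.1 h)
  have hρD : ρ * D' = σ * D := by simpa using eI2 0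
  have hc0 : σ * c' 0 = 1 := by
    have h1 := eE2 0
    simp only [zero_mul, zero_sub] at h1
    have h2 : D * (σ * c' 0 - 1) = 0 := by
      linear_combination (-1 : ℝ) * h1 - c' 0 * hρD
    linarith [(mul_eq_zero.1 h2).resolve_left hD0]
  -- The ratio `z ∑ c k / (k - z)` tends to `-σ` at `∞`. If the nearest mass is at `s`, then the ratio
  -- tends to `-T / (1 - T)` with `T = exp (a - s)`, as `eval_insert_mass` shows.
  set T := σ / (1 + σ) with hT
  have hTpos : 0 < T := by positivity
  have hT1 : T < 1 := by rw [hT, div_lt_one (by positivity)]; linarith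
  set s := a - Real.log T with hs
  have has : a < s := by linarith [Real.log_neg hTpos hT1]
  have hexp : Real.exp (a - s) = T := by
    rw [hs, sub_sub_cancel, Real.exp_log hTpos]
  obtain ⟨S, w, u, hS, hu, hSz⟩ := ih K'.card hcard K' (fun k => σ * (1 + σ) * c' k) s rfl h0'
    (fun k hk => by
      have := hc' k (by rw [hZ]; exact mem_insert_of_mem hk)
      positivity)
  refine ⟨insert s S, Function.update w s (σ * (1 + σ) * b'),
    Function.update u s (σ * (1 + σ) * A'), ?_, ?_, fun z => ?_⟩
  · intro t ht
    rcases mem_insert.1 ht with rfl | ht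
    · exact has
    · exact has.trans (hS t ht)
  · intro t
    rcases eq_or_ne t s with rfl | ht
    · rw [Function.update_self]; positivity
    · rw [Function.update_of_ne ht]; exact hu t
  obtain ⟨h1, h2⟩ := eval_insert_mass (S := S) (w := w) (u := u) (w₀ := σ * (1 + σ) * b')
    (u₀ := σ * (1 + σ) * A') has hS z
  obtain ⟨h3, h4⟩ := hSz z
  rw [hexp] at h1 h2
  rw [h1, h2]
  have hsc : (nevNum 0 0 (fun k => σ * (1 + σ) * c' k) K').eval z =
      σ * (1 + σ) * (nevNum 0 0 c' K').eval z := by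
    simp only [nevNum, C_0, zero_mul, zero_add, zero_sub, eval_neg, eval_finsetSum, eval_mul,
      eval_C, mul_neg, mul_sum]
    congr 1
    exact sum_congr rfl fun k _ => by ring
  rw [hsc] at h4
  have e1 := eI2 z
  have e2 := eE2 z
  have hTσ : T * (1 + σ) = σ := by rw [hT]; field_simp
  generalize Real.exp s * (grow S w u).eval z = B at *
  generalize Real.exp (s / 2) * (phi S w u s).eval z = P at *
  generalize (nevNum 0 0 c' K').eval z = m at *
  generalize (nevNum 0 0 c K).eval z = m₀ at *
  generalize (rootPoly K').eval z = d' at *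
  generalize (rootPoly K).eval z = d at *
  set Y := B + (σ * (1 + σ) * b' * z + σ * (1 + σ) * A' * z ^ 2) * P with hY
  have hY1 : D * (T * Y) = z * m₀ := by
    have hA : D' * Y = σ * (1 + σ) * (z * ((A' * z + b') * d' + m)) := by
      rw [hY]
      linear_combination h4 + (σ * (1 + σ) * b' * z + σ * (1 + σ) * A' * z ^ 2) * h3
    have hC : ρ * D' * Y = (1 + σ) * (z * m₀) := by
      linear_combination ρ * hA + σ * (1 + σ) * e2 + (1 + σ) * ρ * d' * hc0 + (1 + σ) * e1
    refine mul_left_cancel₀ hσpos.ne' ?_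
    linear_combination T * hC - T * Y * hρD + z * m₀ * hTσ
  constructor
  · refine mul_left_cancel₀ hσpos.ne' ?_
    linear_combination ρ * h3 - P * hρD + e1 + D * Y * hTσ - hY1
  · exact hY1

/-! ### Gluing two half-lines -/

/-- The Wronskian of the two Jost solutions, computed at a point `a` from the weights on either
side and at `a` itself. -/
lemma wronski_eq_at {S : Finset ℝ} {q f g : ℝ → ℝ} {a : ℝ} (ha : a ∈ S) (hf : IsJost S q f)
    (hg : IsJostLeft S q g) : wronski S q f = f a * g a
      - f a * (Real.exp (-a / 2) * ∑ s ∈ S.filter (· < a), Real.exp (s / 2) * (q s * g s))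
      - g a * (Real.exp (a / 2) * ∑ s ∈ S.filter (a < ·), Real.exp (-s / 2) * (q s * f s))
      - q a * f a * g a := by
  set L := S.filter (· < a) with hL
  set R := S.filter (a < ·) with hR
  have hsplit : ∀ h : ℝ → ℝ, ∑ s ∈ S, h s = ∑ s ∈ L, h s + h a + ∑ s ∈ R, h s := by
    intro h
    have h1 : ∀ s ∈ S, h s = (if s < a then h s else 0) + (if s = a then h s else 0) +
        (if a < s then h s else 0) := by
      intro s _
      rcases lt_trichotomy s a with h | h | h
      · simp [h, h.ne, h.not_gt]
      · simp [h]
      · simp [h, h.ne', h.not_gt]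
    rw [sum_congr rfl h1, sum_add_distrib, sum_add_distrib, hL, hR, sum_filter, sum_filter,
      sum_ite_eq' S a h, if_pos ha]
  set A₁ := 1 - ∑ s ∈ R, Real.exp (s / 2) * (q s * f s) with hA₁
  set B₁ := ∑ s ∈ R, Real.exp (-s / 2) * (q s * f s) with hB₁
  set X₁ := ∑ s ∈ L, Real.exp (-s / 2) * (q s * g s) with hX₁
  set X₂ := ∑ s ∈ L, Real.exp (s / 2) * (q s * g s) with hX₂
  set A₂ := A₁ - Real.exp (a / 2) * (q a * f a) with hA₂
  set B₂ := B₁ + Real.exp (-a / 2) * (q a * f a) with hB₂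
  have hfL : ∀ s ≤ a, f s = Real.exp (-s / 2) * A₂ + Real.exp (s / 2) * B₂ -
      ∑ t ∈ L, vol t s * (q t * f t) := by
    intro s hs
    have h1 := hf s
    rw [hsplit, vol_of_ge hs] at h1
    have h2 : ∑ t ∈ R, vol t s • (q t * f t) =
        Real.exp (-s / 2) * (1 - A₁) - Real.exp (s / 2) * B₁ := by
      rw [hA₁, hB₁, sub_sub_cancel, mul_sum, mul_sum, ← sum_sub_distrib]
      refine sum_congr rfl fun t ht => ?_
      rw [vol_of_ge (hs.trans (mem_filter.1 ht).2.le), smul_eq_mul]; ring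
    rw [h2] at h1
    rw [h1, hA₂, hB₂]
    simp only [smul_eq_mul, Algebra.algebraMap_self, RingHom.id_apply]
    ring
  have hgL : ∀ s ≤ a, g s = Real.exp (s / 2) - ∑ t ∈ L, vol s t * (q t * g t) := by
    intro s hs
    have h1 := hg s
    rw [hsplit, vol_of_le hs, sum_eq_zero (s := R) fun t ht => by
      rw [vol_of_le (hs.trans (mem_filter.1 ht).2.le), zero_smul]] at h1
    simpa only [smul_eq_mul, Algebra.algebraMap_self, RingHom.id_apply, zero_mul, add_zero] using h1
  have hfa : f a = Real.exp (-a / 2) * A₁ + Real.exp (a / 2) * B₁ := by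
    have h1 := hfL a le_rfl
    rw [sum_eq_zero fun t ht => by rw [vol_of_le (mem_filter.1 ht).2.le, zero_mul], sub_zero,
      hA₂, hB₂] at h1
    linear_combination h1
  have hga : g a = Real.exp (a / 2) * (1 - X₁) + Real.exp (-a / 2) * X₂ := by
    rw [hgL a le_rfl, hX₁, hX₂, mul_sub, mul_one, mul_sum, mul_sum, sub_add, ← sum_sub_distrib]
    congr 1
    refine sum_congr rfl fun t ht => ?_
    rw [vol_of_ge (mem_filter.1 ht).2.le]; ring
  -- Green's identity over the weights to the left of `a`
  have hgreen : ∑ s ∈ L, Real.exp (s / 2) * (q s * f s) = A₂ * X₁ + B₂ * X₂ := by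
    have e1 : ∑ s ∈ L, q s * g s * f s = A₂ * X₁ + B₂ * X₂ -
        ∑ s ∈ L, ∑ t ∈ L, vol t s * (q t * f t * (q s * g s)) := by
      rw [hX₁, hX₂, mul_sum, mul_sum, ← sum_add_distrib, ← sum_sub_distrib]
      refine sum_congr rfl fun s hs => ?_
      rw [hfL s (mem_filter.1 hs).2.le, mul_sub, mul_sum]
      congr 1
      · ring
      · exact sum_congr rfl fun t _ => by ring
    have e2 : ∑ s ∈ L, q s * g s * f s = ∑ s ∈ L, Real.exp (s / 2) * (q s * f s) -
        ∑ s ∈ L, ∑ t ∈ L, vol t s * (q t * f t * (q s * g s)) := by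
      rw [sum_comm, ← sum_sub_distrib]
      refine sum_congr rfl fun s hs => ?_
      rw [hgL s (mem_filter.1 hs).2.le, mul_sub, sub_mul, mul_sum, sum_mul]
      congr 1
      · ring
      · exact sum_congr rfl fun t _ => by ring
    linarith
  have hW : wronski S q f = A₂ - ∑ s ∈ L, Real.exp (s / 2) * (q s * f s) := by
    rw [wronski, hsplit, hA₂, hA₁]
    simp only [smul_eq_mul]; ring
  have i1 := exp_half_mul a
  rw [hW, hgreen]
  have e3 : A₂ = f a * Real.exp (a / 2) - Real.exp (a / 2) ^ 2 * B₂ := by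
    rw [hA₂, hB₂]
    nth_rw 2 [hfa]
    linear_combination (-A₁ + Real.exp (a / 2) * q a * f a) * i1
  have e4 : Real.exp (a / 2) * B₂ = Real.exp (a / 2) * B₁ + q a * f a := by
    rw [hB₂]
    linear_combination (q a * f a) * i1
  generalize Real.exp (a / 2) = x at *
  generalize Real.exp (-a / 2) = y at *
  linear_combination (1 - X₁) * e3 + (x * B₂ - f a) * hga - g a * e4 + B₂ * X₂ * i1

/-- Weights with prescribed half-line data on both sides of `a` and prescribed weight at `a`: the
zeros of `φ₊(·, a)` are the points of `K₁`, and those of the solution decaying at `-∞` are the points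
of `K₂`. The last property compares the normalising constants, through the derivative of the Wronskian
at an eigenvalue `l`. -/
lemma exists_weights_line {K₁ K₂ : Finset ℝ} {c₁ c₂ : ℝ → ℝ} (a w₀ u₀ : ℝ) (hu₀ : 0 ≤ u₀)
    (h01 : (0 : ℝ) ∉ K₁) (h02 : (0 : ℝ) ∉ K₂) (hc1 : ∀ k ∈ K₁, 0 < c₁ k)
    (hc2 : ∀ k ∈ K₂, 0 < c₂ k) : ∃ (S : Finset ℝ) (w u : ℝ → ℝ), a ∈ S ∧ (∀ s, 0 ≤ u s) ∧
      (∀ z, (rootPoly K₁).eval 0 * (Real.exp (a / 2) * (phi S w u a).eval z) =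
        (rootPoly K₁).eval z) ∧
      (∀ z, (rootPoly K₁).eval 0 * (rootPoly K₂).eval 0 * (wron S w u).eval z =
        (rootPoly K₁).eval z * (rootPoly K₂).eval z
          - z * (rootPoly K₁).eval z * (nevNum 0 0 c₂ K₂).eval z
          - z * (rootPoly K₂).eval z * (nevNum 0 0 c₁ K₁).eval z
          - (w₀ * z + u₀ * z ^ 2) * (rootPoly K₁).eval z * (rootPoly K₂).eval z) ∧
      ∀ l, (wron S w u).eval l = 0 → ∃ g : ℝ → ℝ, Continuous g ∧
        g l = ∑ s ∈ S, (w s + 2 * l * u s) * (phi S w u s).eval l ^ 2 ∧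
        ∀ z, (wron S w u).eval z * ((rootPoly K₁).eval l * (rootPoly K₂).eval 0) =
          (l - z) * (g z * (Real.exp a * (rootPoly K₂).eval l * (rootPoly K₁).eval 0)) := by
  classical
  obtain ⟨R, w₁, u₁, hR, hu1, h1⟩ := exists_weights_half_line _ K₁ c₁ a rfl h01 hc1
  obtain ⟨M, w₂, u₂, hM, hu2, h2⟩ := exists_weights_half_line _ K₂ c₂ (-a) rfl h02 hc2
  set L := M.image (fun s => -s) with hL
  have hLlt : ∀ s ∈ L, s < a := by
    intro s hs
    obtain ⟨t, ht, rfl⟩ := mem_image.1 hs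
    linarith [hM t ht]
  set S := insert a (L ∪ R) with hS
  set w : ℝ → ℝ := fun s => if a < s then w₁ s else if s = a then w₀ else w₂ (-s) with hw
  set u : ℝ → ℝ := fun s => if a < s then u₁ s else if s = a then u₀ else u₂ (-s) with hu
  have hSR : S.filter (a < ·) = R := by
    ext s
    simp only [hS, mem_filter, mem_insert, mem_union]
    constructor
    · rintro ⟨rfl | h | h, hs⟩
      · exact absurd hs (lt_irrefl _)
      · exact absurd hs (hLlt s h).not_gt
      · exact h
    · exact fun h => ⟨Or.inr (Or.inr h), hR s h⟩
  have hSL : S.filter (· < a) = L := by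
    ext s
    simp only [hS, mem_filter, mem_insert, mem_union]
    constructor
    · rintro ⟨rfl | h | h, hs⟩
      · exact absurd hs (lt_irrefl _)
      · exact h
      · exact absurd hs (hR s h).not_gt
    · exact fun h => ⟨Or.inr (Or.inl h), hLlt s h⟩
  have hRR : R.filter (a < ·) = R := filter_true_of_mem hR
  have hwR : ∀ s, a < s → w s = w₁ s := fun s hs => if_pos hs
  have huR : ∀ s, a < s → u s = u₁ s := fun s hs => if_pos hs
  have hwL : ∀ s, s < a → w s = w₂ (-s) := fun s hs => by
    simp only [hw]; rw [if_neg hs.not_gt, if_neg hs.ne]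
  have huL : ∀ s, s < a → u s = u₂ (-s) := fun s hs => by
    simp only [hu]; rw [if_neg hs.not_gt, if_neg hs.ne]
  have hwa : w a = w₀ := by simp [hw]
  have hua : u a = u₀ := by simp [hu]
  -- the solution from the left is the reflection of a solution from the right
  set S' := S.image (fun s => -s) with hS'
  set ψ : ℝ → ℝ[X] := fun x => phi S' (fun s => w (-s)) (fun s => u (-s)) (-x) with hψ
  have hψJ : IsJostLeft S (pw w u) ψ := by
    have h := (isJost_phi S' (fun s => w (-s)) (fun s => u (-s))).reflect
    have e1 : S'.image (fun s => -s) = S := by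
      rw [hS', image_image]; simp
    have e2 : (fun s => pw (fun s => w (-s)) (fun s => u (-s)) (-s)) = pw w u := by
      funext s; simp [pw]
    rw [e1, e2] at h
    exact h
  have hfilter : S'.filter (-a < ·) = M := by
    ext s
    rw [mem_filter, hS', mem_image]
    constructor
    · rintro ⟨⟨t, ht, rfl⟩, hs⟩
      have : t ∈ L := by rw [← hSL]; exact mem_filter.2 ⟨ht, by linarith⟩
      obtain ⟨r, hr, rfl⟩ := mem_image.1 this
      rwa [neg_neg]
    · intro hs
      have h3 : -s ∈ L := mem_image.2 ⟨s, hs, rfl⟩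
      rw [← hSL] at h3
      exact ⟨⟨-s, (mem_filter.1 h3).1, neg_neg s⟩, hM s hs⟩
  have hψphi : ∀ x ≤ a, ψ x = phi M w₂ u₂ (-x) := fun x hx =>
    phi_congr (a := -a) (by rw [hfilter]; exact (filter_true_of_mem hM).symm)
      (fun s hs => by rw [hwL _ (by linarith), neg_neg])
      (fun s hs => by rw [huL _ (by linarith), neg_neg]) (neg_le_neg hx)
  have hphi : ∀ x, a ≤ x → phi S w u x = phi R w₁ u₁ x := fun x hx =>
    phi_congr (by rw [hSR, hRR]) hwR huR hx
  have haS : a ∈ S := mem_insert_self _ _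
  have hψa : ∀ z, (rootPoly K₂).eval 0 * (Real.exp (-a / 2) * (ψ a).eval z) =
      (rootPoly K₂).eval z := fun z => by rw [hψphi a le_rfl]; exact (h2 z).1
  have hphia : ∀ z, (rootPoly K₁).eval 0 * (Real.exp (a / 2) * (phi S w u a).eval z) =
      (rootPoly K₁).eval z := fun z => by rw [hphi a le_rfl]; exact (h1 z).1
  have hψev : ∀ z, IsJostLeft S (fun s => (pw w u s).eval z) (fun s => (ψ s).eval z) := fun z =>
    hψJ.map (Polynomial.aeval z)
  have i1 := exp_half_mul a
  have ea : Real.exp a = Real.exp (a / 2) * Real.exp (a / 2) := by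
    rw [← Real.exp_add]; congr 1; ring
  have ea' : Real.exp (-a) = Real.exp (-a / 2) * Real.exp (-a / 2) := by
    rw [← Real.exp_add]; congr 1; ring
  refine ⟨S, w, u, haS, fun s => ?_, hphia, fun z => ?_, fun l hl => ?_⟩
  · simp only [hu]
    split_ifs
    · exact hu1 s
    · exact hu₀
    · exact hu2 _
  · have hWr := wronski_eq_at haS (eval_phi S w u z) (hψev z)
    rw [← eval_wron] at hWr
    have hgR : ∑ s ∈ S.filter (a < ·), Real.exp (-s / 2) *
        ((pw w u s).eval z * (phi S w u s).eval z) = (grow R w₁ u₁).eval z := by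
      rw [hSR, eval_grow]
      refine sum_congr rfl fun s hs => ?_
      rw [eval_pw, hwR s (hR s hs), huR s (hR s hs), hphi s (hR s hs).le]
    have hgL : ∑ s ∈ S.filter (· < a), Real.exp (s / 2) *
        ((pw w u s).eval z * (ψ s).eval z) = (grow M w₂ u₂).eval z := by
      rw [hSL, eval_grow, hL, sum_image fun _ _ _ _ h => neg_injective h]
      refine sum_congr rfl fun s hs => ?_
      have hs' : -s < a := by linarith [hM s hs]
      rw [eval_pw, hwL _ hs', huL _ hs', hψphi _ hs'.le, neg_neg]
    rw [hgR, hgL, eval_pw, hwa, hua] at hWr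
    rw [hWr]
    have g1 := (h1 z).2
    have g2 := (h2 z).2
    have f1 := hphia z
    have f2 := hψa z
    rw [ea] at g1
    rw [ea'] at g2
    generalize Real.exp (a / 2) = x at *
    generalize Real.exp (-a / 2) = y at *
    generalize (phi S w u a).eval z = f at *
    generalize (ψ a).eval z = g at *
    generalize (grow R w₁ u₁).eval z = b₁ at *
    generalize (grow M w₂ u₂).eval z = b₂ at *
    rw [← f1, ← f2]
    generalize (rootPoly K₁).eval 0 = D₁ at *
    generalize (rootPoly K₂).eval 0 = D₂ at *
    linear_combination (D₁ * D₂) * (f * y * b₂ + g * x * b₁ - f * g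
      * (1 - (w₀ * z + u₀ * z ^ 2))) * i1 - D₁ * (x * f) * g2 - D₂ * (y * g) * g1
  · have hcd := fun z => christoffel_darboux (T := S) (w := w) (u := u) (z := z) (l := l)
      (f := fun s => (phi S w u s).eval z) (g := fun s => (phi S w u s).eval l)
      (fun x _ => by
        have := eval_phi S w u z x
        simp only [eval_pw, smul_eq_mul] at this
        exact this)
      (fun x _ => by
        have := eval_phi S w u l x
        simp only [eval_pw, smul_eq_mul] at this
        exact this)
    simp only [← eval_pw, ← eval_wron, hl, zero_mul, sub_zero] at hcd
    refine ⟨fun z => ∑ s ∈ S, (w s + (l + z) * u s) *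
      ((phi S w u s).eval z * (phi S w u s).eval l), ?_, ?_, fun z => ?_⟩
    · refine continuous_finsetSum _ fun s _ => ?_
      have := (phi S w u s).continuous
      fun_prop
    · exact sum_congr rfl fun s _ => by ring
    · -- at an eigenvalue the two Jost solutions are proportional
      have hprop : (phi S w u a).eval l = (ψ a).eval l * growth S (fun s => (pw w u s).eval l)
          (fun s => (phi S w u s).eval l) := by
        refine (hψev l).unique (g := fun x => (phi S w u x).eval l) (fun x => ?_) a
        have := (eval_phi S w u l).eq_ker x
        rw [← eval_wron, hl, smul_zero, zero_add] at this
        rw [this, growth, Algebra.algebraMap_self, RingHom.id_apply, mul_sum, ← sum_sub_distrib]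
        refine sum_congr rfl fun s _ => ?_
        rw [vol_add_ker, ker_comm]
        simp only [smul_eq_mul]; ring
      have h3 := hcd z
      have f1 := hphia l
      have f2 := hψa l
      rw [ea, ← f1, ← f2, hprop]
      generalize growth S (fun s => (pw w u s).eval l) (fun s => (phi S w u s).eval l) = B at *
      generalize Real.exp (a / 2) = x at *
      generalize Real.exp (-a / 2) = y at *
      generalize (rootPoly K₁).eval 0 = D₁ at *
      generalize (rootPoly K₂).eval 0 = D₂ at *
      linear_combination D₁ * x * (ψ a).eval l * D₂ * h3
        - (l - z) * (∑ s ∈ S, (w s + (l + z) * u s) *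
          ((phi S w u s).eval z * (phi S w u s).eval l)) * x * D₂ * (ψ a).eval l * D₁ * i1

/-! ### Signs across the gaps of the eigenvalues -/

/-- `k₁ < k₂` are neighbouring points of `K`. -/
structure IsGap (K : Finset ℝ) (k₁ k₂ : ℝ) : Prop where
  left_mem : k₁ ∈ K
  right_mem : k₂ ∈ K
  lt : k₁ < k₂
  le_or_le : ∀ k ∈ K, k ≤ k₁ ∨ k₂ ≤ k

lemma IsGap.eq_and_eq {K : Finset ℝ} {k₁ k₂ l₁ l₂ x : ℝ} (h : IsGap K k₁ k₂) (h' : IsGap K l₁ l₂)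
    (hk₁ : k₁ < x) (hk₂ : x < k₂) (hl₁ : l₁ < x) (hl₂ : x < l₂) : k₁ = l₁ ∧ k₂ = l₂ := by
  have h1 := (h.le_or_le l₁ h'.left_mem).resolve_right (by linarith)
  have h2 := (h'.le_or_le k₁ h.left_mem).resolve_right (by linarith)
  have h3 := (h.le_or_le l₂ h'.right_mem).resolve_left (by linarith)
  have h4 := (h'.le_or_le k₂ h.right_mem).resolve_left (by linarith)
  exact ⟨le_antisymm h2 h1, le_antisymm h3 h4⟩

lemma rootPoly_mul_pos {K : Finset ℝ} {x y : ℝ} (hxy : x ≤ y) (h : ∀ k ∈ K, k < x ∨ y < k) :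
    0 < (rootPoly K).eval x * (rootPoly K).eval y :=
  mul_pos_of_continuous_of_ne_zero (rootPoly K).continuous hxy fun t ht h0 => by
    rcases h t (eval_rootPoly_eq_zero.1 h0) with h1 | h1
    · exact absurd ht.1 h1.not_ge
    · exact absurd ht.2 h1.not_ge

/-- A polynomial with exactly one, simple, root in an interval changes sign there. -/
lemma rootPoly_mul_neg {K : Finset ℝ} {x y ζ : ℝ} (hζ : ζ ∈ K) (hx : x < ζ) (hy : ζ < y)
    (h : ∀ k ∈ K, k ≠ ζ → k < x ∨ y < k) : (rootPoly K).eval x * (rootPoly K).eval y < 0 := by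
  have h1 := rootPoly_mul_pos (K := K.erase ζ) (hx.trans hy).le
    fun k hk => h k (mem_of_mem_erase hk) (ne_of_mem_erase hk)
  have h2 : ∀ z, (rootPoly K).eval z = (z - ζ) * (rootPoly (K.erase ζ)).eval z := fun z => by
    rw [← rootPoly_erase hζ]; simp
  have h3 : (x - ζ) * (y - ζ) < 0 := mul_neg_of_neg_of_pos (by linarith) (by linarith)
  rw [h2 x, h2 y]
  have := mul_neg_of_neg_of_pos h3 h1
  linarith

/-- A rational Nevanlinna function has a zero between two neighbouring poles. -/
lemma exists_zero_of_isGap {A b ρ : ℝ} {r : ℝ → ℝ} {K Z : Finset ℝ} (hr : ∀ k ∈ K, 0 < r k)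
    (hZ : nevNum A b r K = C ρ * rootPoly Z) {k₁ k₂ : ℝ} (h : IsGap K k₁ k₂) :
    ∃ ζ ∈ Z, k₁ < ζ ∧ ζ < k₂ := by
  by_contra! hno
  have hKZ : ∀ k ∈ K, k ∉ Z := fun k hk hkZ => by
    refine eval_nevNum_ne_zero (A := A) (b := b) hr hk ?_
    rw [hZ, eval_mul, eval_rootPoly_eq_zero.2 hkZ, mul_zero]
  have h1 : 0 < (rootPoly Z).eval k₁ * (rootPoly Z).eval k₂ := by
    refine rootPoly_mul_pos h.lt.le fun ζ hζ => ?_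
    rcases lt_trichotomy ζ k₁ with h2 | rfl | h2
    · exact Or.inl h2
    · exact absurd hζ (hKZ _ h.left_mem)
    · refine Or.inr (lt_of_le_of_ne (hno ζ hζ h2) ?_)
      rintro rfl
      exact hKZ _ h.right_mem hζ
  set E := rootPoly ((K.erase k₁).erase k₂) with hE
  have h2 : 0 < E.eval k₁ * E.eval k₂ := by
    refine rootPoly_mul_pos h.lt.le fun k hk => ?_
    have hk2 := ne_of_mem_erase hk
    have hk1 := ne_of_mem_erase (mem_of_mem_erase hk)
    rcases h.le_or_le k (mem_of_mem_erase (mem_of_mem_erase hk)) with h3 | h3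
    · exact Or.inl (lt_of_le_of_ne h3 hk1)
    · exact Or.inr (lt_of_le_of_ne h3 hk2.symm)
  have e1 : (rootPoly (K.erase k₁)).eval k₁ = (k₁ - k₂) * E.eval k₁ := by
    rw [← rootPoly_erase (mem_erase.2 ⟨h.lt.ne', h.right_mem⟩)]; simp [hE]
  have e2 : (rootPoly (K.erase k₂)).eval k₂ = (k₂ - k₁) * E.eval k₂ := by
    rw [← rootPoly_erase (mem_erase.2 ⟨h.lt.ne, h.left_mem⟩), erase_right_comm]; simp [hE]
  have f1 := eval_nevNum_self (A := A) (b := b) (r := r) h.left_mem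
  have f2 := eval_nevNum_self (A := A) (b := b) (r := r) h.right_mem
  rw [hZ, e1, eval_mul, eval_C] at f1
  rw [hZ, e2, eval_mul, eval_C] at f2
  have h3 : ρ ^ 2 * ((rootPoly Z).eval k₁ * (rootPoly Z).eval k₂) =
      -(k₂ - k₁) ^ 2 * (r k₁ * r k₂ * (E.eval k₁ * E.eval k₂)) := by
    linear_combination ρ * (rootPoly Z).eval k₂ * f1 - r k₁ * ((k₁ - k₂) * E.eval k₁) * f2
  have h4 : 0 < (k₂ - k₁) ^ 2 := by have := h.lt; exact pow_pos (by linarith) 2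
  have h5 := mul_pos h4 (mul_pos (mul_pos (hr _ h.left_mem) (hr _ h.right_mem)) h2)
  have h6 := mul_nonneg (sq_nonneg ρ) h1.le
  linarith

/-- Among the gaps of `K`, the roots of `rootPoly Q` lie in precisely those across which `β` changes
sign, one in each, and `β` is positive next to `0`. So `β` has the signs of `rootPoly Q`, the latter
normalised to be positive at `0`. -/
lemma mul_rootPoly_pos {K Q : Finset ℝ} {β : ℝ → ℝ} (hK : K.Nonempty) (h0K : (0 : ℝ) ∉ K)
    (hβ : ∀ k ∈ K, β k ≠ 0) (h0Q : (0 : ℝ) ∉ Q) (hKQ : ∀ k ∈ K, k ∉ Q)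
    (huniq : ∀ x ∈ insert 0 Q, ∀ y ∈ insert 0 Q, x < y → ∃ k ∈ K, x < k ∧ k < y)
    (hodd : ∀ k₁ k₂, IsGap K k₁ k₂ → ∀ κ ∈ Q, k₁ < κ → κ < k₂ → β k₁ * β k₂ < 0)
    (hex : ∀ k₁ k₂, IsGap K k₁ k₂ → β k₁ * β k₂ < 0 → ∃ κ ∈ Q, k₁ < κ ∧ κ < k₂)
    (hpos : ∀ k ∈ K, (∀ l ∈ K, ¬ (0 < l ∧ l < k) ∧ ¬ (k < l ∧ l < 0)) → 0 < β k) :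
    ∀ k ∈ K, 0 < β k * ((rootPoly Q).eval k * (rootPoly Q).eval 0) := by
  set D := fun k => (rootPoly Q).eval k with hD
  have hgap : ∀ k₁ k₂, IsGap K k₁ k₂ → 0 < (β k₁ * D k₁) * (β k₂ * D k₂) := by
    intro k₁ k₂ h
    have e : (β k₁ * D k₁) * (β k₂ * D k₂) = (β k₁ * β k₂) * (D k₁ * D k₂) := by ring
    have hlr : ∀ κ ∈ Q, (κ < k₁ ∨ k₂ < κ) ∨ (k₁ < κ ∧ κ < k₂) := by
      intro κ hκ
      have h1 : κ ≠ k₁ := fun h' => hKQ _ h.left_mem (h' ▸ hκ)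
      have h2 : κ ≠ k₂ := fun h' => hKQ _ h.right_mem (h' ▸ hκ)
      rcases lt_or_gt_of_ne h1 with h3 | h3
      · exact Or.inl (Or.inl h3)
      · rcases lt_or_gt_of_ne h2 with h4 | h4
        · exact Or.inr ⟨h3, h4⟩
        · exact Or.inl (Or.inr h4)
    have hb : β k₁ * β k₂ ≠ 0 := mul_ne_zero (hβ _ h.left_mem) (hβ _ h.right_mem)
    rw [e]
    rcases lt_or_gt_of_ne hb with h1 | h1
    · obtain ⟨ζ, hζ, h2, h3⟩ := hex k₁ k₂ h h1
      refine mul_pos_of_neg_of_neg h1 (rootPoly_mul_neg hζ h2 h3 fun κ hκ hne => ?_)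
      rcases hlr κ hκ with h4 | ⟨h4, h5⟩
      · exact h4
      · exfalso
        rcases lt_or_gt_of_ne hne with h6 | h6
        · obtain ⟨k, hk, h7, h8⟩ := huniq κ (mem_insert_of_mem hκ) ζ (mem_insert_of_mem hζ) h6
          rcases h.le_or_le k hk with h9 | h9 <;> linarith
        · obtain ⟨k, hk, h7, h8⟩ := huniq ζ (mem_insert_of_mem hζ) κ (mem_insert_of_mem hκ) h6
          rcases h.le_or_le k hk with h9 | h9 <;> linarith
    · refine mul_pos h1 (rootPoly_mul_pos h.lt.le fun κ hκ => ?_)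
      rcases hlr κ hκ with h4 | ⟨h4, h5⟩
      · exact h4
      · exact absurd (hodd k₁ k₂ h κ hκ h4 h5) h1.not_gt
  -- the gaps between two arbitrary points of `K` are passed one by one
  have hpair : ∀ n k₁ k₂, k₁ ∈ K → k₂ ∈ K → k₁ < k₂ →
      (K.filter fun k => k₁ < k ∧ k < k₂).card = n → 0 < (β k₁ * D k₁) * (β k₂ * D k₂) := by
    intro n
    induction n using Nat.strong_induction_on with
    | _ n ih =>
    intro k₁ k₂ h1 h2 h12 hn
    by_cases hm : ∃ m ∈ K, k₁ < m ∧ m < k₂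
    · obtain ⟨m, hm, hm1, hm2⟩ := hm
      have c1 : (K.filter fun k => k₁ < k ∧ k < m).card < n := by
        rw [← hn]
        refine card_lt_card (ssubset_iff.2 ⟨m, by simp, insert_subset ?_ fun k hk => ?_⟩)
        · exact mem_filter.2 ⟨hm, hm1, hm2⟩
        · obtain ⟨h3, h4, h5⟩ := mem_filter.1 hk
          exact mem_filter.2 ⟨h3, h4, h5.trans hm2⟩
      have c2 : (K.filter fun k => m < k ∧ k < k₂).card < n := by
        rw [← hn]
        refine card_lt_card (ssubset_iff.2 ⟨m, by simp, insert_subset ?_ fun k hk => ?_⟩)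
        · exact mem_filter.2 ⟨hm, hm1, hm2⟩
        · obtain ⟨h3, h4, h5⟩ := mem_filter.1 hk
          exact mem_filter.2 ⟨h3, hm1.trans h4, h5⟩
      have p1 := ih _ c1 k₁ m h1 hm hm1 rfl
      have p2 := ih _ c2 m k₂ hm h2 hm2 rfl
      have p3 := mul_pos p1 p2
      have e : (β k₁ * D k₁) * (β m * D m) * ((β m * D m) * (β k₂ * D k₂)) =
          (β m * D m) ^ 2 * ((β k₁ * D k₁) * (β k₂ * D k₂)) := by ring
      rw [e] at p3
      exact pos_of_mul_pos_right p3 (sq_nonneg _)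
    · push Not at hm
      exact hgap k₁ k₂ ⟨h1, h2, h12, fun k hk => (le_or_gt k k₁).imp id (hm k hk)⟩
  obtain ⟨k₀, hk₀, hmin⟩ := exists_min_image K (fun k => |k|) hK
  have hno : ∀ l ∈ K, ¬ (0 < l ∧ l < k₀) ∧ ¬ (k₀ < l ∧ l < 0) := fun l hl => by
    have h1 := hmin l hl
    refine ⟨fun ⟨h2, h3⟩ => ?_, fun ⟨h2, h3⟩ => ?_⟩
    · rw [abs_of_pos h2, abs_of_pos (h2.trans h3)] at h1; linarith
    · rw [abs_of_neg h3, abs_of_neg (h2.trans h3)] at h1; linarith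
  -- there is no root between `0` and the pole closest to it
  have hanchor : 0 < D k₀ * D 0 := by
    have hk0 : k₀ ≠ 0 := fun h => h0K (h ▸ hk₀)
    rcases lt_or_gt_of_ne hk0 with hlt | hlt
    · refine rootPoly_mul_pos hlt.le fun κ hκ => ?_
      by_contra! h
      have h1 : κ < 0 := lt_of_le_of_ne h.2 fun h' => h0Q (h' ▸ hκ)
      obtain ⟨k, hk, h2, h3⟩ := huniq κ (mem_insert_of_mem hκ) 0 (mem_insert_self _ _) h1
      exact (hno k hk).2 ⟨h.1.trans_lt h2, h3⟩
    · rw [mul_comm]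
      refine rootPoly_mul_pos hlt.le fun κ hκ => ?_
      by_contra! h
      have h1 : 0 < κ := lt_of_le_of_ne h.1 fun h' => h0Q (h' ▸ hκ)
      obtain ⟨k, hk, h2, h3⟩ := huniq 0 (mem_insert_self _ _) κ (mem_insert_of_mem hκ) h1
      exact (hno k hk).1 ⟨h2, h3.trans_le h.2⟩
  have hk₀pos := mul_pos (hpos k₀ hk₀ hno) hanchor
  intro k hk
  have hkk : 0 < (β k * D k) * (β k₀ * D k₀) := by
    rcases lt_trichotomy k k₀ with h | rfl | h
    · exact hpair _ k k₀ hk hk₀ h rfl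
    · have : β k * D k ≠ 0 := mul_ne_zero (hβ k hk) fun h => hKQ k hk (eval_rootPoly_eq_zero.1 h)
      exact mul_self_pos.2 this
    · rw [mul_comm]; exact hpair _ k₀ k hk₀ hk h rfl
  have h1 : 0 < (β k * D k) * (β k₀ * D k₀) * (β k₀ * (D k₀ * D 0)) := mul_pos hkk hk₀pos
  have e : (β k * D k) * (β k₀ * D k₀) * (β k₀ * (D k₀ * D 0)) =
      (β k₀ * D k₀) ^ 2 * (β k * (D k * D 0)) := by ring
  rw [e] at h1
  exact pos_of_mul_pos_right h1 (sq_nonneg _)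

/-! ### The inverse problem on the line -/

/-- The polynomial numerator of `G` for data indexed by the set `K` of eigenvalues with `β ≠ 0`. -/
noncomputable def numG (β : ℝ → ℝ) (K : Finset ℝ) : ℝ[X] :=
  nevNum (1 - ∑ k ∈ K, β k ^ 2) (-∑ k ∈ K, β k ^ 2 * k) (fun k => β k ^ 2 * k * k) K

/-- The zeros of `G` are `0` and a set `Q`. The last identity says that
`-1 / G = A z + b - 1 / z + ∑ c κ / (κ - z)`, where the residue at `0` is determined by the special
form of the coefficients of `G`. -/
lemma exists_numG_eq {K : Finset ℝ} {β : ℝ → ℝ} (hK : K.Nonempty) (h0 : (0 : ℝ) ∉ K)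
    (hβ : ∀ k ∈ K, β k ≠ 0) (hs : ∑ k ∈ K, β k ^ 2 ≤ 1) :
    ∃ (ρ : ℝ) (Q : Finset ℝ) (A b : ℝ) (c : ℝ → ℝ), ρ ≠ 0 ∧ 0 ≤ A ∧ (∀ κ ∈ Q, 0 < c κ) ∧
      (0 : ℝ) ∉ Q ∧ numG β K = C ρ * rootPoly (insert 0 Q) ∧
      rootPoly K = C ρ * (rootPoly Q - X * ((C A * X + C b) * rootPoly Q + nevNum 0 0 c Q)) := by
  classical
  obtain ⟨ρ, Z, A, b, c, hρ, hA, hc, hE1, hE2⟩ := exists_nevNum_inversion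
    (A := 1 - ∑ k ∈ K, β k ^ 2) (b := -∑ k ∈ K, β k ^ 2 * k) (r := fun k => β k ^ 2 * k * k)
    (K := K) (by linarith)
    (fun k hk => by
      have h1 : k ≠ 0 := fun h => h0 (h ▸ hk)
      have h2 := hβ k hk
      rw [mul_assoc]
      exact mul_pos (by positivity) (mul_self_pos.2 h1)) (Or.inl hK)
  have hI : numG β K = X * (C (1 - ∑ k ∈ K, β k ^ 2) * rootPoly K +
      nevNum 0 0 (fun k => β k ^ 2 * k) K) := by
    have h1 := nevNum_mul_self (fun k => β k ^ 2 * k) K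
    have h2 : numG β K = (C (1 - ∑ k ∈ K, β k ^ 2) * X + C (-∑ k ∈ K, β k ^ 2 * k)) * rootPoly K +
        nevNum 0 0 (fun k => β k ^ 2 * k * k) K := by
      simp only [numG, nevNum, C_0]; ring
    rw [h2, h1, C_neg]; ring
  have hZ0 : (0 : ℝ) ∈ Z := by
    have := congrArg (eval 0) (hI.symm.trans hE1)
    simp only [eval_mul, eval_X, zero_mul, eval_C] at this
    exact eval_rootPoly_eq_zero.1 ((mul_eq_zero.1 this.symm).resolve_left hρ)
  have hQ0 : (0 : ℝ) ∉ Z.erase 0 := notMem_erase 0 Z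
  obtain ⟨Q, hQ⟩ : ∃ Q, Q = Z.erase 0 := ⟨_, rfl⟩
  have hZ : Z = insert 0 Q := by rw [hQ, insert_erase hZ0]
  rw [← hQ] at hQ0
  rw [hZ, nevNum_insert_zero A b c hQ0] at hE2
  have hE1' : numG β K = C ρ * rootPoly (insert 0 Q) := by rw [← hZ]; exact hE1
  have h1 : C (1 - ∑ k ∈ K, β k ^ 2) * rootPoly K + nevNum 0 0 (fun k => β k ^ 2 * k) K =
      C ρ * rootPoly Q := by
    refine mul_left_cancel₀ (X_ne_zero (R := ℝ)) ?_
    rw [← hI, hE1', rootPoly_insert hQ0, C_0, sub_zero]; ring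
  have hD : (rootPoly K).eval 0 ≠ 0 := fun h => h0 (eval_rootPoly_eq_zero.1 h)
  have hc0 : c 0 = 1 := by
    have e1 := congrArg (eval 0) hE2
    rw [nevNum_mul_self (fun k => β k ^ 2)] at h1
    have e2 := congrArg (eval 0) h1
    simp at e1 e2
    refine mul_left_cancel₀ hD ?_
    linear_combination (-1 : ℝ) * e1 + c 0 * e2
  refine ⟨ρ, Q, A, b, c, hρ, hA, fun κ hκ => hc κ (hZ ▸ mem_insert_of_mem hκ), hQ0, hE1', ?_⟩
  rw [hE2, hc0, C_1]; ring

/-- Division of the nonzero zeros of `G` among the two sides of `a`: `K₁` consists of the points with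
`p`, and `K₂` of the others and of the points of `J`, which belong to both sides, with half of the
residue on each. -/
lemma exists_split {Q J : Finset ℝ} (hJ : J ⊆ Q) (p : ℝ → Prop) (hp : ∀ κ ∈ J, p κ) (c : ℝ → ℝ)
    (hc : ∀ κ ∈ Q, 0 < c κ) : ∃ (K₁ K₂ : Finset ℝ) (d : ℝ → ℝ), K₁ ⊆ Q ∧ K₂ ⊆ Q ∧
      (∀ κ ∈ Q, κ ∈ K₁ ↔ p κ) ∧ (∀ κ ∈ Q, 0 < d κ) ∧
      (∀ z, (rootPoly K₁).eval z * (rootPoly K₂).eval z =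
        (rootPoly Q).eval z * (rootPoly J).eval z) ∧
      ∀ z ∉ Q, (rootPoly K₁).eval z * (nevNum 0 0 d K₂).eval z +
        (rootPoly K₂).eval z * (nevNum 0 0 d K₁).eval z =
        (rootPoly J).eval z * (nevNum 0 0 c Q).eval z := by
  classical
  have hprod : ∀ z, (rootPoly (Q.filter p)).eval z *
      (rootPoly (Q.filter fun κ => κ ∈ J ∨ ¬ p κ)).eval z =
      (rootPoly Q).eval z * (rootPoly J).eval z := by
    intro z
    have e : J = Q.filter (· ∈ J) := by
      ext κ; rw [mem_filter]; exact ⟨fun h => ⟨hJ h, h⟩, fun h => h.2⟩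
    have e' : (rootPoly J).eval z = ∏ κ ∈ Q, if κ ∈ J then (z - κ) else 1 := by
      conv_lhs => rw [e]
      rw [eval_rootPoly, prod_filter]
    rw [e', eval_rootPoly, eval_rootPoly, eval_rootPoly, prod_filter, prod_filter,
      ← prod_mul_distrib, ← prod_mul_distrib]
    refine prod_congr rfl fun κ _ => ?_
    by_cases h1 : κ ∈ J
    · simp [h1, hp κ h1]
    · by_cases h2 : p κ <;> simp [h1, h2]
  refine ⟨Q.filter p, Q.filter fun κ => κ ∈ J ∨ ¬ p κ, fun κ => if κ ∈ J then c κ / 2 else c κ,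
    filter_subset _ _, filter_subset _ _, fun κ hκ => ?_, fun κ hκ => ?_, hprod, fun z hz => ?_⟩
  · rw [mem_filter]; exact ⟨fun h => h.2, fun h => ⟨hκ, h⟩⟩
  · have := hc κ hκ
    dsimp only
    split_ifs <;> linarith
  · rw [eval_nevNum fun h => hz (filter_subset _ _ h), eval_nevNum fun h => hz (filter_subset _ _ h),
      eval_nevNum hz]
    have hsum : ∑ κ ∈ Q.filter p, (if κ ∈ J then c κ / 2 else c κ) / (κ - z) +
        ∑ κ ∈ Q.filter (fun κ => κ ∈ J ∨ ¬ p κ), (if κ ∈ J then c κ / 2 else c κ) / (κ - z) =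
        ∑ κ ∈ Q, c κ / (κ - z) := by
      rw [sum_filter, sum_filter, ← sum_add_distrib]
      refine sum_congr rfl fun κ _ => ?_
      by_cases h1 : κ ∈ J
      · simp only [h1, hp κ h1, if_true, true_or]; ring
      · by_cases h2 : p κ <;> simp [h1, h2]
    rw [← hsum]
    linear_combination (∑ κ ∈ Q.filter p, (if κ ∈ J then c κ / 2 else c κ) / (κ - z) +
      ∑ κ ∈ Q.filter (fun κ => κ ∈ J ∨ ¬ p κ), (if κ ∈ J then c κ / 2 else c κ) / (κ - z)) * hprod z

/-- The inverse problem, for data indexed by finite sets of real numbers: `K` are the eigenvalues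
with nonzero value `β` at `a`, and `J` those whose eigenfunction vanishes at `a`. -/
theorem exists_weights_of_values {K J : Finset ℝ} {β : ℝ → ℝ} (a : ℝ) (hK : K.Nonempty)
    (h0K : (0 : ℝ) ∉ K) (h0J : (0 : ℝ) ∉ J) (hβ : ∀ k ∈ K, β k ≠ 0)
    (hs : ∑ k ∈ K, β k ^ 2 ≤ 1) (hJ : ∀ j ∈ J, (numG β K).eval j = 0)
    (huniq : ∀ x y, x < y → (numG β K).eval x = 0 → (numG β K).eval y = 0 →
      ∃ k ∈ K, x < k ∧ k < y)
    (hodd : ∀ k₁ k₂, IsGap K k₁ k₂ → ∀ j ∈ J, k₁ < j → j < k₂ → β k₁ * β k₂ < 0)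
    (hpos : ∀ k ∈ K, (∀ l ∈ K, ¬ (0 < l ∧ l < k) ∧ ¬ (k < l ∧ l < 0)) → 0 < β k) :
    ∃ (S : Finset ℝ) (w u : ℝ → ℝ), (∀ s, 0 ≤ u s) ∧
      (∃ m : ℝ, m ≠ 0 ∧ C m * wron S w u = rootPoly J * rootPoly K) ∧
      (∀ j ∈ J, (phi S w u a).eval j = 0) ∧
      ∀ k ∈ K, β k = (phi S w u a).eval k /
        Real.sqrt (k * ∑ s ∈ S, (w s + 2 * k * u s) * (phi S w u s).eval k ^ 2) := by
  classical
  obtain ⟨ρ, Q, A, b, c, hρ, hA, hc, h0Q, hnum, hrK⟩ := exists_numG_eq hK h0K hβ hs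
  have hr : ∀ k ∈ K, 0 < β k ^ 2 * k * k := fun k hk => by
    have h1 : k ≠ 0 := fun h => h0K (h ▸ hk)
    have h2 := hβ k hk
    rw [mul_assoc]
    exact mul_pos (by positivity) (mul_self_pos.2 h1)
  have hzero : ∀ x, (numG β K).eval x = 0 ↔ x ∈ insert 0 Q := fun x => by
    rw [hnum, eval_mul, eval_C, mul_eq_zero, eval_rootPoly_eq_zero]
    exact ⟨fun h => h.resolve_left hρ, Or.inr⟩
  have hJQ : J ⊆ Q := fun j hj => by
    have h1 := (hzero j).1 (hJ j hj)
    exact (mem_insert.1 h1).resolve_left fun h => h0J (h ▸ hj)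
  have hKQ : ∀ k ∈ K, k ∉ Q := fun k hk hkQ =>
    eval_nevNum_ne_zero hr hk ((hzero k).2 (mem_insert_of_mem hkQ))
  obtain ⟨K₁, K₂, d, hK₁, hK₂, hmem, hd, hprod, hsum⟩ := exists_split hJQ
    (fun κ => κ ∈ J ∨ ∃ k₁ k₂, IsGap K k₁ k₂ ∧ k₁ < κ ∧ κ < k₂ ∧ β k₁ * β k₂ < 0)
    (fun κ hκ => Or.inl hκ) c hc
  have h01 : (0 : ℝ) ∉ K₁ := fun h => h0Q (hK₁ h)
  have h02 : (0 : ℝ) ∉ K₂ := fun h => h0Q (hK₂ h)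
  have hsign := mul_rootPoly_pos (K := K) (Q := K₁) (β := β) hK h0K hβ h01
    (fun k hk h => hKQ k hk (hK₁ h))
    (fun x hx y hy hxy => huniq x y hxy ((hzero x).2 (insert_subset_insert 0 hK₁ hx))
      ((hzero y).2 (insert_subset_insert 0 hK₁ hy)))
    (fun k₁ k₂ h κ hκ hl hr' => by
      rcases (hmem κ (hK₁ hκ)).1 hκ with h1 | ⟨l₁, l₂, h1, h2, h3, h4⟩
      · exact hodd k₁ k₂ h κ h1 hl hr'
      · obtain ⟨rfl, rfl⟩ := h.eq_and_eq h1 hl hr' h2 h3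
        exact h4)
    (fun k₁ k₂ h hneg => by
      obtain ⟨ζ, hζ, h1, h2⟩ := exists_zero_of_isGap hr hnum h
      -- next to `0` both values are positive, so the zero in this gap is not `0`
      have hζ0 : ζ ≠ 0 := by
        rintro rfl
        have p1 := hpos k₁ h.left_mem fun l hl => ⟨fun h3 => by linarith [h3.1, h3.2],
          fun h3 => by rcases h.le_or_le l hl with h4 | h4 <;> linarith [h3.1, h3.2]⟩
        have p2 := hpos k₂ h.right_mem fun l hl => ⟨fun h3 => by
          rcases h.le_or_le l hl with h4 | h4 <;> linarith [h3.1, h3.2],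
          fun h3 => by linarith [h3.1, h3.2]⟩
        exact absurd hneg (mul_pos p1 p2).not_gt
      have hζQ : ζ ∈ Q := (mem_insert.1 hζ).resolve_left hζ0
      exact ⟨ζ, (hmem ζ hζQ).2 (Or.inr ⟨k₁, k₂, h, h1, h2, hneg⟩), h1, h2⟩)
    hpos
  obtain ⟨S, w, u, haS, hu, hphi, hW, hnorm⟩ := exists_weights_line (c₁ := d) (c₂ := d) a b A hA
    h01 h02 (fun k hk => hd k (hK₁ hk)) (fun k hk => hd k (hK₂ hk))
  have hD1 : (rootPoly K₁).eval 0 ≠ 0 := fun h => h01 (eval_rootPoly_eq_zero.1 h)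
  have hD2 : (rootPoly K₂).eval 0 ≠ 0 := fun h => h02 (eval_rootPoly_eq_zero.1 h)
  set D₁ := (rootPoly K₁).eval 0 with hD₁
  set D₂ := (rootPoly K₂).eval 0 with hD₂
  have hwron : C (ρ * D₁ * D₂) * wron S w u = rootPoly J * rootPoly K := by
    refine eq_of_infinite_eval_eq _ _ (Q.finite_toSet.infinite_compl.mono fun z hz => ?_)
    have hzQ : z ∉ Q := fun h => hz h
    have e1 := hsum z hzQ
    have e2 := hprod z
    have e3 := congrArg (eval z) hrK
    have e4 := hW z
    simp only [eval_mul, eval_C, eval_sub, eval_X, eval_add] at e3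
    simp only [Set.mem_ofPred_eq, eval_mul, eval_C]
    rw [e3]
    linear_combination ρ * e4 - ρ * z * e1 + ρ * (1 - z * (A * z + b)) * e2
  have hm : ρ * D₁ * D₂ ≠ 0 := mul_ne_zero (mul_ne_zero hρ hD1) hD2
  have hwev : ∀ z, ρ * D₁ * D₂ * (wron S w u).eval z =
      (rootPoly J).eval z * (rootPoly K).eval z := fun z => by
    have := congrArg (eval z) hwron
    simpa only [eval_mul, eval_C] using this
  refine ⟨S, w, u, hu, ⟨_, hm, hwron⟩, fun j hj => ?_, fun k hk => ?_⟩
  · have h1 := hphi j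
    rw [eval_rootPoly_eq_zero.2 ((hmem j (hJQ hj)).2 (Or.inl hj))] at h1
    have h2 := (mul_eq_zero.1 h1).resolve_left hD1
    exact (mul_eq_zero.1 h2).resolve_left (Real.exp_pos _).ne'
  · have hwk : (wron S w u).eval k = 0 := by
      have := hwev k
      rw [eval_rootPoly_eq_zero.2 hk, mul_zero] at this
      exact (mul_eq_zero.1 this).resolve_left hm
    have hγ := gamma_pos haS hu hwk
    obtain ⟨g, hgc, hgk, hg⟩ := hnorm k hwk
    set γ := ∑ s ∈ S, (w s + 2 * k * u s) * (phi S w u s).eval k ^ 2 with hγdef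
    set E := rootPoly (K.erase k) with hE
    have hEK : ∀ z, (rootPoly K).eval z = (z - k) * E.eval z := fun z => by
      rw [← rootPoly_erase hk]; simp [hE]
    -- the derivative of the Wronskian at `k`, as the value of its difference quotient
    have hlim : (fun z => (rootPoly J).eval z * E.eval z * ((rootPoly K₁).eval k * D₂)) =
        fun z => -(ρ * D₁ * D₂ * (g z * (Real.exp a * (rootPoly K₂).eval k * D₁))) := by
      refine Continuous.ext_on (dense_compl_singleton k) ?_ ?_ fun z hz => ?_
      · have h1 := (rootPoly J).continuous
        have h2 := E.continuous
        fun_prop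
      · fun_prop
      · refine mul_left_cancel₀ (sub_ne_zero.2 hz) ?_
        have h1 := hg z
        have h2 := hwev z
        rw [hEK] at h2
        linear_combination ρ * D₁ * D₂ * h1 - ((rootPoly K₁).eval k * D₂) * h2
    have h1 := congrFun hlim k
    simp only [hgk] at h1
    have h2 : (numG β K).eval k = -(β k ^ 2 * k * k * E.eval k) := eval_nevNum_self hk
    have h3 : (numG β K).eval k = ρ * (k * (rootPoly Q).eval k) := by
      rw [hnum, rootPoly_insert h0Q]; simp
    have h4 := hprod k
    have h5 := hphi k
    have h6 := hsign k hk
    have hk0 : k ≠ 0 := fun h => h0K (h ▸ hk)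
    have hK2k : (rootPoly K₂).eval k ≠ 0 := fun h =>
      hKQ k hk (hK₂ (eval_rootPoly_eq_zero.1 h))
    have ea : Real.exp a = Real.exp (a / 2) * Real.exp (a / 2) := by
      rw [← Real.exp_add]; congr 1; ring
    rw [ea] at h1
    have hxpos := Real.exp_pos (a / 2)
    generalize Real.exp (a / 2) = x at *
    generalize (phi S w u a).eval k = f at *
    rw [← h5] at h1 h4 h6
    have hsq : f ^ 2 = β k ^ 2 * (k * γ) := by
      have hne : ρ * k * D₂ * (rootPoly K₂).eval k * (D₁ * x) ^ 2 ≠ 0 := by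
        have := hxpos.ne'
        simp [hρ, hk0, hD2, hK2k, hD1, this]
      refine mul_left_cancel₀ hne ?_
      linear_combination ρ * k * D₂ * D₁ * x * f * h4 + D₂ * (rootPoly J).eval k * D₁ * x * f *
        (h2 - h3) - β k ^ 2 * k ^ 2 * h1
    have hfpos : 0 < β k * f := by
      have h7 : β k * (D₁ * (x * f) * D₁) = (β k * f) * (D₁ ^ 2 * x) := by ring
      rw [h7] at h6
      exact pos_of_mul_pos_left h6 (by positivity)
    have hsqrt := Real.sqrt_pos.2 hγ
    rw [eq_div_iff hsqrt.ne']
    have h8 : (β k * Real.sqrt (k * γ) - f) * (β k * Real.sqrt (k * γ) + f) = 0 := by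
      have := Real.sq_sqrt hγ.le
      linear_combination β k ^ 2 * this - hsq
    rcases mul_eq_zero.1 h8 with h9 | h9
    · linarith
    · exfalso
      have h10 : β k * f = -(β k ^ 2 * Real.sqrt (k * γ)) := by
        linear_combination β k * h9
      have := hβ k hk
      have : 0 < β k ^ 2 * Real.sqrt (k * γ) := by positivity
      linarith

/-! ### Sufficiency of the conditions -/

/-- The conditions on the data are sufficient: the weights are those found from the sets of
eigenvalues with nonzero and with zero value at `a`. -/
theorem exists_weights_of_conditions (a : ℝ) {N : ℕ} (hN : 1 ≤ N) {lam al : Fin N → ℝ}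
    (hi : ∀ j : Fin N, al j = 0 → G lam al (lam j) = 0)
    (hii : ∀ i j k : Fin N, (i : ℕ) + 1 = j → (j : ℕ) + 1 = k → al j = 0 → al i * al k < 0)
    (hT : ClassT lam al) : ∃ (S : Finset ℝ) (w u : ℝ → ℝ), (∀ s, 0 ≤ u s) ∧
      (∀ z : ℂ, aeval z (wron S w u) = 0 ↔ ∃ i, (lam i : ℂ) = z) ∧
      ∀ i, al i = (phi S w u a).eval (lam i) / Real.sqrt (lam i *
        ∑ s ∈ S, (w s + 2 * lam i * u s) * (phi S w u s).eval (lam i) ^ 2) := by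
  classical
  obtain ⟨hmono, hs, j₀, hj₀, hneg, hpos⟩ := hT
  have hinj := hmono.injective
  have hltneg : ∀ i : Fin N, (i : ℕ) < j₀ → lam i < 0 := fun i h => by
    have h1 := (hneg ⟨j₀ - 1, by omega⟩ (by simp; omega)).1
    exact (hmono.monotone (by rw [Fin.le_def]; simp; omega)).trans_lt h1
  have hgepos : ∀ i : Fin N, j₀ ≤ (i : ℕ) → 0 < lam i := fun i h => by
    have h1 := (hpos ⟨j₀, by omega⟩ rfl).1
    exact h1.trans_le (hmono.monotone (by rw [Fin.le_def]; exact h))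
  have hlam : ∀ i, lam i ≠ 0 := fun i => by
    rcases Nat.lt_or_ge i j₀ with h | h
    · exact (hltneg i h).ne
    · exact (hgepos i h).ne'
  set β : ℝ → ℝ := Function.extend lam al 0 with hβ
  have hβlam : ∀ i, β (lam i) = al i := fun i => hinj.extend_apply _ _ _
  set K : Finset ℝ := (univ.filter fun i => al i ≠ 0).image lam with hK
  set J : Finset ℝ := (univ.filter fun i => al i = 0).image lam with hJ
  have hmemK : ∀ i, lam i ∈ K ↔ al i ≠ 0 := fun i => by
    rw [hK, mem_image]
    exact ⟨fun ⟨t, ht, h⟩ => hinj h ▸ (mem_filter.1 ht).2,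
      fun h => ⟨i, mem_filter.2 ⟨mem_univ _, h⟩, rfl⟩⟩
  have hK' : ∀ k ∈ K, ∃ i, lam i = k ∧ al i ≠ 0 := fun k hk => by
    obtain ⟨i, hi, rfl⟩ := mem_image.1 hk
    exact ⟨i, rfl, (mem_filter.1 hi).2⟩
  have hJ' : ∀ k ∈ J, ∃ i, lam i = k ∧ al i = 0 := fun k hk => by
    obtain ⟨i, hi, rfl⟩ := mem_image.1 hk
    exact ⟨i, rfl, (mem_filter.1 hi).2⟩
  have hsumK : ∀ g : ℝ → ℝ → ℝ, (∀ x, g x 0 = 0) → ∑ k ∈ K, g k (β k) = ∑ i, g (lam i) (al i) := by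
    intro g hg
    rw [hK, sum_image fun _ _ _ _ h => hinj h, sum_filter]
    refine sum_congr rfl fun i _ => ?_
    by_cases h : al i = 0
    · simp [h, hg]
    · rw [if_pos h, hβlam]
  have hprodKJ : rootPoly J * rootPoly K = ∏ i, (X - C (lam i)) := by
    rw [rootPoly, rootPoly, hJ, hK, prod_image fun _ _ _ _ h => hinj h,
      prod_image fun _ _ _ _ h => hinj h]
    exact prod_filter_mul_prod_filter_not univ (fun i => al i = 0) _
  have hnumG : ∀ z, z ∉ K → (numG β K).eval z = (rootPoly K).eval z * G lam al z := by
    intro z hz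
    have e1 := hsumK (fun _ y => y ^ 2) (by simp)
    have e2 := hsumK (fun x y => y ^ 2 * x) (by simp)
    have e3 := hsumK (fun x y => y ^ 2 * x * x / (x - z)) (by simp)
    rw [numG, eval_nevNum hz, e1, e2, e3, G]
    congr 1
    have e4 : ∑ i, al i ^ 2 * lam i = ∑ i, lam i * al i ^ 2 := sum_congr rfl fun i _ => by ring
    have e5 : ∑ i, al i ^ 2 * lam i * lam i / (lam i - z) =
        ∑ i, lam i ^ 2 * al i ^ 2 / (lam i - z) :=
      sum_congr rfl fun i _ => by rw [show al i ^ 2 * lam i * lam i = lam i ^ 2 * al i ^ 2 by ring]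
    rw [e4, e5]; ring
  have h0K : (0 : ℝ) ∉ K := fun h => by
    obtain ⟨i, h1, -⟩ := hK' 0 h
    exact hlam i h1
  have hKne : K.Nonempty := by
    rcases Nat.eq_zero_or_pos j₀ with h | h
    · exact ⟨_, (hmemK ⟨0, by omega⟩).2 (hpos _ h.symm).2.ne'⟩
    · exact ⟨_, (hmemK ⟨j₀ - 1, by omega⟩).2 (hneg _ (by simp; omega)).2.ne'⟩
  have hβK : ∀ k ∈ K, β k ≠ 0 := fun k hk => by
    obtain ⟨i, rfl, h⟩ := hK' k hk
    rwa [hβlam]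
  have hr : ∀ k ∈ K, 0 < β k ^ 2 * k * k := fun k hk => by
    have h1 : k ≠ 0 := fun h => h0K (h ▸ hk)
    have h2 := hβK k hk
    rw [mul_assoc]
    exact mul_pos (by positivity) (mul_self_pos.2 h1)
  have hG0 : ∀ x, (numG β K).eval x = 0 → x ∉ K ∧ G lam al x = 0 := fun x hx => by
    have h1 : x ∉ K := fun h => eval_nevNum_ne_zero hr h hx
    rw [hnumG x h1] at hx
    exact ⟨h1, (mul_eq_zero.1 hx).resolve_left fun h => h1 (eval_rootPoly_eq_zero.1 h)⟩
  have huniq : ∀ x y, x < y → (numG β K).eval x = 0 → (numG β K).eval y = 0 →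
      ∃ k ∈ K, x < k ∧ k < y := by
    intro x y hxy hx hy
    by_contra! h
    obtain ⟨h1, h2⟩ := hG0 x hx
    obtain ⟨h3, h4⟩ := hG0 y hy
    refine G_ne_G hlam hxy (fun i hal => ?_) hs (h2.trans h4.symm)
    have h5 := (hmemK i).2 hal
    rcases lt_trichotomy (lam i) x with h6 | h6 | h6
    · exact Or.inl h6
    · exact absurd (h6 ▸ h5) h1
    · exact Or.inr (lt_of_le_of_ne (h _ h5 h6) fun h7 => h3 (h7 ▸ h5))
  have hJ0 : ∀ i, al i = 0 → (numG β K).eval (lam i) = 0 := fun i h => by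
    rw [hnumG _ fun h' => (hmemK i).1 h' h, hi i h, mul_zero]
  obtain ⟨S, w, u, hu, ⟨m, hm, hwron⟩, hphiJ, hphiK⟩ := exists_weights_of_values (J := J) a hKne h0K
    (fun h => by
      obtain ⟨i, h1, -⟩ := hJ' 0 h
      exact hlam i h1) hβK
    (by rw [hsumK (fun _ y => y ^ 2) (by simp)]; exact hs)
    (fun j hj => by
      obtain ⟨i, rfl, h⟩ := hJ' j hj
      exact hJ0 i h) huniq
    (fun k₁ k₂ hgap j hj h1 h2 => by
      obtain ⟨i₁, rfl, hi₁⟩ := hK' k₁ hgap.left_mem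
      obtain ⟨i₂, rfl, hi₂⟩ := hK' k₂ hgap.right_mem
      obtain ⟨t, rfl, ht⟩ := hJ' j hj
      have h3 := hmono.lt_iff_lt.1 h1
      have h4 := hmono.lt_iff_lt.1 h2
      rw [Fin.lt_def] at h3 h4
      -- the neighbours of a point of `J` are not in `J`, as a gap contains only one zero of `G`
      have hl : (i₁ : ℕ) + 1 = t := by
        by_contra hne
        set p : Fin N := ⟨t - 1, by omega⟩ with hp
        have hp1 : lam i₁ < lam p := hmono (by rw [Fin.lt_def, hp]; simp; omega)
        have hp2 : lam p < lam t := hmono (by rw [Fin.lt_def, hp]; simp; omega)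
        by_cases hpz : al p = 0
        · obtain ⟨k, hk, h5, h6⟩ := huniq _ _ hp2 (hJ0 p hpz) (hJ0 t ht)
          rcases hgap.le_or_le k hk with h7 | h7 <;> linarith
        · rcases hgap.le_or_le _ ((hmemK p).2 hpz) with h7 | h7 <;> linarith
      have hr : (t : ℕ) + 1 = i₂ := by
        by_contra hne
        set p : Fin N := ⟨t + 1, by omega⟩ with hp
        have hp1 : lam p < lam i₂ := hmono (by rw [Fin.lt_def, hp]; simp; omega)
        have hp2 : lam t < lam p := hmono (by rw [Fin.lt_def, hp]; simp)
        by_cases hpz : al p = 0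
        · obtain ⟨k, hk, h5, h6⟩ := huniq _ _ hp2 (hJ0 t ht) (hJ0 p hpz)
          rcases hgap.le_or_le k hk with h7 | h7 <;> linarith
        · rcases hgap.le_or_le _ ((hmemK p).2 hpz) with h7 | h7 <;> linarith
      rw [hβlam, hβlam]
      exact hii i₁ t i₂ hl hr ht)
    (fun k hk hno => by
      obtain ⟨i, rfl, hal⟩ := hK' k hk
      rw [hβlam]
      rcases Nat.lt_or_ge i j₀ with h | h
      · set p : Fin N := ⟨j₀ - 1, by omega⟩ with hp
        obtain ⟨h1, h2⟩ := hneg p (by rw [hp]; simp; omega)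
        by_cases hip : i = p
        · rwa [hip]
        · have h3 : lam i < lam p := hmono (lt_of_le_of_ne (by rw [Fin.le_def, hp]; simp; omega) hip)
          exact absurd ⟨h3, h1⟩ (hno _ ((hmemK p).2 h2.ne')).2
      · set p : Fin N := ⟨j₀, by omega⟩ with hp
        obtain ⟨h1, h2⟩ := hpos p rfl
        by_cases hip : i = p
        · rwa [hip]
        · have h3 : lam p < lam i :=
            hmono (lt_of_le_of_ne (by rw [Fin.le_def]; exact h) (Ne.symm hip))
          exact absurd ⟨h1, h3⟩ (hno _ ((hmemK p).2 h2.ne')).1)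
  refine ⟨S, w, u, hu, fun z => ?_, fun i => ?_⟩
  · have h1 := congrArg (aeval z) (hwron.trans hprodKJ)
    rw [map_mul, aeval_C, map_prod] at h1
    have h2 : aeval z (wron S w u) = 0 ↔ ∏ i, aeval z (X - C (lam i)) = 0 := by
      rw [← h1, mul_eq_zero]
      simp [hm]
    rw [h2, prod_eq_zero_iff]
    simp only [mem_univ, true_and, map_sub, aeval_X, aeval_C, sub_eq_zero, Complex.coe_algebraMap]
    exact exists_congr fun i => eq_comm
  · by_cases h : al i = 0
    · rw [hphiJ (lam i) (mem_image.2 ⟨i, mem_filter.2 ⟨mem_univ _, h⟩, rfl⟩), zero_div, h]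
    · rw [← hphiK (lam i) ((hmemK i).2 h), hβlam]

end CamassaHolm

theorem theorem3p18 (a : ℝ) (N : ℕ) (hN : 1 ≤ N) (lam al : Fin N → ℝ) :
    (∃ H : CamassaHolm.DiscretePair, H.IsInteriorSpectralData a lam al) ↔
      ((∀ j : Fin N, al j = 0 → CamassaHolm.G lam al (lam j) = 0) ∧
        (∀ i j k : Fin N, (i : ℕ) + 1 = j → (j : ℕ) + 1 = k → al j = 0 → al i * al k < 0) ∧
        CamassaHolm.ClassT lam al) := by
  constructor
  · rintro ⟨H, hH⟩
    obtain ⟨S, w, u, hR, ha, hu⟩ := H.exists_represents a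
    obtain ⟨hmono, hspec, hal⟩ := (hR.isInteriorSpectralData_iff a lam al).1 hH
    refine CamassaHolm.conditions_of_data ha hu hmono (fun z => ?_) hal
    have h1 := hspec (z : ℂ)
    rw [CamassaHolm.aeval_ofReal] at h1
    exact_mod_cast h1
  · rintro ⟨hi, hii, hT⟩
    obtain ⟨S, w, u, hu, hspec, hal⟩ := CamassaHolm.exists_weights_of_conditions a hN hi hii hT
    obtain ⟨H, hR⟩ := CamassaHolm.DiscretePair.exists_of_weights S w u hu
    exact ⟨H, (hR.isInteriorSpectralData_iff a lam al).2 ⟨hT.1, hspec, hal⟩⟩
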